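/- Let $M$ be a finite-dimensional smooth Riemannian manifold without boundary (Hausdorff, second countable), $f\colon M\to M$ a $C^1$ diffeomorphism, and $\Lambda\subset M$ a compact set with $f(\Lambda)=\Lambda$. A $df$-invariant splitting $T_\Lambda M=E\oplus F$ with bundles of constant dimension is called dominated if there is $N\ge1$ such that $\|df^N_x v\|\le\frac12\|df^N_x w\|$ for all $x\in\Lambda$ and all unit vectors $v\in E_x$, $w\in F_x$. Suppose that $\Lambda$ carries a dominated splitting $E\oplus_{<}F$, and let $\tilde\Lambda=\bigcap_{k\in\mathbb Z}f^k(U)$ be the maximal invariant set of a neighborhood $U$ of $\Lambda$, such that $\tilde\Lambda$ is compact (for instance, $U$ compact) and $E\oplus_{<}F$ extends to a dominated splitting over $\tilde\Lambda$, still denoted $E\oplus_{<}F$. For a compact invariant set $K$, let $\mathcal M(K)$ be the set of $f$-invariant Borel probability measures supported on $K$. Fix a dense sequence $(\varphi_n)_{n\ge1}$ in $C^0(\tilde\Lambda)$ and let $$D(\mu,\nu)=\sum_{n\ge1}\frac{1}{2^n\|\varphi_n\|_\infty}\Big|\int\varphi_n\,d\mu-\int\varphi_n\,d\nu\Big|$$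 (terms with $\varphi_n=0$ being $0$), a metric for the weak$*$ topology on probability measures on $\tilde\Lambda$. For $\nu\in\mathcal M(\tilde\Lambda)$ let $$\lambda_E^+(\nu)=\lim_{n\to\infty}\frac1n\int\log\|df^n_{/E}\|\,d\nu,\qquad \lambda_F^-(\nu)=\lim_{n\to\infty}\frac1n\int\log\|(df^n_{/F})^{-1}\|^{-1}\,d\nu$$ be the maximal Lyapunov exponent of $\nu$ in $E$ and the minimal Lyapunov exponent of $\nu$ in $F$ (with the conventions $\lambda_E^+(\nu)=-\infty$ if $E=0$ and $\lambda_F^-(\nu)=+\infty$ if $F=0$). The Lyapunov exponent of a nonzero $v\in T_xM$ is $\limsup_{n\to\infty}\frac1n\log\|df^n_xv\|$. An invariant probability measure $\mu$ is hyperbolic of $s$-index $m$ if, for $\mu$-almost every $x$, there are nonzero vectors of $T_xM$ with negative and with positive exponent, no nonzero vector has exponent zero, and the vectors with negative exponent span a space of dimension $m$. A compact invariant set $\Gamma$ is hyperbolic of $s$-index $m$ if there are a $df$-invariant splitting $T_\Gamma M=E^s\oplus E^u$ with $\dim E^s=m$ and constants $C,\ell>0$ such that $\|df^n_xv\|\le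 Ce^{-n\ell}\|v\|$ and $\|df^{-n}_xw\|\le Ce^{-n\ell}\|w\|$ for all $x\in\Gamma$, $n\ge0$, $v\in E^s_x$, $w\in E^u_x$. **Proposition.** 1. Let $\mu_1,\dots,\mu_k\in\mathcal M(\Lambda)$ be ergodic hyperbolic measures of $s$-index $\dim E$. Then there are $\varkappa>0$ and $\lambda>0$ such that every $\nu\in\mathcal M(\tilde\Lambda)$ with $D(\nu,\eta)<\varkappa$ for some $\eta$ in the simplex $\{\sum_j s_j\mu_j: s_j\ge0,\ \sum_js_j=1\}$ satisfies $$\lambda_E^+(\nu)<-\lambda<0<\lambda<\lambda_F^-(\nu),$$ and, if moreover $\nu$ is ergodic, then $\nu$ is hyperbolic of $s$-index $\dim E$. 2. Let $\Gamma\subset\Lambda$ be a compact invariant hyperbolic set of $s$-index $\dim E$. Then there are $\varkappa>0$ and $\lambda>0$ such that every $\nu\in\mathcal M(\tilde\Lambda)$ with $D(\nu,\eta)<\varkappa$ for some $\eta\in\mathcal M(\Gamma)$ satisfies $$\lambda_E^+(\nu)<-\lambda<0<\lambda<\lambda_F^-(\nu).$$ -/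

import Mathlib

open Set Filter Topology MeasureTheory Manifold Bundle
open scoped NNReal ContDiff

noncomputable section

section DominatedDynamics

variable {d : ℕ} {M : Type*} [TopologicalSpace M] [ChartedSpace (EuclideanSpace ℝ (Fin d)) M]

/-- The iterate `f ^ k`, `k ∈ ℤ`, of a `C¹` diffeomorphism, as a map `M → M`. -/
def zIter (f : M ≃ₘ^1⟮𝓡 d, 𝓡 d⟯ M) (k : ℤ) : M → M :=
  ⇑((f.toEquiv : Equiv.Perm M) ^ k)

/-- The tangent map `d(f ^ k)` at `x`. -/
def dIter (f : M ≃ₘ^1⟮𝓡 d, 𝓡 d⟯ M) (k : ℤ) (x : M) :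
    TangentSpace (𝓡 d) x →L[ℝ] TangentSpace (𝓡 d) (zIter f k x) :=
  mfderiv (𝓡 d) (𝓡 d) (zIter f k) x

/-- `Λ` is `f`-invariant: `f(Λ) = Λ`. -/
def IsFInvariant (f : M ≃ₘ^1⟮𝓡 d, 𝓡 d⟯ M) (Λ : Set M) : Prop :=
  f '' Λ = Λ

/-- The maximal `f`-invariant subset `⋂ k ∈ ℤ, f^k(U)` of `U`. -/
def maxInvariant (f : M ≃ₘ^1⟮𝓡 d, 𝓡 d⟯ M) (U : Set M) : Set M :=
  ⋂ k : ℤ, zIter f k '' U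

/-- Over the points of `Λ`, the tangent spaces split as `V ⊕ W`, the splitting is invariant under
`df`, and `V` has constant dimension `m`. (The values of `V`, `W` off `Λ` play no role.) -/
def IsInvariantSplitting (f : M ≃ₘ^1⟮𝓡 d, 𝓡 d⟯ M) (Λ : Set M) (m : ℕ)
    (V W : (x : M) → Submodule ℝ (TangentSpace (𝓡 d) x)) : Prop :=
  ∀ x ∈ Λ, IsCompl (V x) (W x) ∧ Module.finrank ℝ (V x) = m ∧
    (V x).map (mfderiv (𝓡 d) (𝓡 d) f x).toLinearMap = V (f x) ∧
    (W x).map (mfderiv (𝓡 d) (𝓡 d) f x).toLinearMap = W (f x)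

variable [RiemannianBundle (fun x : M => TangentSpace (𝓡 d) x)]

/-- `T_Λ M = E ⊕_< F` is a dominated splitting with `dim E = m`: it is `df`-invariant and there is
`N ≥ 1` such that `‖df^N v‖ ≤ ½ ‖df^N w‖` for all unit vectors `v ∈ E_x`, `w ∈ F_x`, `x ∈ Λ`. -/
def IsDominatedSplitting (f : M ≃ₘ^1⟮𝓡 d, 𝓡 d⟯ M) (Λ : Set M) (m : ℕ)
    (E F : (x : M) → Submodule ℝ (TangentSpace (𝓡 d) x)) : Prop :=
  IsInvariantSplitting f Λ m E F ∧
  ∃ N : ℕ, 1 ≤ N ∧ ∀ x ∈ Λ, ∀ v ∈ E x, ∀ w ∈ F x, ‖v‖ = 1 → ‖w‖ = 1 →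
    ‖dIter f N x v‖ ≤ 1 / 2 * ‖dIter f N x w‖

/-- `Γ` is a (uniformly) hyperbolic set whose stable bundle has dimension `m`. -/
def IsHyperbolicSet (f : M ≃ₘ^1⟮𝓡 d, 𝓡 d⟯ M) (Γ : Set M) (m : ℕ) : Prop :=
  ∃ Es Eu : (x : M) → Submodule ℝ (TangentSpace (𝓡 d) x),
    IsInvariantSplitting f Γ m Es Eu ∧
    ∃ C > (0 : ℝ), ∃ l > (0 : ℝ), ∀ x ∈ Γ, ∀ n : ℕ,
      (∀ v ∈ Es x, ‖dIter f n x v‖ ≤ C * Real.exp (-(n * l)) * ‖v‖) ∧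
      (∀ w ∈ Eu x, ‖dIter f (-n) x w‖ ≤ C * Real.exp (-(n * l)) * ‖w‖)

/-- The Lyapunov exponent `limsup_{n → ∞} (1/n) log ‖df^n_x v‖` of a nonzero vector `v` at `x`.
(For almost every `x`, with respect to any invariant probability measure with compact support, the
upper limit is a limit by Oseledets' theorem.) -/
def lyapunovExponent (f : M ≃ₘ^1⟮𝓡 d, 𝓡 d⟯ M) (x : M) (v : TangentSpace (𝓡 d) x) : EReal :=
  limsup (fun n : ℕ => ((1 / (n : ℝ) * Real.log ‖dIter f n x v‖ : ℝ) : EReal)) atTop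

/-- There are negative and positive, but no zero, Lyapunov exponents at `x`. -/
def IsHyperbolicPoint (f : M ≃ₘ^1⟮𝓡 d, 𝓡 d⟯ M) (x : M) : Prop :=
  (∀ v : TangentSpace (𝓡 d) x, v ≠ 0 → lyapunovExponent f x v ≠ 0) ∧
  (∃ v : TangentSpace (𝓡 d) x, v ≠ 0 ∧ lyapunovExponent f x v < 0) ∧
  (∃ v : TangentSpace (𝓡 d) x, v ≠ 0 ∧ 0 < lyapunovExponent f x v)

/-- The stable space at `x`: the span of the vectors whose Lyapunov exponent is negative. -/
def stableSpace (f : M ≃ₘ^1⟮𝓡 d, 𝓡 d⟯ M) (x : M) : Submodule ℝ (TangentSpace (𝓡 d) x) :=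
  Submodule.span ℝ {v | v ≠ 0 ∧ lyapunovExponent f x v < 0}

/-- The norm `‖df^k_{/V_x}‖` of the restriction of `df^k` to the subspace `V_x` of `T_x M`. -/
def restrictedNorm (f : M ≃ₘ^1⟮𝓡 d, 𝓡 d⟯ M)
    (V : (x : M) → Submodule ℝ (TangentSpace (𝓡 d) x)) (k : ℤ) (x : M) : ℝ :=
  ‖(dIter f k x).comp (V x).subtypeL‖

variable [MeasurableSpace M]

/-- `𝓜(K)`: the `f`-invariant Borel probability measures supported on `K`. -/
def invMeasures (f : M ≃ₘ^1⟮𝓡 d, 𝓡 d⟯ M) (K : Set M) : Set (Measure M) :=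
  {μ | IsProbabilityMeasure μ ∧ MeasurePreserving f μ μ ∧ μ Kᶜ = 0}

/-- `μ` is hyperbolic and its `s`-index (the number of its negative Lyapunov exponents, counted with
multiplicity) is `m`. -/
def IsHyperbolicMeasure (f : M ≃ₘ^1⟮𝓡 d, 𝓡 d⟯ M) (μ : Measure M) (m : ℕ) : Prop :=
  ∀ᵐ x ∂μ, IsHyperbolicPoint f x ∧ Module.finrank ℝ (stableSpace f x) = m

/-- `a` is the maximal Lyapunov exponent of `ν` in `V`,
`a = lim_{n → ∞} (1/n) ∫ log ‖df^n_{/V}‖ dν`, with the convention `log 0 = -∞` if `V = 0`. -/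
def IsMaxExponent (f : M ≃ₘ^1⟮𝓡 d, 𝓡 d⟯ M)
    (V : (x : M) → Submodule ℝ (TangentSpace (𝓡 d) x)) (ν : Measure M) (a : EReal) : Prop :=
  ((∀ᵐ x ∂ν, V x = ⊥) ∧ a = ⊥) ∨
  ((∀ᵐ x ∂ν, V x ≠ ⊥) ∧
    (∀ n : ℕ, Integrable (fun x => Real.log (restrictedNorm f V n x)) ν) ∧
    Tendsto (fun n : ℕ =>
      ((1 / (n : ℝ) * ∫ x, Real.log (restrictedNorm f V n x) ∂ν : ℝ) : EReal)) atTop (𝓝 a))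

/-- `b` is the minimal Lyapunov exponent of `ν` in `V`,
`b = lim_{n → ∞} (1/n) ∫ log ‖(df^n_{/V})⁻¹‖⁻¹ dν`, where `(df^n_{/V_x})⁻¹` is the restriction of
`df^{-n}` to `V_{f^n(x)}`; with the convention `log (0⁻¹) = +∞` if `V = 0`. -/
def IsMinExponent (f : M ≃ₘ^1⟮𝓡 d, 𝓡 d⟯ M)
    (V : (x : M) → Submodule ℝ (TangentSpace (𝓡 d) x)) (ν : Measure M) (b : EReal) : Prop :=
  ((∀ᵐ x ∂ν, V x = ⊥) ∧ b = ⊤) ∨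
  ((∀ᵐ x ∂ν, V x ≠ ⊥) ∧
    (∀ n : ℕ, Integrable (fun x => Real.log (restrictedNorm f V (-n) (zIter f n x))⁻¹) ν) ∧
    Tendsto (fun n : ℕ =>
      ((1 / (n : ℝ) * ∫ x, Real.log (restrictedNorm f V (-n) (zIter f n x))⁻¹ ∂ν : ℝ) : EReal))
      atTop (𝓝 b))

/-- `λ_E⁺(ν) < -l` and `l < λ_F⁻(ν)`. -/
def ExponentGap (f : M ≃ₘ^1⟮𝓡 d, 𝓡 d⟯ M)
    (E F : (x : M) → Submodule ℝ (TangentSpace (𝓡 d) x)) (ν : Measure M) (l : ℝ) : Prop :=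
  ∃ a b : EReal, IsMaxExponent f E ν a ∧ IsMinExponent f F ν b ∧
    a < ((-l : ℝ) : EReal) ∧ (l : EReal) < b

end DominatedDynamics

/-- The distance `D(μ, ν) = ∑_{n ≥ 1} |∫ φ_n dμ - ∫ φ_n dν| / (2^n ‖φ_n‖_∞)` between measures
supported on `K`, for a sequence `φ` of continuous functions on `K` (indexed from `0` here).
A zero function contributes `0`. -/
def weakStarDist {M : Type*} [TopologicalSpace M] [MeasurableSpace M] {K : Set M}
    (φ : ℕ → C(K, ℝ)) (μ ν : Measure M) : ℝ :=
  ∑' n : ℕ, 1 / (2 ^ (n + 1) * ⨆ x : K, |φ n x|) *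
    |(∫ x : K, φ n x ∂(μ.comap Subtype.val)) - ∫ x : K, φ n x ∂(ν.comap Subtype.val)|

/-- The simplex of the convex combinations `∑ s_i μ_i`. -/
def measureSimplex {M : Type*} [MeasurableSpace M] {k : ℕ} (μ : Fin k → Measure M) :
    Set (Measure M) :=
  {η | ∃ s : Fin k → ℝ≥0, ∑ i, s i = 1 ∧ η = ∑ i, s i • μ i}

end

/-!
Write `K` for the maximal invariant set `maxInvariant f U`.

Both exponents are limits of `(1 / n) ∫ ψ_n dν`, up to sign, for the sequences `ψ_n = log
‖df^n_{/E}‖` (`logNorm`) and `ψ_n = log ‖(df^n_{/F})⁻¹‖` (`logInvNorm`). These sequences are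
subadditive along orbits and consist of continuous functions on `K`, because the bundles of a
dominated splitting are continuous (`IsDominatedSplitting.isContinuousSubbundleOn`): any limit of
the spaces `E x` satisfies the same domination inequalities as `E` at the limit point, and a
dominated splitting is unique (`le_of_dominated`). By Fekete's lemma the limit lies below each of
its terms, so a bound `∫ ψ_n dη ≤ -c n` at a single time `n` yields a bound on the exponent of `η`.
At a fixed time the integral is continuous in the measure for the distance `D`
(`exists_weakStarDist_integral_lt`). It is therefore enough to find one time `n` and one `c > 0`
with `∫ ψ_n dη ≤ -c n` for all `η` in the simplex, or in `𝓜(Γ)`: this is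
`IsDominatedSplitting.exists_exponentGap`. For the simplex, affinity reduces to the measures `μ_j`.

For an ergodic hyperbolic measure `μ` of index `dim E`, domination forces the stable space to be
`E` almost everywhere (`IsDominatedAt.stableSpace_eq`): otherwise a vector of negative exponent has
a nonzero component in `F`, which makes all of `E`, and one more direction, stable. Along `E`,
every vector decreases exponentially, so `ψ_n ≤ -c n` eventually, almost everywhere, and dominated
convergence gives the bound in mean. Along `F`, the definition of the exponent as an upper limit
only gives, for each vector, infinitely many times of expansion, and Oseledets' theorem would be
the usual tool to pass to `‖(df^n_{/F})⁻¹‖`. It is avoided as follows. The exponents in `F x` are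
bounded away from `0`, by finiteness of the filtration by exponents, and uniformly in `x` by
ergodicity. By compactness of the unit sphere, all unit vectors of `F x` are expanded at rate `c`
before some time `N`, outside a set `lateSet` whose measure tends to `0` as `N` grows.
Concatenating these expansion times along an orbit (`stopping_time_bound`) and integrating
(`eventually_le_integral_of_stopping`) gives the bound in mean.

Conversely, an ergodic `ν` with `∫ ψ_n dν < 0` for both sequences is hyperbolic, since a Birkhoff
type upper bound (`Ergodic.ae_birkhoffSum_le`, by the same stopping times) makes both sequences
decrease linearly almost everywhere. Over a hyperbolic set `Γ`, the stable bundle is `E` by the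
same comparison of growths, and a compactness argument gives a common expansion time for all unit
vectors of `F` over `Γ`, which makes the expansion of `F` uniform.
-/

noncomputable section

/-! ### Iterates of the diffeomorphism and the derivative cocycle -/

section Cocycle

variable {d : ℕ} {M : Type*} [TopologicalSpace M] [ChartedSpace (EuclideanSpace ℝ (Fin d)) M]
  (f : M ≃ₘ^1⟮𝓡 d, 𝓡 d⟯ M)

lemma zIter_zero : zIter f 0 = id := by
  funext x; simp [zIter]

lemma zIter_one : zIter f 1 = f := by
  funext x; simp [zIter]

lemma zIter_add (k l : ℤ) : zIter f (k + l) = zIter f k ∘ zIter f l := by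
  funext x
  simp [zIter, zpow_add]

lemma zIter_natCast (n : ℕ) : zIter f n = f^[n] := by
  induction n with
  | zero => simp [zIter_zero]
  | succ n ih =>
    rw [Nat.cast_succ, zIter_add, ih, zIter_one, Function.iterate_succ]

lemma zIter_neg_apply (k : ℤ) (x : M) : zIter f (-k) (zIter f k x) = x := by
  rw [← Function.comp_apply (f := zIter f (-k)), ← zIter_add]
  simp [zIter_zero]

lemma zIter_apply_neg (k : ℤ) (x : M) : zIter f k (zIter f (-k) x) = x := by
  simpa using zIter_neg_apply f (-k) x

lemma contMDiff_zIter (k : ℤ) : ContMDiff (𝓡 d) (𝓡 d) 1 (zIter f k) := by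
  have hneg : zIter f (-1) = f.symm := by
    funext x
    simp only [zIter, zpow_neg, zpow_one]
    rfl
  induction k with
  | zero => rw [zIter_zero]; exact contMDiff_id
  | succ n ih => rw [zIter_add, zIter_one]; exact ih.comp f.contMDiff
  | pred n ih =>
    rw [sub_eq_add_neg, zIter_add, hneg]
    exact ih.comp f.symm.contMDiff

lemma continuous_zIter (k : ℤ) : Continuous (zIter f k) := (contMDiff_zIter f k).continuous

lemma mdifferentiable_zIter (k : ℤ) : MDifferentiable (𝓡 d) (𝓡 d) (zIter f k) :=
  (contMDiff_zIter f k).mdifferentiable one_ne_zero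

lemma image_zIter {K : Set M} (hK : IsFInvariant f K) (k : ℤ) : zIter f k '' K = K := by
  have hneg : zIter f (-1) '' K = K := by
    conv_lhs => rw [← show f '' K = K from hK]
    rw [← zIter_one f, ← image_comp, ← zIter_add]
    simp [zIter_zero]
  induction k with
  | zero => simp [zIter_zero]
  | succ n ih => rw [zIter_add, zIter_one, image_comp, show f '' K = K from hK, ih]
  | pred n ih => rw [sub_eq_add_neg, zIter_add, image_comp, hneg, ih]

lemma zIter_mem {K : Set M} (hK : IsFInvariant f K) (k : ℤ) {x : M} (hx : x ∈ K) :
    zIter f k x ∈ K := by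
  rw [← image_zIter f hK k]; exact mem_image_of_mem _ hx

lemma iterate_mem {K : Set M} (hK : IsFInvariant f K) (n : ℕ) {x : M} (hx : x ∈ K) :
    f^[n] x ∈ K := by
  rw [← zIter_natCast]; exact zIter_mem f hK n hx

lemma isFInvariant_maxInvariant (U : Set M) : IsFInvariant f (maxInvariant f U) := by
  have hbij : Function.Bijective f := f.toEquiv.bijective
  rw [IsFInvariant, maxInvariant, image_iInter hbij]
  have : ∀ k : ℤ, f '' (zIter f k '' U) = zIter f (1 + k) '' U := by
    intro k
    rw [zIter_add, image_comp, zIter_one]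
  simp only [this]
  exact (Equiv.addLeft (1 : ℤ)).surjective.iInter_comp fun k => zIter f k '' U

lemma subset_maxInvariant {Λ U : Set M} (hΛ : IsFInvariant f Λ) (hU : Λ ⊆ U) :
    Λ ⊆ maxInvariant f U := by
  refine subset_iInter fun k => ?_
  rw [← image_zIter f hΛ k]
  exact image_mono hU

/-- Invariance of a bundle under `df` gives invariance under all `d(f^k)`, `k ∈ ℤ`. -/
lemma map_dIter {K : Set M} (hK : IsFInvariant f K)
    {V : (x : M) → Submodule ℝ (TangentSpace (𝓡 d) x)}
    (hV : ∀ x ∈ K, (V x).map (mfderiv (𝓡 d) (𝓡 d) f x).toLinearMap = V (f x))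
    (k : ℤ) {x : M} (hx : x ∈ K) :
    (V x).map (dIter f k x).toLinearMap = V (zIter f k x) := by
  -- The type of `mfderiv g y` depends on `g y`, so that identities between iterates cannot be
  -- rewritten in it: they are used as equations `g = …` for a variable map `g`.
  have hcomp : ∀ k l : ℤ, ∀ y, ∀ g, g = zIter f k ∘ zIter f l →
      (V y).map (dIter f l y).toLinearMap = V (zIter f l y) →
      (V (zIter f l y)).map (dIter f k (zIter f l y)).toLinearMap = V (zIter f k (zIter f l y)) →
      (V y).map (mfderiv (𝓡 d) (𝓡 d) g y).toLinearMap = V (g y) := by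
    rintro k l y _ rfl h1 h2
    rw [mfderiv_comp y (mdifferentiable_zIter f k _) (mdifferentiable_zIter f l _)]
    refine (Submodule.map_comp _ _ _).trans ?_
    exact (congrArg _ h1).trans h2
  have hzero : ∀ y, ∀ g, g = id → (V y).map (mfderiv (𝓡 d) (𝓡 d) g y).toLinearMap = V (g y) := by
    rintro y _ rfl
    rw [mfderiv_id]
    exact Submodule.map_id _
  have hone : ∀ y ∈ K, (V y).map (dIter f 1 y).toLinearMap = V (zIter f 1 y) := by
    intro y hy
    have : ∀ g, g = ⇑f → (V y).map (mfderiv (𝓡 d) (𝓡 d) g y).toLinearMap = V (g y) := by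
      rintro _ rfl
      exact hV y hy
    exact this _ (zIter_one f)
  have hneg : ∀ y ∈ K, (V y).map (dIter f (-1) y).toLinearMap = V (zIter f (-1) y) := by
    intro y hy
    obtain ⟨z, rfl⟩ : ∃ z, y = zIter f 1 z := ⟨zIter f (-1) y, (zIter_apply_neg f 1 y).symm⟩
    have hz : z ∈ K := by simpa [zIter_neg_apply] using zIter_mem f hK (-1) hy
    have key : ∀ g, g = zIter f (-1) ∘ zIter f 1 → g = id →
        (V (zIter f 1 z)).map (dIter f (-1) (zIter f 1 z)).toLinearMap =
          V (zIter f (-1) (zIter f 1 z)) := by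
      rintro g rfl hg
      have h3 := hzero z _ hg
      rw [mfderiv_comp z (mdifferentiable_zIter f (-1) _) (mdifferentiable_zIter f 1 _)] at h3
      refine Eq.trans ?_ h3
      refine Eq.trans ?_ (Submodule.map_comp _ _ _).symm
      exact (congrArg _ (hone z hz)).symm
    exact key _ rfl (by rw [← zIter_add]; simp [zIter_zero])
  induction k with
  | zero => exact hzero x _ (zIter_zero f)
  | succ n ih =>
    exact hcomp 1 n x _ (by rw [← zIter_add, add_comm]) ih (hone _ (zIter_mem f hK _ hx))
  | pred n ih =>
    exact hcomp (-1) (-n) x _ (by rw [← zIter_add]; congr 1; ring) ih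
      (hneg _ (zIter_mem f hK _ hx))

/-! ### Coordinates on the tangent bundle -/

section Coordinates

variable [IsManifold (𝓡 d) 1 M]

/-- Reading a tangent vector at `x` in the trivialization of the tangent bundle around `x₀`. -/
def tangentRead (x₀ x : M) : TangentSpace (𝓡 d) x →L[ℝ] EuclideanSpace ℝ (Fin d) :=
  (trivializationAt (EuclideanSpace ℝ (Fin d)) (TangentSpace (𝓡 d) (M := M)) x₀).continuousLinearMapAt
    ℝ x

/-- The tangent vector at `x` with given coordinates in the trivialization around `x₀`. -/
def tangentWrite (x₀ x : M) : EuclideanSpace ℝ (Fin d) →L[ℝ] TangentSpace (𝓡 d) x :=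
  (trivializationAt (EuclideanSpace ℝ (Fin d)) (TangentSpace (𝓡 d) (M := M)) x₀).symmL ℝ x

/-- The neighborhood of `x₀` over which the tangent bundle is trivialized. -/
def tangentDomain (x₀ : M) : Set M :=
  (trivializationAt (EuclideanSpace ℝ (Fin d)) (TangentSpace (𝓡 d) (M := M)) x₀).baseSet

lemma tangentDomain_mem_nhds (x₀ : M) : tangentDomain (d := d) x₀ ∈ 𝓝 x₀ :=
  (trivializationAt (EuclideanSpace ℝ (Fin d)) (TangentSpace (𝓡 d) (M := M))
    x₀).open_baseSet.mem_nhds (FiberBundle.mem_baseSet_trivializationAt' x₀)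

lemma mem_tangentDomain (x₀ : M) : x₀ ∈ tangentDomain (d := d) x₀ :=
  mem_of_mem_nhds (tangentDomain_mem_nhds x₀)

lemma tangentWrite_read {x₀ x : M} (hx : x ∈ tangentDomain (d := d) x₀)
    (v : TangentSpace (𝓡 d) x) : tangentWrite x₀ x (tangentRead x₀ x v) = v :=
  (trivializationAt (EuclideanSpace ℝ (Fin d)) (TangentSpace (𝓡 d) (M := M))
    x₀).symmL_continuousLinearMapAt hx v

lemma tangentRead_write {x₀ x : M} (hx : x ∈ tangentDomain (d := d) x₀)
    (v : EuclideanSpace ℝ (Fin d)) : tangentRead x₀ x (tangentWrite x₀ x v) = v :=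
  (trivializationAt (EuclideanSpace ℝ (Fin d)) (TangentSpace (𝓡 d) (M := M))
    x₀).continuousLinearMapAt_symmL hx v

lemma tendsto_tangentWrite {ι : Type*} {l : Filter ι} {x₀ : M} {x : ι → M}
    {v : ι → EuclideanSpace ℝ (Fin d)} {v₀ : EuclideanSpace ℝ (Fin d)}
    (hx : Tendsto x l (𝓝 x₀)) (hv : Tendsto v l (𝓝 v₀)) :
    Tendsto (fun i => (⟨x i, tangentWrite x₀ (x i) (v i)⟩ : TangentBundle (𝓡 d) M)) l
      (𝓝 ⟨x₀, tangentWrite x₀ x₀ v₀⟩) := by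
  set e := trivializationAt (EuclideanSpace ℝ (Fin d)) (TangentSpace (𝓡 d) (M := M)) x₀
  rw [e.tendsto_nhds_iff (z := ⟨x₀, tangentWrite x₀ x₀ v₀⟩)
    (e.mem_source.2 (mem_tangentDomain x₀))]
  refine ⟨hx, ?_⟩
  have key : ∀ y ∈ tangentDomain (d := d) x₀, ∀ w,
      (e (⟨y, tangentWrite x₀ y w⟩ : TangentBundle (𝓡 d) M)).2 = w := by
    intro y hy w
    have := tangentRead_write hy w
    rw [tangentRead, Trivialization.continuousLinearMapAt_apply,
      Trivialization.linearMapAt_apply] at this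
    exact (if_pos hy).symm.trans this
  rw [key x₀ (mem_tangentDomain x₀)]
  refine hv.congr' ?_
  filter_upwards [hx (tangentDomain_mem_nhds (d := d) x₀)] with i hi
  rw [key _ hi]

lemma tendsto_tangentRead {ι : Type*} {l : Filter ι} {x₀ : M} {u : TangentSpace (𝓡 d) x₀}
    {p : ι → TangentBundle (𝓡 d) M} (hp : Tendsto p l (𝓝 ⟨x₀, u⟩)) :
    Tendsto (fun i => tangentRead x₀ (p i).1 (p i).2) l (𝓝 (tangentRead x₀ x₀ u)) := by
  set e := trivializationAt (EuclideanSpace ℝ (Fin d)) (TangentSpace (𝓡 d) (M := M)) x₀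
  rw [e.tendsto_nhds_iff (z := ⟨x₀, u⟩) (e.mem_source.2 (mem_tangentDomain x₀))] at hp
  have key : ∀ y ∈ tangentDomain (d := d) x₀, ∀ w,
      (e (⟨y, w⟩ : TangentBundle (𝓡 d) M)).2 = tangentRead x₀ y w := by
    intro y hy w
    rw [tangentRead, Trivialization.continuousLinearMapAt_apply,
      Trivialization.linearMapAt_apply]
    exact (if_pos hy).symm
  have h2 := hp.2
  rw [key x₀ (mem_tangentDomain x₀)] at h2
  refine h2.congr' ?_
  filter_upwards [hp.1 (tangentDomain_mem_nhds (d := d) x₀)] with i hi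
  exact key _ hi _

end Coordinates

/-! ### The Riemannian norm along the cocycle -/

variable [RiemannianBundle (fun x : M => TangentSpace (𝓡 d) x)]

lemma norm_dIter_add (k l : ℤ) (x : M) (v : TangentSpace (𝓡 d) x) :
    ‖dIter f (k + l) x v‖ = ‖dIter f k (zIter f l x) (dIter f l x v)‖ := by
  have : ∀ g, g = zIter f k ∘ zIter f l →
      ‖mfderiv (𝓡 d) (𝓡 d) g x v‖ = ‖dIter f k (zIter f l x) (dIter f l x v)‖ := by
    rintro _ rfl
    rw [mfderiv_comp x (mdifferentiable_zIter f k _) (mdifferentiable_zIter f l _)]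
    rfl
  exact this _ (zIter_add f k l)

lemma norm_dIter_zero (x : M) (v : TangentSpace (𝓡 d) x) : ‖dIter f 0 x v‖ = ‖v‖ := by
  have : ∀ g, g = id → ‖mfderiv (𝓡 d) (𝓡 d) g x v‖ = ‖v‖ := by
    rintro _ rfl
    rw [mfderiv_id]
    rfl
  exact this _ (zIter_zero f)

lemma dIter_ne_zero (k : ℤ) {x : M} {v : TangentSpace (𝓡 d) x} (hv : v ≠ 0) :
    dIter f k x v ≠ 0 := by
  intro h
  have h1 := norm_dIter_add f (-k) k x v
  rw [h, map_zero, norm_zero, neg_add_cancel, norm_dIter_zero] at h1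
  exact hv (norm_eq_zero.1 h1)

lemma norm_dIter_pos (k : ℤ) {x : M} {v : TangentSpace (𝓡 d) x} (hv : v ≠ 0) :
    0 < ‖dIter f k x v‖ := norm_pos_iff.2 (dIter_ne_zero f k hv)

/-- The seminorm `v ↦ ‖df^k v‖` on the tangent space at `x`. -/
def growthSeminorm (k : ℤ) (x : M) : Seminorm ℝ (TangentSpace (𝓡 d) x) :=
  (normSeminorm ℝ (TangentSpace (𝓡 d) (zIter f k x))).comp (dIter f k x).toLinearMap

lemma growthSeminorm_apply (k : ℤ) (x : M) (v : TangentSpace (𝓡 d) x) :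
    growthSeminorm f k x v = ‖dIter f k x v‖ := rfl

section Continuity

variable [IsManifold (𝓡 d) ∞ M]
    [IsContMDiffRiemannianBundle (𝓡 d) ∞ (EuclideanSpace ℝ (Fin d))
      (fun x : M => TangentSpace (𝓡 d) x)]

lemma isContinuousRiemannianBundle_tangent :
    IsContinuousRiemannianBundle (EuclideanSpace ℝ (Fin d))
      (fun x : M => TangentSpace (𝓡 d) x) := by
  obtain ⟨g, hg, h⟩ := IsContMDiffRiemannianBundle.exists_contMDiff (IB := 𝓡 d) (n := ∞)
    (F := EuclideanSpace ℝ (Fin d)) (E := fun x : M => TangentSpace (𝓡 d) x)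
  exact ⟨g, hg.continuous, h⟩

lemma continuous_norm_tangent :
    Continuous (fun p : TangentBundle (𝓡 d) M => ‖p.2‖) := by
  have := isContinuousRiemannianBundle_tangent (M := M) (d := d)
  have h : Continuous (fun p : TangentBundle (𝓡 d) M => inner ℝ p.2 p.2) :=
    Continuous.inner_bundle (F := EuclideanSpace ℝ (Fin d))
      (E := fun x : M => TangentSpace (𝓡 d) x) (b := fun p : TangentBundle (𝓡 d) M => p.1)
      (v := fun p => p.2) (w := fun p => p.2) continuous_id continuous_id
  have h2 : (fun p : TangentBundle (𝓡 d) M => ‖p.2‖) = fun p => √(inner ℝ p.2 p.2) := by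
    funext p
    rw [real_inner_self_eq_norm_sq, Real.sqrt_sq (norm_nonneg _)]
  rw [h2]
  exact h.sqrt

lemma continuous_norm_dIter (k : ℤ) :
    Continuous (fun p : TangentBundle (𝓡 d) M => ‖dIter f k p.1 p.2‖) := by
  have : IsManifold (𝓡 d) 1 M := IsManifold.of_le (n := ∞) (by norm_num)
  exact continuous_norm_tangent.comp ((contMDiff_zIter f k).continuous_tangentMap le_rfl)

end Continuity

variable [IsManifold (𝓡 d) ∞ M]
    [IsContMDiffRiemannianBundle (𝓡 d) ∞ (EuclideanSpace ℝ (Fin d))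
      (fun x : M => TangentSpace (𝓡 d) x)]

/-- The unit tangent vectors over a compact set form a compact set. -/
lemma isCompact_unitTangent {K : Set M} (hK : IsCompact K) :
    IsCompact {p : TangentBundle (𝓡 d) M | p.1 ∈ K ∧ ‖p.2‖ = 1} := by
  have : IsManifold (𝓡 d) 1 M := IsManifold.of_le (n := ∞) (by norm_num)
  have := isContinuousRiemannianBundle_tangent (M := M) (d := d)
  rw [isCompact_iff_ultrafilter_le_nhds]
  intro 𝒰 h𝒰
  rw [le_principal_iff] at h𝒰
  have hKU : ((𝒰.map (fun p : TangentBundle (𝓡 d) M => p.1) : Ultrafilter M) : Filter M) ≤ 𝓟 K := by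
    rw [le_principal_iff]
    have : ∀ᶠ p : TangentBundle (𝓡 d) M in 𝒰, p.1 ∈ K := by
      filter_upwards [h𝒰] with p hp using hp.1
    exact this
  obtain ⟨x₀, hx₀, hx⟩ := hK.ultrafilter_le_nhds _ hKU
  have hx' : Tendsto (fun p : TangentBundle (𝓡 d) M => p.1) 𝒰 (𝓝 x₀) := hx
  obtain ⟨C, hC, hev⟩ := eventually_norm_trivializationAt_lt (EuclideanSpace ℝ (Fin d))
    (fun x : M => TangentSpace (𝓡 d) x) x₀
  have hball : ∀ᶠ p : TangentBundle (𝓡 d) M in 𝒰,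
      tangentRead x₀ p.1 p.2 ∈ Metric.closedBall (0 : EuclideanSpace ℝ (Fin d)) C := by
    filter_upwards [h𝒰, hx' hev] with p hp hpC
    rw [mem_closedBall_zero_iff]
    refine ((tangentRead x₀ p.1).le_opNorm p.2).trans ?_
    rw [hp.2, mul_one]
    exact le_of_lt hpC
  obtain ⟨v₀, -, hv⟩ := (isCompact_closedBall (0 : EuclideanSpace ℝ (Fin d)) C).ultrafilter_le_nhds
    (𝒰.map fun p : TangentBundle (𝓡 d) M => tangentRead x₀ p.1 p.2) (le_principal_iff.2 hball)
  have hv' : Tendsto (fun p : TangentBundle (𝓡 d) M => tangentRead x₀ p.1 p.2) 𝒰 (𝓝 v₀) := hv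
  have hlim : Tendsto id (𝒰 : Filter (TangentBundle (𝓡 d) M)) (𝓝 ⟨x₀, tangentWrite x₀ x₀ v₀⟩) := by
    refine (tendsto_tangentWrite hx' hv').congr' ?_
    filter_upwards [hx' (tangentDomain_mem_nhds (d := d) x₀)] with p hp
    rw [tangentWrite_read hp]
    rfl
  refine ⟨⟨x₀, tangentWrite x₀ x₀ v₀⟩, ⟨hx₀, ?_⟩, hlim⟩
  have h1 := (continuous_norm_tangent.tendsto
    (⟨x₀, tangentWrite x₀ x₀ v₀⟩ : TangentBundle (𝓡 d) M)).comp hlim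
  refine tendsto_nhds_unique h1 (tendsto_const_nhds.congr' ?_)
  filter_upwards [h𝒰] with p hp
  exact hp.2.symm

/-- Over a compact set, `df` distorts the length of the tangent vectors by a bounded factor. -/
lemma exists_log_norm_bound {K : Set M} (hK : IsCompact K) (k : ℤ) :
    ∃ L : ℝ, 0 ≤ L ∧ ∀ x ∈ K, ∀ v : TangentSpace (𝓡 d) x,
      ‖dIter f k x v‖ ≤ Real.exp L * ‖v‖ ∧ ‖v‖ ≤ Real.exp L * ‖dIter f k x v‖ := by
  set S := {p : TangentBundle (𝓡 d) M | p.1 ∈ K ∧ ‖p.2‖ = 1}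
  have hpos : ∀ p ∈ S, 0 < ‖dIter f k p.1 p.2‖ := fun p hp => norm_dIter_pos f k (by
    rintro h
    have := hp.2
    rw [h, norm_zero] at this
    exact zero_ne_one this)
  have hcont : ContinuousOn (fun p : TangentBundle (𝓡 d) M => Real.log ‖dIter f k p.1 p.2‖) S :=
    (continuous_norm_dIter f k).continuousOn.log fun p hp => (hpos p hp).ne'
  obtain ⟨L, hL⟩ := (isCompact_unitTangent hK).exists_bound_of_continuousOn hcont
  refine ⟨|L|, abs_nonneg _, fun x hx v => ?_⟩
  rcases eq_or_ne v 0 with rfl | hv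
  · simp
  have hv0 : 0 < ‖v‖ := norm_pos_iff.2 hv
  have hS : (⟨x, ‖v‖⁻¹ • v⟩ : TangentBundle (𝓡 d) M) ∈ S :=
    ⟨hx, by rw [norm_smul, norm_inv, norm_norm, inv_mul_cancel₀ hv0.ne']⟩
  have h1 := (hL _ hS).trans (le_abs_self L)
  have h2 := hpos _ hS
  simp only [map_smul, norm_smul, norm_inv, norm_norm] at h1 h2
  rw [Real.norm_eq_abs, abs_le] at h1
  have h3 := (Real.log_le_iff_le_exp h2).1 h1.2
  have h4 := (Real.le_log_iff_exp_le h2).1 h1.1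
  rw [Real.exp_neg] at h4
  constructor
  · rwa [inv_mul_le_iff₀ hv0, mul_comm] at h3
  · rw [le_inv_mul_iff₀ hv0, mul_inv_le_iff₀ (Real.exp_pos _), mul_comm] at h4
    rwa [mul_comm] at h4 ⊢

end Cocycle

/-! ### Uniqueness of dominated splittings -/

section LinearAlgebra

open Module

/-- Uniqueness of the weak bundle of a dominated splitting, for the growth of the norms `a j` along
one forward orbit. If `E ⊕ F` is dominated and the vectors of `V` are dominated by those of `W`,
with `dim W` at least the codimension of `E`, then `V ≤ E`. A vector `e + g ∈ V` with nonzero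
component `g ∈ F` would grow at least like `g`, hence at least like any vector of `E ⊕ ℝ g`; by
dimension, `W` contains a nonzero vector of this space, and it would have to grow faster. -/
lemma le_of_dominated {T : Type*} [AddCommGroup T] [Module ℝ T] [FiniteDimensional ℝ T]
    (a : ℕ → Seminorm ℝ T) (ha : ∀ j v, v ≠ 0 → 0 < a j v) {E F V W : Submodule ℝ T}
    (hEF : E ⊔ F = ⊤) (hdim : finrank ℝ T ≤ finrank ℝ E + finrank ℝ W)
    (hE : ∀ j, ∀ v ∈ E, ∀ w ∈ F, a j v * a 0 w ≤ (1 / 2) ^ j * (a j w * a 0 v))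
    (hV : ∀ j, ∀ v ∈ V, ∀ w ∈ W, a j v * a 0 w ≤ (1 / 2) ^ j * (a j w * a 0 v)) :
    V ≤ E := by
  intro u hu
  obtain ⟨e, he, g, hg, rfl⟩ := Submodule.mem_sup.1 (hEF ▸ Submodule.mem_top (x := u) : u ∈ E ⊔ F)
  by_contra hne
  have hgE : g ∉ E := fun h => hne (E.add_mem he h)
  have hg0 : g ≠ 0 := fun h => hgE (h ▸ E.zero_mem)
  -- By dimension, `W` meets `E ⊕ ℝ g` in a nonzero vector `w`.
  obtain ⟨w, hw, hw0⟩ : ∃ w ∈ (E ⊔ Submodule.span ℝ {g}) ⊓ W, w ≠ 0 := by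
    apply Submodule.exists_mem_ne_zero_of_ne_bot
    intro h
    have h1 := Submodule.finrank_sup_add_finrank_inf_eq (E ⊔ Submodule.span ℝ {g}) W
    have h2 : finrank ℝ E < finrank ℝ (E ⊔ Submodule.span ℝ {g} : Submodule ℝ T) := by
      apply Submodule.finrank_lt_finrank_of_lt
      refine lt_of_le_of_ne le_sup_left fun h => hgE ?_
      rw [h]
      exact Submodule.mem_sup_right (Submodule.mem_span_singleton_self g)
    rw [h, finrank_bot] at h1
    have h3 := Submodule.finrank_le ((E ⊔ Submodule.span ℝ {g}) ⊔ W)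
    omega
  obtain ⟨e', he', z, hz, rfl⟩ := Submodule.mem_sup.1 hw.1
  obtain ⟨t, rfl⟩ := Submodule.mem_span_singleton.1 hz
  set D := a 0 e' + |t| * a 0 g
  have hα : 0 < a 0 g := ha 0 g hg0
  have hw0' : 0 < a 0 (e' + t • g) := ha 0 _ hw0
  -- All growth rates are compared with `a j g`, which cancels from the inequality.
  have key : ∀ j : ℕ, a 0 g * a 0 (e' + t • g) ≤
      (1 / 2) ^ j * (a 0 e * a 0 (e' + t • g) + D * a 0 (e + g)) := by
    intro j
    have hA : 0 < a j g := ha j g hg0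
    have hq0 : (0 : ℝ) ≤ (1 / 2) ^ j := by positivity
    have hq1 : ((1 : ℝ) / 2) ^ j ≤ 1 := pow_le_one₀ (by norm_num) (by norm_num)
    have h1 := hE j e he g hg
    have h2 := hE j e' he' g hg
    have h3 := hV j _ hu _ hw.2
    have h4 : a j (e' + t • g) ≤ a j e' + |t| * a j g := by
      refine (map_add_le_add _ _ _).trans ?_
      rw [map_smul_eq_mul, Real.norm_eq_abs]
    have h5 : a j g - a j e ≤ a j (e + g) := by
      have := map_sub_le_add (a j) (e + g) e
      rw [add_sub_cancel_left] at this
      linarith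
    have h2' : a j e' * a 0 g ≤ a j g * a 0 e' :=
      h2.trans (mul_le_of_le_one_left (by positivity) hq1)
    have h6 : a 0 g * a j (e' + t • g) ≤ a j g * D := by
      have := mul_le_mul_of_nonneg_left h4 hα.le
      simp only [D]
      nlinarith
    have h7 : a j g * (a 0 g - (1 / 2) ^ j * a 0 e) ≤ a 0 g * a j (e + g) := by
      have := mul_le_mul_of_nonneg_left h5 hα.le
      nlinarith
    have h8 : a j g * ((a 0 g - (1 / 2) ^ j * a 0 e) * a 0 (e' + t • g)) ≤
        a j g * ((1 / 2) ^ j * (D * a 0 (e + g))) := by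
      calc _ = (a j g * (a 0 g - (1 / 2) ^ j * a 0 e)) * a 0 (e' + t • g) := by ring
        _ ≤ (a 0 g * a j (e + g)) * a 0 (e' + t • g) := by gcongr
        _ = a 0 g * (a j (e + g) * a 0 (e' + t • g)) := by ring
        _ ≤ a 0 g * ((1 / 2) ^ j * (a j (e' + t • g) * a 0 (e + g))) := by gcongr
        _ = (1 / 2) ^ j * ((a 0 g * a j (e' + t • g)) * a 0 (e + g)) := by ring
        _ ≤ (1 / 2) ^ j * ((a j g * D) * a 0 (e + g)) := by
          have : 0 ≤ a 0 (e + g) := apply_nonneg _ _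
          gcongr
        _ = _ := by ring
    have h9 := le_of_mul_le_mul_left h8 hA
    nlinarith
  have hlim : Tendsto (fun j : ℕ => ((1 : ℝ) / 2) ^ j *
      (a 0 e * a 0 (e' + t • g) + D * a 0 (e + g))) atTop (𝓝 0) := by
    have := (tendsto_pow_atTop_nhds_zero_of_lt_one (r := (1 : ℝ) / 2)
      (by norm_num) (by norm_num)).mul_const (a 0 e * a 0 (e' + t • g) + D * a 0 (e + g))
    rwa [zero_mul] at this
  have := ge_of_tendsto' hlim key
  have := mul_pos hα hw0'
  linarith

end LinearAlgebra

/-! ### Stopping times and ergodic measures -/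

section Ergodic

/-- A growth estimate by stopping times. The sequence `a` loses at most `L` at each step, and
except at the times counted by `b`, it gains `c n` over the next `n` steps, for some `n ≤ N`. Up to
time `T` it then grows at rate `c`, except for a loss of `c + L` for each time counted by `b` and
for each of the at most `N` last steps. -/
lemma stopping_time_bound {a b : ℕ → ℝ} {c L : ℝ} {N T : ℕ} (hcL : 0 ≤ c + L)
    (hb : ∀ t, 0 ≤ b t) (hstep : ∀ t < T, a t - L ≤ a (t + 1))
    (hgood : ∀ t < T, 1 ≤ b t ∨
      ∃ n : ℕ, 1 ≤ n ∧ n ≤ N ∧ (t + n ≤ T → a t + c * n ≤ a (t + n))) :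
    a 0 + c * T - (c + L) * (∑ t ∈ Finset.range T, b t + N) ≤ a T := by
  have hdown : ∀ s t, t + s = T → a t - L * s ≤ a T := by
    intro s
    induction s with
    | zero => rintro t rfl; simp
    | succ s ih =>
      intro t ht
      have h1 := ih (t + 1) (by omega)
      have h2 := hstep t (by omega)
      push_cast
      linarith
  have key : ∀ s t, t + s = T →
      a t + c * s - (c + L) * (∑ t ∈ Finset.Ico t T, b t + N) ≤ a T := by
    intro s
    induction s using Nat.strong_induction_on with
    | _ s ih =>
      intro t ht
      have hsum0 : ∀ t, 0 ≤ ∑ t ∈ Finset.Ico t T, b t := fun t => Finset.sum_nonneg fun i _ => hb i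
      rcases Nat.eq_zero_or_pos s with rfl | hs
      · obtain rfl : t = T := by omega
        have : 0 ≤ (c + L) * N := by positivity
        simpa using this
      -- At a time counted by `b` one step is made, otherwise `n` steps; a block of steps that would
      -- end after `T` is replaced by the at most `N` remaining steps, each of which loses `L`.
      rcases hgood t (by omega) with h | ⟨n, hn1, hnN, hn⟩
      · have h1 := ih (s - 1) (by omega) (t + 1) (by omega)
        have h2 := hstep t (by omega)
        rw [Finset.sum_eq_sum_Ico_succ_bot (by omega : t < T)]
        rw [Nat.cast_sub hs, Nat.cast_one] at h1
        have : (c + L) * 1 ≤ (c + L) * b t := mul_le_mul_of_nonneg_left h hcL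
        nlinarith
      · by_cases hT : t + n ≤ T
        · have h1 := ih (s - n) (by omega) (t + n) (by omega)
          have h2 := hn hT
          rw [Nat.cast_sub (by omega)] at h1
          have h3 : ∑ t ∈ Finset.Ico (t + n) T, b t ≤ ∑ t ∈ Finset.Ico t T, b t :=
            Finset.sum_le_sum_of_subset_of_nonneg (Finset.Ico_subset_Ico_left (by omega))
              fun i _ _ => hb i
          have := mul_le_mul_of_nonneg_left h3 hcL
          nlinarith
        · have h1 := hdown s t ht
          have h2 : (s : ℝ) ≤ N := by exact_mod_cast (by omega : s ≤ N)
          have h3 : (s : ℝ) ≤ ∑ t ∈ Finset.Ico t T, b t + N := by linarith [hsum0 t]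
          have := mul_le_mul_of_nonneg_left h3 hcL
          nlinarith
  simpa using key T 0 (zero_add T)

variable {X : Type*} [MeasurableSpace X] {g : X → X} {μ : Measure X}

/-- The stopping time estimate in mean. The orbits visit `B N` with frequency `μ (B N)`, which is
small if `N` is large, so that the losses become negligible. -/
lemma eventually_le_integral_of_stopping [IsProbabilityMeasure μ] (hg : MeasurePreserving g μ μ)
    {B : ℕ → Set X} (hB : ∀ N, MeasurableSet (B N)) (hB0 : Tendsto (fun N => μ (B N)) atTop (𝓝 0))
    {Y : ℕ → X → ℝ} (hY : ∀ T, Integrable (Y T) μ) {c L c' : ℝ} (hc' : c' < c)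
    (h : ∀ N T : ℕ, ∀ᵐ x ∂μ, c * T - (c + L) *
      (∑ t ∈ Finset.range T, (B N).indicator 1 (g^[t] x) + N) ≤ Y T x) :
    ∀ᶠ T : ℕ in atTop, c' * T ≤ ∫ x, Y T x ∂μ := by
  have hreal : Tendsto (fun N => (c + L) * μ.real (B N)) atTop (𝓝 0) := by
    have := ((ENNReal.tendsto_toReal ENNReal.zero_ne_top).comp hB0).const_mul (c + L)
    simpa [Measure.real] using this
  obtain ⟨N, hN⟩ :=
    (hreal.eventually (gt_mem_nhds (show (0 : ℝ) < (c - c') / 2 by linarith))).exists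
  have hind : ∀ t, Integrable (fun x => (B N).indicator (1 : X → ℝ) (g^[t] x)) μ := fun t =>
    (hg.iterate t).integrable_comp_of_integrable
      ((integrable_const (1 : ℝ)).indicator (hB N))
  have hint : ∀ t, ∫ x, (B N).indicator (1 : X → ℝ) (g^[t] x) ∂μ = μ.real (B N) := by
    intro t
    have h1 := integral_map (μ := μ) (φ := g^[t]) (hg.iterate t).measurable.aemeasurable
      (f := (B N).indicator (1 : X → ℝ))
      ((measurable_one.indicator (hB N)).aestronglyMeasurable)
    rw [← h1, (hg.iterate t).map_eq, integral_indicator_one (hB N)]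
  have hlarge : ∀ᶠ T : ℕ in atTop, (c + L) * N ≤ (c - c') / 2 * T := by
    have : Tendsto (fun T : ℕ => (c - c') / 2 * (T : ℝ)) atTop atTop :=
      tendsto_natCast_atTop_atTop.const_mul_atTop (by linarith)
    exact this.eventually_ge_atTop _
  filter_upwards [hlarge] with T hT
  have hsum : Integrable (fun x => ∑ t ∈ Finset.range T, (B N).indicator (1 : X → ℝ) (g^[t] x)) μ :=
    integrable_finsetSum _ fun t _ => hind t
  have hadd : Integrable (fun x => (c + L) *
      (∑ t ∈ Finset.range T, (B N).indicator (1 : X → ℝ) (g^[t] x) + N)) μ :=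
    (hsum.add (integrable_const (N : ℝ))).const_mul (c + L)
  have hmono := integral_mono_ae ((integrable_const (c * T)).sub hadd) (hY T) (h N T)
  have heval : ∫ x, (c * T - (c + L) *
      (∑ t ∈ Finset.range T, (B N).indicator (1 : X → ℝ) (g^[t] x) + N)) ∂μ =
      c * T - (c + L) * (T * μ.real (B N) + N) := by
    rw [integral_sub (integrable_const _) hadd,
      integral_const_mul, integral_const_mul, integral_add hsum (integrable_const _),
      integral_finsetSum _ fun t _ => hind t]
    simp [hint]
  have hmono' : c * T - (c + L) * (T * μ.real (B N) + N) ≤ ∫ x, Y T x ∂μ := heval ▸ hmono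
  have hT0 : (0 : ℝ) ≤ T := T.cast_nonneg
  nlinarith

/-- A `0`-`1` law: for an ergodic measure, either almost all forward orbits stay in `H`, or almost
all of them leave `H`. -/
lemma Ergodic.ae_forall_iterate_mem_or [IsFiniteMeasure μ] (hg : Ergodic g μ) {H : Set X}
    (hH : MeasurableSet H) :
    (∀ᵐ x ∂μ, ∀ j, g^[j] x ∈ H) ∨ (∀ᵐ x ∂μ, ∃ j, g^[j] x ∉ H) := by
  set S : Set X := ⋂ j, g^[j] ⁻¹' H
  have hS : MeasurableSet S := MeasurableSet.iInter fun j => (hg.measurable.iterate j) hH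
  have hsub : S ⊆ g ⁻¹' S := by
    intro x hx
    simp only [S, mem_preimage, mem_iInter] at hx ⊢
    intro j
    simpa [Function.iterate_succ_apply] using hx (j + 1)
  rcases hg.ae_empty_or_univ_of_ae_le_preimage hS.nullMeasurableSet
    (LE.le.eventuallyLE hsub) with h | h
  · right
    filter_upwards [h] with x hx
    have : x ∉ S := fun hxS => (show x ∈ (∅ : Set X) from hx.mp hxS).elim
    simpa [S] using this
  · left
    filter_upwards [h] with x hx
    have : x ∈ S := hx.mpr trivial
    simpa [S] using this

/-- An antitone sequence of measurable sets that almost no point meets in all members has measure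
tending to `0`. -/
lemma tendsto_measure_antitone_zero [IsFiniteMeasure μ] {B : ℕ → Set X}
    (hB : ∀ N, MeasurableSet (B N)) (hanti : Antitone B) (h : ∀ᵐ x ∂μ, ∃ N, x ∉ B N) :
    Tendsto (fun N => μ (B N)) atTop (𝓝 0) := by
  have h1 := tendsto_measure_iInter_atTop (μ := μ) (fun N => (hB N).nullMeasurableSet) hanti
    ⟨0, measure_ne_top _ _⟩
  have h2 : μ (⋂ N, B N) = 0 := by
    rw [measure_eq_zero_iff_ae_notMem]
    filter_upwards [h] with x ⟨N, hN⟩ hx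
    exact hN (mem_iInter.1 hx N)
  rwa [h2] at h1

lemma measurable_birkhoffSum (hg : Measurable g) {φ : X → ℝ} (hφ : Measurable φ) (n : ℕ) :
    Measurable (birkhoffSum g φ n) := by
  unfold birkhoffSum
  exact Finset.measurable_sum _ fun k _ => hφ.comp (hg.iterate k)

/-- An upper bound as in Birkhoff's theorem, for an ergodic measure and a bounded function: at
almost every point, the Birkhoff sums stay below a line of any given slope larger than the
integral. Let `B N` be the set of points whose first `N` Birkhoff sums are all below the line of
slope `-c`. By the `0`-`1` law, either almost every orbit visits `⋂ N, B N`, which gives the claim,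
or almost no orbit does; then `μ (B N)` tends to `0`, and the stopping time estimate contradicts
the value of the integral. -/
lemma Ergodic.ae_birkhoffSum_le [IsProbabilityMeasure μ] (hg : Ergodic g μ) {φ : X → ℝ}
    (hφ : Measurable φ) {L : ℝ} (hL : ∀ x, |φ x| ≤ L) {c : ℝ} (hc : ∫ x, φ x ∂μ < -c) :
    ∀ᵐ x ∂μ, ∃ C, ∀ n : ℕ, birkhoffSum g φ n x ≤ C - c * n := by
  have hφi : Integrable φ μ := Integrable.of_bound hφ.aestronglyMeasurable L
    (ae_of_all _ fun x => by simpa using hL x)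
  have hSm := measurable_birkhoffSum hg.measurable hφ
  set B : ℕ → Set X := fun N => ⋂ n ∈ Finset.Icc 1 N, {x | birkhoffSum g φ n x ≤ -c * n}
  have hB : ∀ N, MeasurableSet (B N) := fun N =>
    Finset.measurableSet_biInter _ fun n _ => measurableSet_le (hSm n) measurable_const
  have hanti : Antitone B := fun N N' hN => by
    apply biInter_subset_biInter_left
    intro n hn
    simp only [Finset.coe_Icc, mem_Icc] at hn ⊢
    exact ⟨hn.1, hn.2.trans hN⟩
  set H : Set X := (⋂ N, B N)ᶜ
  have hH : MeasurableSet H := (MeasurableSet.iInter hB).compl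
  rcases hg.ae_forall_iterate_mem_or hH with h | h
  · exfalso
    have hB0 : Tendsto (fun N => μ (B N)) atTop (𝓝 0) := by
      apply tendsto_measure_antitone_zero hB hanti
      filter_upwards [h] with x hx
      simpa [H] using hx 0
    have hLc : 0 ≤ -c + L := by
      have : -L ≤ ∫ x, φ x ∂μ := by
        have := integral_mono (μ := μ) (integrable_const (-L)) hφi fun x => (abs_le.1 (hL x)).1
        simpa using this
      linarith
    obtain ⟨c'', h1, h2⟩ := exists_between hc
    have hSi : ∀ t, Integrable (fun x => φ (g^[t] x)) μ := fun t =>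
      (hg.toMeasurePreserving.iterate t).integrable_comp_of_integrable hφi
    have hSint : ∀ T : ℕ, ∫ x, birkhoffSum g φ T x ∂μ = T * ∫ x, φ x ∂μ := by
      intro T
      simp only [birkhoffSum]
      rw [integral_finsetSum _ fun t _ => hSi t]
      have : ∀ t, ∫ x, φ (g^[t] x) ∂μ = ∫ x, φ x ∂μ := by
        intro t
        rw [← integral_map (φ := g^[t]) (hg.toMeasurePreserving.iterate t).measurable.aemeasurable
          hφ.aestronglyMeasurable, (hg.toMeasurePreserving.iterate t).map_eq]
      simp [this]
    have hev := eventually_le_integral_of_stopping hg.toMeasurePreserving hB hB0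
      (Y := fun T x => birkhoffSum g φ T x)
      (fun T => integrable_finsetSum _ fun t _ => hSi t) h2
      (fun N T => ae_of_all _ fun x => by
        have := stopping_time_bound (a := fun t => birkhoffSum g φ t x)
          (b := fun t => (B N).indicator 1 (g^[t] x)) (N := N) (T := T) hLc
          (fun t => indicator_nonneg (fun _ _ => zero_le_one) _)
          (fun t _ => by
            rw [birkhoffSum_succ]
            linarith [(abs_le.1 (hL (g^[t] x))).1])
          (fun t _ => by
            by_cases ht : g^[t] x ∈ B N
            · left; simp [ht]
            · right
              simp only [B, mem_iInter, not_forall, mem_ofPred_eq, not_le] at ht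
              obtain ⟨n, hn, hlt⟩ := ht
              refine ⟨n, (Finset.mem_Icc.1 hn).1, (Finset.mem_Icc.1 hn).2, fun _ => ?_⟩
              rw [birkhoffSum_add]
              linarith)
        simpa using this)
    obtain ⟨T, hT, hT1⟩ := (hev.and (eventually_ge_atTop 1)).exists
    rw [hSint] at hT
    have : (0 : ℝ) < T := by exact_mod_cast hT1
    nlinarith
  · filter_upwards [h] with x ⟨j, hj⟩
    simp only [H, B, mem_compl_iff, not_not, mem_iInter, mem_ofPred_eq] at hj
    have hj' : ∀ n : ℕ, birkhoffSum g φ n (g^[j] x) ≤ -c * n := by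
      intro n
      rcases Nat.eq_zero_or_pos n with rfl | hn
      · simp
      · exact hj n n (Finset.mem_Icc.2 ⟨hn, le_rfl⟩)
    have hL0 : 0 ≤ L := (abs_nonneg _).trans (hL x)
    have hbd : ∀ n : ℕ, |birkhoffSum g φ n x| ≤ n * L := by
      intro n
      refine (Finset.abs_sum_le_sum_abs _ _).trans ?_
      refine (Finset.sum_le_sum fun k _ => hL _).trans ?_
      simp
    refine ⟨j * L + |c| * j, fun n => ?_⟩
    rcases le_total j n with hn | hn
    · obtain ⟨k, rfl⟩ := Nat.exists_eq_add_of_le hn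
      rw [birkhoffSum_add]
      have h1 := hj' k
      have h2 := (abs_le.1 (hbd j)).2
      have h3 : c * j ≤ |c| * j := by gcongr; exact le_abs_self c
      push_cast
      linarith
    · have h1 := (abs_le.1 (hbd n)).2
      have h2 : (n : ℝ) * L ≤ j * L := by gcongr
      have h3 : c * n ≤ |c| * j := by
        have : c * n ≤ |c| * n := by gcongr; exact le_abs_self c
        have h4 : |c| * n ≤ |c| * j := by gcongr
        linarith
      linarith

end Ergodic

/-! ### Subadditive sequences of continuous functions -/

section Subadditive

variable {X : Type*} [TopologicalSpace X] {g : X → X} {K : Set X}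

lemma integrable_of_continuousOn_compact [T2Space X] [MeasurableSpace X] [BorelSpace X]
    {μ : Measure X} [IsFiniteMeasure μ] (hK : IsCompact K) (hμ : μ Kᶜ = 0)
    {h : X → ℝ} (hh : ContinuousOn h K) : Integrable h μ := by
  have hres : μ.restrict K = μ :=
    Measure.restrict_eq_self_of_ae_mem (by rwa [ae_iff])
  have := hh.integrableOn_compact (μ := μ) hK
  rwa [IntegrableOn, hres] at this

/-- A sequence of functions, continuous on `K` and of at most linear growth there, that is
subadditive along the orbits of `g` in `K`. -/
structure IsSubadditiveOn (g : X → X) (K : Set X) (ψ : ℕ → X → ℝ) (L : ℝ) : Prop where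
  add_le : ∀ m n, ∀ x ∈ K, ψ (m + n) x ≤ ψ m (g^[n] x) + ψ n x
  bound : ∀ n, ∀ x ∈ K, |ψ n x| ≤ L * n
  continuousOn : ∀ n, ContinuousOn (ψ n) K

namespace IsSubadditiveOn

variable {ψ : ℕ → X → ℝ} {L : ℝ}

lemma nonneg (h : IsSubadditiveOn g K ψ L) {x : X} (hx : x ∈ K) : 0 ≤ L := by
  have := (abs_nonneg _).trans (h.bound 1 x hx)
  simpa using this

/-- A subadditive sequence is controlled by the Birkhoff sums of any of its members: the sums
`∑ i < p, ψ (n + i)` change from `n` to `n + 1` by at most `ψ p ∘ g^[n]`. -/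
lemma mul_le_birkhoffSum (h : IsSubadditiveOn g K ψ L) (hgK : ∀ n, ∀ x ∈ K, g^[n] x ∈ K) (p n : ℕ)
    {x : X} (hx : x ∈ K) :
    p * ψ (n + p) x ≤ 2 * (L * p * p) + birkhoffSum g (ψ p) n x := by
  have hL := h.nonneg hx
  have hT : ∀ n : ℕ, ∑ i ∈ Finset.range p, ψ (n + i) x ≤ L * p * p + birkhoffSum g (ψ p) n x := by
    intro n
    induction n with
    | zero =>
      have : ∀ i ∈ Finset.range p, ψ (0 + i) x ≤ L * p := by
        intro i hi
        refine (le_abs_self _).trans ((h.bound _ x hx).trans ?_)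
        have : ((0 + i : ℕ) : ℝ) ≤ p := by
          exact_mod_cast (by simpa using (Finset.mem_range.1 hi).le)
        gcongr
      refine (Finset.sum_le_sum this).trans ?_
      simp
      linarith
    | succ n ih =>
      have h1 : ∑ i ∈ Finset.range p, ψ (n + 1 + i) x + ψ n x =
          ∑ i ∈ Finset.range p, ψ (n + i) x + ψ (n + p) x := by
        rw [← Finset.sum_range_succ (fun i => ψ (n + i) x), Finset.sum_range_succ']
        simp only [add_zero]
        congr 1
        exact Finset.sum_congr rfl fun i _ => by congr 1; ring
      have h2 := h.add_le p n x hx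
      rw [add_comm p n] at h2
      rw [birkhoffSum_succ]
      linarith
  have hcomp : ∀ i ∈ Finset.range p, ψ (n + p) x ≤ ψ (n + i) x + L * p := by
    intro i hi
    have hi' := (Finset.mem_range.1 hi).le
    have h1 := h.add_le (p - i) (n + i) x hx
    rw [show p - i + (n + i) = n + p by omega] at h1
    have h2 := (le_abs_self _).trans (h.bound (p - i) _ (hgK (n + i) x hx))
    have h3 : L * ((p - i : ℕ) : ℝ) ≤ L * p := by
      gcongr
      exact_mod_cast Nat.sub_le p i
    linarith
  have h4 := Finset.sum_le_sum hcomp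
  rw [Finset.sum_add_distrib] at h4
  simp only [Finset.sum_const, Finset.card_range, nsmul_eq_mul] at h4
  have := hT n
  nlinarith

lemma integral_le [MeasurableSpace X] {μ : Measure X} [IsProbabilityMeasure μ]
    (h : IsSubadditiveOn g K ψ L) (hμ : μ Kᶜ = 0) (n : ℕ) : |∫ x, ψ n x ∂μ| ≤ L * n := by
  have := norm_integral_le_of_norm_le_const (μ := μ) (f := ψ n) (C := L * n)
    (by filter_upwards [show ∀ᵐ x ∂μ, x ∈ K by rwa [ae_iff]] with x hx using h.bound n x hx)
  simpa using this

variable [T2Space X] [MeasurableSpace X] [BorelSpace X] {μ : Measure X}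

lemma integrable [IsFiniteMeasure μ] (h : IsSubadditiveOn g K ψ L) (hK : IsCompact K)
    (hμ : μ Kᶜ = 0) (n : ℕ) : Integrable (ψ n) μ :=
  integrable_of_continuousOn_compact hK hμ (h.continuousOn n)

/-- The averages of a subadditive sequence converge to a limit below each of them (Fekete). -/
lemma exists_tendsto [IsProbabilityMeasure μ] (h : IsSubadditiveOn g K ψ L) (hK : IsCompact K)
    (hμ : μ Kᶜ = 0) (hg : MeasurePreserving g μ μ) :
    ∃ a : ℝ, Tendsto (fun n : ℕ => 1 / (n : ℝ) * ∫ x, ψ n x ∂μ) atTop (𝓝 a) ∧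
      ∀ n : ℕ, n ≠ 0 → a ≤ (∫ x, ψ n x ∂μ) / n := by
  have hae : ∀ᵐ x ∂μ, x ∈ K := by rwa [ae_iff]
  have hi := h.integrable hK hμ
  have hsub : Subadditive fun n => ∫ x, ψ n x ∂μ := by
    intro m n
    have hcomp : ∫ x, ψ m (g^[n] x) ∂μ = ∫ x, ψ m x ∂μ := by
      have hmp := hg.iterate n
      have h1 := integral_map (μ := μ) (φ := g^[n]) hmp.measurable.aemeasurable (f := ψ m)
        (by rw [hmp.map_eq]; exact (hi m).aestronglyMeasurable)
      rw [← h1, hmp.map_eq]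
    have hci : Integrable (fun x => ψ m (g^[n] x)) μ :=
      (hg.iterate n).integrable_comp_of_integrable (hi m)
    calc ∫ x, ψ (m + n) x ∂μ ≤ ∫ x, (ψ m (g^[n] x) + ψ n x) ∂μ := by
          apply integral_mono_ae (hi _) (hci.add (hi n))
          filter_upwards [hae] with x hx using h.add_le m n x hx
      _ = _ := by rw [integral_add hci (hi n), hcomp]
  have hbdd : BddBelow (range fun n : ℕ => (∫ x, ψ n x ∂μ) / n) := by
    refine ⟨-|L|, ?_⟩
    rintro _ ⟨n, rfl⟩
    rcases Nat.eq_zero_or_pos n with rfl | hn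
    · simp
    have hn' : (0 : ℝ) < n := by exact_mod_cast hn
    have h1 := (abs_le.1 (h.integral_le hμ n)).1
    have h2 : L * n ≤ |L| * n := by gcongr; exact le_abs_self L
    show -|L| ≤ (∫ x, ψ n x ∂μ) / n
    rw [le_div_iff₀ hn']
    linarith
  refine ⟨hsub.lim, ?_, fun n hn => hsub.lim_le_div hbdd hn⟩
  refine (hsub.tendsto_lim hbdd).congr fun n => ?_
  rw [one_div, div_eq_inv_mul]

/-- If one member of a subadditive sequence has negative integral with respect to an ergodic
measure, the sequence decreases linearly almost everywhere. -/
lemma ae_eventually_le [IsProbabilityMeasure μ] (h : IsSubadditiveOn g K ψ L) (hK : IsCompact K)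
    (hμ : μ Kᶜ = 0) (hgK : ∀ n, ∀ x ∈ K, g^[n] x ∈ K) (hg : Ergodic g μ) {p : ℕ}
    (hp : p ≠ 0) (hneg : ∫ x, ψ p x ∂μ < 0) :
    ∀ᵐ x ∂μ, ∃ c > 0, ∀ᶠ n : ℕ in atTop, ψ n x ≤ -c * n := by
  have hae : ∀ᵐ x ∂μ, x ∈ K := by rwa [ae_iff]
  have hKm := hK.measurableSet
  have hφm : Measurable (K.indicator (ψ p)) := by
    classical
    have := (h.continuousOn p).measurable_piecewise (g := (0 : X → ℝ))
      continuous_zero.continuousOn hKm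
    rwa [piecewise_eq_indicator] at this
  have hφL : ∀ x, |K.indicator (ψ p) x| ≤ |L * p| := by
    intro x
    by_cases hx : x ∈ K
    · simpa [hx] using (h.bound p x hx).trans (le_abs_self _)
    · simp [hx, -abs_mul]
  have hφi : ∫ x, K.indicator (ψ p) x ∂μ = ∫ x, ψ p x ∂μ := by
    apply integral_congr_ae
    filter_upwards [hae] with x hx using indicator_of_mem hx _
  obtain ⟨c, hc1, hc2⟩ := exists_between hneg
  have hbirk := hg.ae_birkhoffSum_le hφm hφL (c := -c) (by rw [hφi]; simpa using hc1)
  have hp' : (0 : ℝ) < p := by exact_mod_cast Nat.pos_of_ne_zero hp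
  filter_upwards [hbirk, hae] with x ⟨C, hC⟩ hx
  refine ⟨-c / (2 * p), div_pos (by linarith) (by linarith), ?_⟩
  have hlarge : ∀ᶠ n : ℕ in atTop, 2 * (L * p * p) + C - c * p ≤ -c / 2 * n := by
    have : Tendsto (fun n : ℕ => -c / 2 * (n : ℝ)) atTop atTop :=
      tendsto_natCast_atTop_atTop.const_mul_atTop (by linarith)
    exact this.eventually_ge_atTop _
  filter_upwards [hlarge, eventually_ge_atTop p] with n hn hnp
  obtain ⟨k, rfl⟩ := Nat.exists_eq_add_of_le' hnp
  have h1 := h.mul_le_birkhoffSum hgK p k hx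
  have h2 : birkhoffSum g (K.indicator (ψ p)) k x = birkhoffSum g (ψ p) k x := by
    apply Finset.sum_congr rfl
    intro i _
    exact indicator_of_mem (hgK i x hx) _
  have h3 := hC k
  rw [h2] at h3
  have h4 : (p : ℝ) * ψ (k + p) x ≤ p * (-(-c / (2 * p)) * (k + p : ℕ)) := by
    have : (p : ℝ) * (-(-c / (2 * p)) * (k + p : ℕ)) = c / 2 * (k + p : ℕ) := by
      field_simp
    rw [this]
    push_cast at hn ⊢
    linarith
  exact le_of_mul_le_mul_left h4 hp'

/-- If a subadditive sequence decreases linearly almost everywhere, so do its integrals. -/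
lemma eventually_integral_le [IsProbabilityMeasure μ] (h : IsSubadditiveOn g K ψ L)
    (hK : IsCompact K) (hμ : μ Kᶜ = 0)
    (hae : ∀ᵐ x ∂μ, ∃ c > 0, ∀ᶠ n : ℕ in atTop, ψ n x ≤ -c * n) :
    ∃ c > 0, ∀ᶠ n : ℕ in atTop, ∫ x, ψ n x ∂μ ≤ -c * n := by
  have hKae : ∀ᵐ x ∂μ, x ∈ K := by rwa [ae_iff]
  set u : ℕ → X → ℝ := fun n x => 1 / (n : ℝ) * ψ n x
  have hui : ∀ n, Integrable (u n) μ := fun n => (h.integrable hK hμ n).const_mul _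
  have hub : ∀ n, ∀ x ∈ K, |u n x| ≤ L := by
    intro n x hx
    rcases Nat.eq_zero_or_pos n with rfl | hn
    · simpa [u] using h.nonneg hx
    have hn' : (0 : ℝ) < n := by exact_mod_cast hn
    simp only [u, abs_mul, abs_of_pos (one_div_pos.2 hn')]
    rw [one_div, inv_mul_le_iff₀ hn', mul_comm]
    exact h.bound n x hx
  -- The positive parts of the averages tend to `0` in mean.
  have hpos : Tendsto (fun n => ∫ x, max (u n x) 0 ∂μ) atTop (𝓝 0) := by
    have := tendsto_integral_of_dominated_convergence (μ := μ) (F := fun n x => max (u n x) 0)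
      (f := fun _ => 0) (fun _ => |L|) (fun n => (hui n).pos_part.aestronglyMeasurable)
      (integrable_const _)
      (fun n => by
        filter_upwards [hKae] with x hx
        rw [Real.norm_eq_abs, abs_of_nonneg (le_max_right _ _)]
        exact max_le ((le_abs_self _).trans ((hub n x hx).trans (le_abs_self _))) (abs_nonneg _))
      (by
        filter_upwards [hae] with x ⟨c, hc, hev⟩
        refine tendsto_const_nhds.congr' ?_
        filter_upwards [hev] with n hn
        rw [eq_comm, max_eq_right_iff]
        refine mul_nonpos_of_nonneg_of_nonpos (by positivity) (hn.trans ?_)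
        have : 0 ≤ c * n := by positivity
        linarith)
    simpa using this
  -- A set of positive measure on which the decrease is uniform.
  obtain ⟨k, n₀, hD⟩ : ∃ k n₀ : ℕ,
      μ {x | ∀ n : ℕ, n₀ ≤ n → ψ n x ≤ -(1 / ((k : ℝ) + 1)) * n} ≠ 0 := by
    by_contra! hcon
    have h0 : μ (⋃ k : ℕ, ⋃ n₀ : ℕ, {x | ∀ n : ℕ, n₀ ≤ n → ψ n x ≤ -(1 / ((k : ℝ) + 1)) * n}) = 0 :=
      measure_iUnion_null fun k => measure_iUnion_null fun n₀ => hcon k n₀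
    rw [measure_eq_zero_iff_ae_notMem] at h0
    obtain ⟨x, hx, ⟨c, hc, hev⟩⟩ := (h0.and hae).exists
    apply hx
    obtain ⟨k, hk⟩ := exists_nat_one_div_lt hc
    obtain ⟨n₀, hn₀⟩ := eventually_atTop.1 hev
    refine mem_iUnion.2 ⟨k, mem_iUnion.2 ⟨n₀, fun n hn => (hn₀ n hn).trans ?_⟩⟩
    have : 1 / ((k : ℝ) + 1) * n ≤ c * n := by gcongr
    linarith
  set ε : ℝ := 1 / ((k : ℝ) + 1)
  have hε : 0 < ε := by positivity
  set D := {x | ∀ n : ℕ, n₀ ≤ n → ψ n x ≤ -ε * n}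
  have hDpos : 0 < μ.real D := by
    rw [Measure.real, ENNReal.toReal_pos_iff]
    exact ⟨pos_iff_ne_zero.2 hD, measure_lt_top _ _⟩
  have hnegp : ∀ n : ℕ, n₀ ≤ n → 1 ≤ n → ε * μ.real D ≤ ∫ x, max (-u n x) 0 ∂μ := by
    intro n hn hn1
    have hn' : (0 : ℝ) < n := by exact_mod_cast hn1
    have hm := mul_meas_ge_le_integral_of_nonneg (μ := μ) (f := fun x => max (-u n x) 0)
      (ae_of_all _ fun x => le_max_right (-u n x) 0) (hui n).neg.pos_part ε
    refine le_trans ?_ hm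
    gcongr
    · exact measure_ne_top _ _
    · intro x hx
      show ε ≤ max (-u n x) 0
      refine le_trans ?_ (le_max_left _ _)
      have := hx n hn
      show ε ≤ -(1 / (n : ℝ) * ψ n x)
      rw [one_div, ← mul_neg, le_inv_mul_iff₀ hn']
      linarith
  refine ⟨ε * μ.real D / 2, by positivity, ?_⟩
  filter_upwards [hpos.eventually (gt_mem_nhds (show 0 < ε * μ.real D / 2 by positivity)),
    eventually_ge_atTop n₀, eventually_ge_atTop 1] with n h1 h2 h3
  have hn' : (0 : ℝ) < n := by exact_mod_cast h3
  have h4 := hnegp n h2 h3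
  have h5 : ∫ x, u n x ∂μ = ∫ x, max (u n x) 0 ∂μ - ∫ x, max (-u n x) 0 ∂μ := by
    have hneg : Integrable (fun x => max (-u n x) 0) μ := (hui n).neg.pos_part
    rw [← integral_sub (hui n).pos_part hneg]
    congr 1
    funext x
    exact (max_zero_sub_eq_self (u n x)).symm
  have h6 : ∫ x, ψ n x ∂μ = n * ∫ x, u n x ∂μ := by
    simp only [u]
    rw [integral_const_mul]
    field_simp
  rw [h6]
  nlinarith

end IsSubadditiveOn

end Subadditive

/-! ### The weak-* distance -/

section WeakStar

variable {X : Type*} [TopologicalSpace X] [T2Space X] [MeasurableSpace X] [BorelSpace X]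
  {K : Set X}

/-- Measures on a compact set that are close for `weakStarDist` give close integrals to a given
continuous function. -/
lemma exists_weakStarDist_lt_integral (hK : IsCompact K) {φ : ℕ → C(K, ℝ)} (hφ : DenseRange φ)
    {h : X → ℝ} (hh : ContinuousOn h K) {ε : ℝ} (hε : 0 < ε) :
    ∃ κ > 0, ∀ ν η : Measure X, IsProbabilityMeasure ν → IsProbabilityMeasure η → ν Kᶜ = 0 →
      η Kᶜ = 0 → weakStarDist φ ν η < κ → |∫ x, h x ∂ν - ∫ x, h x ∂η| < ε := by
  have : CompactSpace K := isCompact_iff_compactSpace.1 hK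
  have hKm := hK.measurableSet
  obtain ⟨j, hj⟩ := hφ.exists_dist_lt (⟨K.domRestrict h, hh.domRestrict⟩ : C(K, ℝ))
    (show 0 < ε / 3 by positivity)
  set s : ℕ → ℝ := fun n => ⨆ x : K, |φ n x|
  have hs0 : ∀ n, 0 ≤ s n := fun n => Real.iSup_nonneg fun x => abs_nonneg _
  have hs : ∀ n (x : K), |φ n x| ≤ s n := fun n x => by
    refine le_ciSup (f := fun x : K => |φ n x|) ?_ x
    exact (isCompact_range ((φ n).continuous.abs)).bddAbove
  refine ⟨ε / 3 / (2 ^ (j + 1) * (s j + 1)), by have := hs0 j; positivity, ?_⟩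
  intro ν η hν hη hνK hηK hdist
  have hint : ∀ (g : C(K, ℝ)) (m : Measure X), IsProbabilityMeasure m → m Kᶜ = 0 →
      IsProbabilityMeasure (m.comap (Subtype.val : K → X)) := by
    intro g m hm hmK
    constructor
    rw [comap_subtype_coe_apply hKm m]
    simp only [image_univ, Subtype.range_coe_subtype]
    exact (prob_compl_eq_zero_iff hKm).1 hmK
  have hνp := hint (φ 0) ν hν hνK
  have hηp := hint (φ 0) η hη hηK
  have hcm : ∀ (g : C(K, ℝ)) (m : Measure K) [IsProbabilityMeasure m], Integrable g m :=
    fun g m _ =>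
    g.continuous.integrable_of_hasCompactSupport (HasCompactSupport.of_compactSpace _)
  have hbound : ∀ n (m : Measure K) [IsProbabilityMeasure m], |∫ x, φ n x ∂m| ≤ s n := by
    intro n m _
    have := norm_integral_le_of_norm_le_const (μ := m) (f := φ n) (C := s n)
      (ae_of_all _ fun x => hs n x)
    simpa using this
  set Δ : ℕ → ℝ := fun n => |(∫ x : K, φ n x ∂(ν.comap Subtype.val)) -
    ∫ x : K, φ n x ∂(η.comap Subtype.val)|
  have hΔ : ∀ n, Δ n ≤ 2 * s n := by
    intro n
    refine (abs_sub _ _).trans ?_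
    linarith [hbound n (ν.comap Subtype.val), hbound n (η.comap Subtype.val)]
  have hterm0 : ∀ n, 0 ≤ 1 / (2 ^ (n + 1) * s n) * Δ n := fun n => by
    have := hs0 n
    positivity
  have hsum : Summable fun n => 1 / (2 ^ (n + 1) * s n) * Δ n := by
    refine Summable.of_nonneg_of_le hterm0 (fun n => ?_) summable_geometric_two
    rcases (hs0 n).eq_or_lt with h0 | hpos
    · rw [← h0]; simp
    · calc 1 / (2 ^ (n + 1) * s n) * Δ n ≤ 1 / (2 ^ (n + 1) * s n) * (2 * s n) := by
            gcongr; exact hΔ n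
        _ = (1 / 2) ^ n := by
            rw [pow_succ, one_div_pow]; field_simp
  have hjle : 1 / (2 ^ (j + 1) * s j) * Δ j < ε / 3 / (2 ^ (j + 1) * (s j + 1)) :=
    (hsum.le_tsum j fun n _ => hterm0 n).trans_lt hdist
  have hΔj : Δ j < ε / 3 := by
    rcases (hs0 j).eq_or_lt with h0 | hpos
    · have := hΔ j
      rw [← h0] at this
      linarith
    · have hA : (0 : ℝ) < 2 ^ (j + 1) := by positivity
      rw [one_div, inv_mul_lt_iff₀ (by positivity)] at hjle
      refine hjle.trans_le ?_
      rw [mul_div_assoc', div_le_iff₀ (by positivity)]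
      nlinarith
  have hconv : ∀ m : Measure X, IsProbabilityMeasure m → m Kᶜ = 0 →
      IsProbabilityMeasure (m.comap (Subtype.val : K → X)) →
      |∫ x, h x ∂m - ∫ x : K, φ j x ∂(m.comap Subtype.val)| ≤ ε / 3 := by
    intro m hm hmK hmp
    have hres : m.restrict K = m := Measure.restrict_eq_self_of_ae_mem (by rwa [ae_iff])
    have h1 : ∫ x, h x ∂m = ∫ x : K, h x ∂(m.comap Subtype.val) := by
      rw [integral_subtype_comap hKm, hres]
    have h2 : Integrable (fun x : K => h x) (m.comap (Subtype.val : K → X)) :=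
      hcm ⟨K.domRestrict h, hh.domRestrict⟩ _
    rw [h1, ← integral_sub h2 (hcm (φ j) _)]
    have := norm_integral_le_of_norm_le_const (μ := m.comap (Subtype.val : K → X))
      (f := fun x : K => h x - φ j x) (C := ε / 3)
      (ae_of_all _ fun x => (ContinuousMap.dist_apply_le_dist
        (f := ⟨K.domRestrict h, hh.domRestrict⟩) (g := φ j) x).trans hj.le)
    simpa using this
  have e1 := abs_le.1 (hconv ν hν hνK hνp)
  have e2 := abs_le.1 (hconv η hη hηK hηp)
  have e3 := abs_lt.1 hΔj
  rw [abs_lt]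
  constructor <;> linarith

end WeakStar

/-! ### Limits of subspaces -/

section LimitSubspace

open Module

variable {ι H : Type*} [NormedAddCommGroup H] [InnerProductSpace ℝ H] [FiniteDimensional ℝ H]

/-- Along an ultrafilter, subspaces of constant dimension converge: limits of orthonormal bases span
the limit subspace. -/
lemma exists_limit_submodule (𝒰 : Ultrafilter ι) (S : ι → Submodule ℝ H) (n : ℕ)
    (hS : ∀ᶠ i in 𝒰, finrank ℝ (S i) = n) :
    ∃ S₀ : Submodule ℝ H, finrank ℝ S₀ = n ∧
      (∀ v₀ ∈ S₀, ∃ v : ι → H, (∀ᶠ i in 𝒰, v i ∈ S i) ∧ Tendsto v 𝒰 (𝓝 v₀)) ∧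
      (∀ (v : ι → H) (v₀ : H), (∀ᶠ i in 𝒰, v i ∈ S i) → Tendsto v 𝒰 (𝓝 v₀) → v₀ ∈ S₀) := by
  have hbasis : ∀ i, ∃ b : Fin n → H, finrank ℝ (S i) = n →
      Orthonormal ℝ b ∧ Submodule.span ℝ (range b) = S i := by
    intro i
    by_cases h : finrank ℝ (S i) = n
    · subst h
      refine ⟨fun k => (stdOrthonormalBasis ℝ (S i) k : H), fun _ => ⟨?_, ?_⟩⟩
      · exact (stdOrthonormalBasis ℝ (S i)).orthonormal.comp_linearIsometry (S i).subtypeₗᵢ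
      · have h1 := (stdOrthonormalBasis ℝ (S i)).toBasis.span_eq
        have h2 := congrArg (Submodule.map (S i).subtype) h1
        rw [Submodule.map_span, Submodule.map_top, Submodule.range_subtype, ← range_comp] at h2
        simpa [Function.comp_def] using h2
    · exact ⟨0, fun h' => absurd h' h⟩
  choose b hb using hbasis
  have hbS : ∀ᶠ i in 𝒰, Orthonormal ℝ (b i) ∧ Submodule.span ℝ (range (b i)) = S i :=
    hS.mono fun i hi => hb i hi
  obtain ⟨b₀, -, hb₀⟩ := (isCompact_closedBall (0 : Fin n → H) 1).ultrafilter_le_nhds (𝒰.map b)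
    (le_principal_iff.2 (by
      have : ∀ᶠ i in 𝒰, b i ∈ Metric.closedBall (0 : Fin n → H) 1 := by
        filter_upwards [hbS] with i hi
        rw [mem_closedBall_zero_iff, pi_norm_le_iff_of_nonneg zero_le_one]
        exact fun k => (hi.1.1 k).le
      exact this))
  have hb₀' : ∀ k, Tendsto (fun i => b i k) 𝒰 (𝓝 (b₀ k)) := fun k =>
    ((continuous_apply k).tendsto b₀).comp hb₀
  have horth : Orthonormal ℝ b₀ := by
    rw [orthonormal_iff_ite]
    intro k l
    refine tendsto_nhds_unique ((hb₀' k).inner (hb₀' l)) (tendsto_const_nhds.congr' ?_)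
    filter_upwards [hbS] with i hi
    exact (orthonormal_iff_ite.1 hi.1 k l).symm
  refine ⟨Submodule.span ℝ (range b₀), ?_, ?_, ?_⟩
  · rw [finrank_span_eq_card horth.linearIndependent, Fintype.card_fin]
  · intro v₀ hv₀
    obtain ⟨c, rfl⟩ := (Submodule.mem_span_range_iff_exists_fun ℝ).1 hv₀
    refine ⟨fun i => ∑ k, c k • b i k, ?_, tendsto_finsetSum _ fun k _ => (hb₀' k).const_smul (c k)⟩
    filter_upwards [hbS] with i hi
    rw [← hi.2]
    exact Submodule.sum_mem _ fun k _ => Submodule.smul_mem _ _ (Submodule.subset_span ⟨k, rfl⟩)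
  · intro v v₀ hv hlim
    have h1 : Tendsto (fun i => ∑ k, inner ℝ (b i k) (v i) • b i k) 𝒰
        (𝓝 (∑ k, inner ℝ (b₀ k) v₀ • b₀ k)) :=
      tendsto_finsetSum _ fun k _ => ((hb₀' k).inner hlim).smul (hb₀' k)
    have h2 : v₀ = ∑ k, inner ℝ (b₀ k) v₀ • b₀ k := by
      refine tendsto_nhds_unique hlim (h1.congr' ?_)
      filter_upwards [hbS, hv] with i hi hvi
      rw [← hi.2] at hvi
      obtain ⟨c, hc⟩ := (Submodule.mem_span_range_iff_exists_fun ℝ).1 hvi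
      rw [← hc]
      refine Finset.sum_congr rfl fun k _ => ?_
      rw [hi.1.inner_right_fintype]
    rw [h2]
    exact Submodule.sum_mem _ fun k _ => Submodule.smul_mem _ _ (Submodule.subset_span ⟨k, rfl⟩)

end LimitSubspace

/-! ### Continuity of dominated splittings -/

section DominatedContinuity

open Module

variable {d : ℕ} {M : Type*} [TopologicalSpace M] [ChartedSpace (EuclideanSpace ℝ (Fin d)) M]
  (f : M ≃ₘ^1⟮𝓡 d, 𝓡 d⟯ M)

instance finiteDimensional_tangentSpace (x : M) : FiniteDimensional ℝ (TangentSpace (𝓡 d) x) :=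
  inferInstanceAs (FiniteDimensional ℝ (EuclideanSpace ℝ (Fin d)))

lemma finrank_tangentSpace (x : M) : finrank ℝ (TangentSpace (𝓡 d) x) = d :=
  finrank_euclideanSpace_fin (𝕜 := ℝ) (n := d)

variable {f} {K : Set M} {m : ℕ} {E F V : (x : M) → Submodule ℝ (TangentSpace (𝓡 d) x)}

lemma dIter_mem (hK : IsFInvariant f K)
    (hV : ∀ x ∈ K, (V x).map (mfderiv (𝓡 d) (𝓡 d) f x).toLinearMap = V (f x))
    (k : ℤ) {x : M} (hx : x ∈ K) {v : TangentSpace (𝓡 d) x} (hv : v ∈ V x) :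
    dIter f k x v ∈ V (zIter f k x) := by
  rw [← map_dIter f hK hV k hx]
  exact Submodule.mem_map_of_mem hv

lemma exists_dIter_eq (hK : IsFInvariant f K)
    (hV : ∀ x ∈ K, (V x).map (mfderiv (𝓡 d) (𝓡 d) f x).toLinearMap = V (f x))
    (k : ℤ) {x : M} (hx : x ∈ K) {v : TangentSpace (𝓡 d) (zIter f k x)} (hv : v ∈ V (zIter f k x)) :
    ∃ u ∈ V x, dIter f k x u = v := by
  rw [← map_dIter f hK hV k hx] at hv
  exact hv

variable [RiemannianBundle (fun x : M => TangentSpace (𝓡 d) x)]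

/-- The domination in homogeneous form, iterated: after `j N` steps the ratio of the growths in `E`
and `F` is at most `2⁻ʲ`. -/
lemma IsDominatedSplitting.exists_forall_iterate (hK : IsFInvariant f K)
    (h : IsDominatedSplitting f K m E F) : ∃ N : ℕ, 1 ≤ N ∧ ∀ j : ℕ, ∀ x ∈ K, ∀ v ∈ E x, ∀ w ∈ F x,
      ‖dIter f (j * N) x v‖ * ‖w‖ ≤ (1 / 2) ^ j * (‖dIter f (j * N) x w‖ * ‖v‖) := by
  obtain ⟨hinv, N, hN, hdom⟩ := h
  refine ⟨N, hN, ?_⟩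
  have hone : ∀ x ∈ K, ∀ v ∈ E x, ∀ w ∈ F x,
      ‖dIter f N x v‖ * ‖w‖ ≤ 1 / 2 * (‖dIter f N x w‖ * ‖v‖) := by
    intro x hx v hv w hw
    rcases eq_or_ne v 0 with rfl | hv0
    · simp
    rcases eq_or_ne w 0 with rfl | hw0
    · simp
    have hv' : 0 < ‖v‖ := norm_pos_iff.2 hv0
    have hw' : 0 < ‖w‖ := norm_pos_iff.2 hw0
    have := hdom x hx (‖v‖⁻¹ • v) ((E x).smul_mem _ hv) (‖w‖⁻¹ • w) ((F x).smul_mem _ hw)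
      (by rw [norm_smul, norm_inv, norm_norm, inv_mul_cancel₀ hv'.ne'])
      (by rw [norm_smul, norm_inv, norm_norm, inv_mul_cancel₀ hw'.ne'])
    rw [map_smul, map_smul, norm_smul, norm_smul, norm_inv, norm_inv, norm_norm, norm_norm] at this
    rw [inv_mul_le_iff₀ hv'] at this
    calc _ ≤ ‖v‖ * (1 / 2 * (‖w‖⁻¹ * ‖dIter f N x w‖)) * ‖w‖ := by gcongr
      _ = _ := by field_simp
  intro j
  induction j with
  | zero =>
    intro x hx v hv w hw
    rw [Nat.cast_zero, zero_mul, norm_dIter_zero, norm_dIter_zero, pow_zero, one_mul, mul_comm]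
  | succ j ih =>
    intro x hx v hv w hw
    rcases eq_or_ne w 0 with rfl | hw0
    · simp
    have hE := fun y hy => (hinv y hy).2.2.1
    have hF := fun y hy => (hinv y hy).2.2.2
    have h1 := ih _ (zIter_mem f hK N hx) _ (dIter_mem hK hE N hx hv) _ (dIter_mem hK hF N hx hw)
    rw [← norm_dIter_add, ← norm_dIter_add] at h1
    have h2 := hone x hx v hv w hw
    have h3 : 0 < ‖dIter f N x w‖ := norm_dIter_pos f N hw0
    rw [show ((j + 1 : ℕ) : ℤ) * N = j * N + N by push_cast; ring]
    refine le_of_mul_le_mul_right ?_ h3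
    calc ‖dIter f (j * N + N) x v‖ * ‖w‖ * ‖dIter f N x w‖
        = (‖dIter f (j * N + N) x v‖ * ‖dIter f N x w‖) * ‖w‖ := by ring
      _ ≤ ((1 / 2) ^ j * (‖dIter f (j * N + N) x w‖ * ‖dIter f N x v‖)) * ‖w‖ := by gcongr
      _ = (1 / 2) ^ j * ‖dIter f (j * N + N) x w‖ * (‖dIter f N x v‖ * ‖w‖) := by ring
      _ ≤ (1 / 2) ^ j * ‖dIter f (j * N + N) x w‖ * (1 / 2 * (‖dIter f N x w‖ * ‖v‖)) := by gcongr
      _ = _ := by ring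

variable [IsManifold (𝓡 d) ∞ M]

variable (K V) in
/-- The subspaces `V x` depend continuously on `x ∈ K`: limits of unit vectors of `V` are in `V`,
and every vector of `V` is a limit of vectors of `V` over nearby points. -/
structure IsContinuousSubbundleOn : Prop where
  isCompact_unit : IsCompact {p : TangentBundle (𝓡 d) M | p.1 ∈ K ∧ p.2 ∈ V p.1 ∧ ‖p.2‖ = 1}
  eventually_exists : ∀ x₀ ∈ K, ∀ v₀ ∈ V x₀, ∀ O ∈ 𝓝 (⟨x₀, v₀⟩ : TangentBundle (𝓡 d) M),
    ∀ᶠ x in 𝓝[K] x₀, ∃ v ∈ V x, (⟨x, v⟩ : TangentBundle (𝓡 d) M) ∈ O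

variable [IsContMDiffRiemannianBundle (𝓡 d) ∞ (EuclideanSpace ℝ (Fin d))
      (fun x : M => TangentSpace (𝓡 d) x)]

/-- Continuity of the weak bundle `E` of a dominated splitting along an ultrafilter: every vector of
`E x₀` is a limit of vectors of `E (x i)`, and such limits are in `E x₀`. The times `r j` are
multiples of `N` in practice, positive ones to apply it to `E`, negative ones to apply it to the
other bundle. -/
lemma limit_mem_of_dominated (r : ℕ → ℤ) (hr : r 0 = 0)
    (hcompl : ∀ x ∈ K, IsCompl (E x) (F x)) (hdim : ∀ x ∈ K, finrank ℝ (E x) = m)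
    (hdom : ∀ j : ℕ, ∀ x ∈ K, ∀ v ∈ E x, ∀ w ∈ F x,
      ‖dIter f (r j) x v‖ * ‖w‖ ≤ (1 / 2) ^ j * (‖dIter f (r j) x w‖ * ‖v‖))
    {ι : Type*} (𝒰 : Ultrafilter ι) {x : ι → M} (hxK : ∀ᶠ i in 𝒰, x i ∈ K) {x₀ : M} (hx₀ : x₀ ∈ K)
    (hx : Tendsto x 𝒰 (𝓝 x₀)) (v₀ : TangentSpace (𝓡 d) x₀) :
    (v₀ ∈ E x₀ → ∃ v : (i : ι) → TangentSpace (𝓡 d) (x i), (∀ᶠ i in 𝒰, v i ∈ E (x i)) ∧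
      Tendsto (fun i => (⟨x i, v i⟩ : TangentBundle (𝓡 d) M)) 𝒰 (𝓝 ⟨x₀, v₀⟩)) ∧
    (∀ v : (i : ι) → TangentSpace (𝓡 d) (x i), (∀ᶠ i in 𝒰, v i ∈ E (x i)) →
      Tendsto (fun i => (⟨x i, v i⟩ : TangentBundle (𝓡 d) M)) 𝒰 (𝓝 ⟨x₀, v₀⟩) → v₀ ∈ E x₀) := by
  have hdom' : ∀ᶠ i in 𝒰, x i ∈ tangentDomain (d := d) x₀ := hx (tangentDomain_mem_nhds x₀)
  have hdimF : ∀ y ∈ K, finrank ℝ (F y) = d - m := by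
    intro y hy
    have := Submodule.finrank_add_eq_of_isCompl (hcompl y hy)
    rw [finrank_tangentSpace, hdim y hy] at this
    omega
  have hinj : ∀ y ∈ tangentDomain (d := d) x₀, Function.Injective (tangentRead (d := d) x₀ y) :=
    fun y hy => Function.LeftInverse.injective (tangentWrite_read hy)
  have hread : ∀ (G : (x : M) → Submodule ℝ (TangentSpace (𝓡 d) x)) (n : ℕ),
      (∀ y ∈ K, finrank ℝ (G y) = n) → ∀ᶠ i in 𝒰,
        finrank ℝ ((G (x i)).map (tangentRead (d := d) x₀ (x i)).toLinearMap) = n := by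
    intro G n hG
    filter_upwards [hxK, hdom'] with i hi hi'
    rw [← hG _ hi]
    exact (Submodule.equivMapOfInjective _ (hinj _ hi') (G (x i))).finrank_eq.symm
  obtain ⟨S, hSd, hS1, hS2⟩ := exists_limit_submodule 𝒰 _ _ (hread E m hdim)
  obtain ⟨S', hSd', hS1', -⟩ := exists_limit_submodule 𝒰 _ _ (hread F (d - m) hdimF)
  have hwinj : Function.Injective (tangentWrite (d := d) x₀ x₀) :=
    Function.LeftInverse.injective (tangentRead_write (mem_tangentDomain x₀))
  have hwrite : ∀ (G : (x : M) → Submodule ℝ (TangentSpace (𝓡 d) x)) (s : ι → _),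
      (∀ᶠ i in 𝒰, s i ∈ (G (x i)).map (tangentRead (d := d) x₀ (x i)).toLinearMap) →
      ∀ᶠ i in 𝒰, tangentWrite x₀ (x i) (s i) ∈ G (x i) := by
    intro G s hs
    filter_upwards [hs, hdom'] with i hi hi'
    obtain ⟨u, hu, hus⟩ := hi
    rw [← hus]
    show tangentWrite x₀ (x i) (tangentRead x₀ (x i) u) ∈ _
    rwa [tangentWrite_read hi']
  -- The limits of `E` and `F` satisfy the same domination inequalities at `x₀`, as these are closed
  -- conditions. By uniqueness of dominated splittings, the limit of `E` is `E x₀`.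
  have hVE : S.map (tangentWrite (d := d) x₀ x₀).toLinearMap = E x₀ := by
    apply Submodule.eq_of_le_of_finrank_eq
    · refine le_of_dominated (fun j => growthSeminorm f (r j) x₀)
        (fun j v hv => norm_dIter_pos f _ hv) (F := F x₀)
        (W := S'.map (tangentWrite (d := d) x₀ x₀).toLinearMap)
        (hcompl x₀ hx₀).sup_eq_top ?_ ?_ ?_
      · rw [← (Submodule.equivMapOfInjective _ hwinj S').finrank_eq, hSd', hdim x₀ hx₀,
          finrank_tangentSpace]
        omega
      · intro j v hv w hw
        simp only [growthSeminorm_apply, hr, norm_dIter_zero]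
        exact hdom j x₀ hx₀ v hv w hw
      · rintro j _ ⟨s, hs, rfl⟩ _ ⟨s', hs', rfl⟩
        simp only [growthSeminorm_apply, hr, norm_dIter_zero]
        obtain ⟨v, hv, hvs⟩ := hS1 s hs
        obtain ⟨w, hw, hws⟩ := hS1' s' hs'
        have hv' := hwrite E v hv
        have hw' := hwrite F w hw
        have tv := tendsto_tangentWrite hx hvs
        have tw := tendsto_tangentWrite hx hws
        have nd := fun k => (continuous_norm_dIter f k).tendsto
          (⟨x₀, tangentWrite x₀ x₀ s⟩ : TangentBundle (𝓡 d) M)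
        have nd' := fun k => (continuous_norm_dIter f k).tendsto
          (⟨x₀, tangentWrite x₀ x₀ s'⟩ : TangentBundle (𝓡 d) M)
        have nn := (continuous_norm_tangent (d := d) (M := M)).tendsto
          (⟨x₀, tangentWrite x₀ x₀ s⟩ : TangentBundle (𝓡 d) M)
        have nn' := (continuous_norm_tangent (d := d) (M := M)).tendsto
          (⟨x₀, tangentWrite x₀ x₀ s'⟩ : TangentBundle (𝓡 d) M)
        refine le_of_tendsto_of_tendsto (((nd (r j)).comp tv).mul (nn'.comp tw))
          ((((nd' (r j)).comp tw).mul (nn.comp tv)).const_mul ((1 / 2) ^ j)) ?_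
        filter_upwards [hxK, hv', hw'] with i h1 h2 h3
        exact hdom j _ h1 _ h2 _ h3
    · rw [← (Submodule.equivMapOfInjective _ hwinj S).finrank_eq, hSd, hdim x₀ hx₀]
  constructor
  · intro hv₀
    rw [← hVE] at hv₀
    obtain ⟨s, hs, rfl⟩ := hv₀
    obtain ⟨v, hv, hvs⟩ := hS1 s hs
    exact ⟨fun i => tangentWrite x₀ (x i) (v i), hwrite E v hv, tendsto_tangentWrite hx hvs⟩
  · intro v hv hlim
    rw [← hVE]
    have hmem : ∀ᶠ i in 𝒰, tangentRead (d := d) x₀ (x i) (v i) ∈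
        (E (x i)).map (tangentRead (d := d) x₀ (x i)).toLinearMap := by
      filter_upwards [hv] with i hi
      exact Submodule.mem_map_of_mem hi
    have hread₀ : Tendsto (fun i => tangentRead (d := d) x₀ (x i) (v i)) 𝒰
        (𝓝 (tangentRead (d := d) x₀ x₀ v₀)) :=
      tendsto_tangentRead (p := fun i => (⟨x i, v i⟩ : TangentBundle (𝓡 d) M)) hlim
    have hS0 : tangentRead (d := d) x₀ x₀ v₀ ∈ S :=
      hS2 (fun i => tangentRead (d := d) x₀ (x i) (v i)) _ hmem hread₀
    have hwr : tangentWrite x₀ x₀ (tangentRead x₀ x₀ v₀) = v₀ :=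
      tangentWrite_read (mem_tangentDomain x₀) v₀
    rw [← hwr]
    exact Submodule.mem_map_of_mem hS0

/-- The bundle that is dominated along the times `r j` is continuous: both properties are tested
along ultrafilters. -/
lemma isContinuousSubbundleOn_of_dominated (hKc : IsCompact K) (r : ℕ → ℤ) (hr : r 0 = 0)
    (hcompl : ∀ x ∈ K, IsCompl (E x) (F x)) (hdim : ∀ x ∈ K, finrank ℝ (E x) = m)
    (hdom : ∀ j : ℕ, ∀ x ∈ K, ∀ v ∈ E x, ∀ w ∈ F x,
      ‖dIter f (r j) x v‖ * ‖w‖ ≤ (1 / 2) ^ j * (‖dIter f (r j) x w‖ * ‖v‖)) :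
    IsContinuousSubbundleOn K E where
  isCompact_unit := by
    rw [isCompact_iff_ultrafilter_le_nhds]
    intro 𝒰 h𝒰
    rw [le_principal_iff] at h𝒰
    obtain ⟨p₀, hp₀, hlim⟩ := (isCompact_unitTangent (d := d) hKc).ultrafilter_le_nhds 𝒰
      (le_principal_iff.2 (mem_of_superset h𝒰 fun p hp => ⟨hp.1, hp.2.2⟩))
    refine ⟨p₀, ⟨hp₀.1, ?_, hp₀.2⟩, hlim⟩
    have hproj : Tendsto (fun p : TangentBundle (𝓡 d) M => p.1) 𝒰 (𝓝 p₀.1) :=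
      ((FiberBundle.continuous_proj (EuclideanSpace ℝ (Fin d))
        (fun x : M => TangentSpace (𝓡 d) x)).tendsto p₀).mono_left hlim
    refine (limit_mem_of_dominated r hr hcompl hdim hdom 𝒰 (x := fun p => p.1)
      (by filter_upwards [h𝒰] with p hp using hp.1) hp₀.1 hproj p₀.2).2 (fun p => p.2)
      (by filter_upwards [h𝒰] with p hp using hp.2.1) hlim
  eventually_exists := by
    intro x₀ hx₀ v₀ hv₀ O hO
    by_contra hcon
    rw [not_eventually, frequently_iff_neBot] at hcon
    set 𝒰 := Ultrafilter.of (𝓝[K] x₀ ⊓ 𝓟 {x | ¬∃ v ∈ E x, (⟨x, v⟩ : TangentBundle (𝓡 d) M) ∈ O})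
    have hle : (𝒰 : Filter M) ≤ _ := Ultrafilter.of_le _
    have hnhds : Tendsto id (𝒰 : Filter M) (𝓝 x₀) :=
      hle.trans (inf_le_left.trans nhdsWithin_le_nhds)
    have hUK : ∀ᶠ x in (𝒰 : Filter M), x ∈ K :=
      (hle.trans inf_le_left) self_mem_nhdsWithin
    have hbad : ∀ᶠ x in (𝒰 : Filter M), ¬∃ v ∈ E x, (⟨x, v⟩ : TangentBundle (𝓡 d) M) ∈ O :=
      (hle.trans inf_le_right) (mem_principal_self _)
    obtain ⟨v, hv, hlim⟩ := (limit_mem_of_dominated r hr hcompl hdim hdom 𝒰 (x := id) hUK hx₀ hnhds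
      v₀).1 hv₀
    have hnear : ∀ᶠ x in (𝒰 : Filter M), (⟨id x, v x⟩ : TangentBundle (𝓡 d) M) ∈ O := hlim hO
    obtain ⟨x, h1, h2, h3⟩ := (hv.and (hnear.and hbad)).exists
    exact h3 ⟨v x, h1, h2⟩

/-- The bundles of a dominated splitting over a compact invariant set are continuous. -/
lemma IsDominatedSplitting.isContinuousSubbundleOn (hKc : IsCompact K) (hK : IsFInvariant f K)
    (h : IsDominatedSplitting f K m E F) :
    IsContinuousSubbundleOn K E ∧ IsContinuousSubbundleOn K F := by
  obtain ⟨N, -, hdom⟩ := h.exists_forall_iterate hK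
  have hinv := h.1
  have hcompl := fun x hx => (hinv x hx).1
  have hdim := fun x hx => (hinv x hx).2.1
  have hE := fun x hx => (hinv x hx).2.2.1
  have hF := fun x hx => (hinv x hx).2.2.2
  refine ⟨isContinuousSubbundleOn_of_dominated hKc (fun j => j * N) (by simp) hcompl hdim hdom, ?_⟩
  refine isContinuousSubbundleOn_of_dominated (f := f) (m := d - m) (F := E) hKc
    (fun j => -(j * N)) (by simp) (fun x hx => (hcompl x hx).symm) (fun x hx => ?_) ?_
  · have := Submodule.finrank_add_eq_of_isCompl (hcompl x hx)
    rw [finrank_tangentSpace, hdim x hx] at this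
    omega
  · intro j x hx w hw v hv
    have h1 := hdom j _ (zIter_mem f hK (-(j * N)) hx) _ (dIter_mem hK hE (-(j * N)) hx hv) _
      (dIter_mem hK hF (-(j * N)) hx hw)
    rw [← norm_dIter_add, ← norm_dIter_add, add_neg_cancel, norm_dIter_zero,
      norm_dIter_zero] at h1
    calc _ = ‖v‖ * ‖dIter f (-(j * N)) x w‖ := mul_comm _ _
      _ ≤ _ := h1
      _ = _ := by ring

end DominatedContinuity

/-! ### Norms of the cocycle on a continuous bundle -/

section RestrictedNorm

open Module

variable {d : ℕ} {M : Type*} [TopologicalSpace M] [ChartedSpace (EuclideanSpace ℝ (Fin d)) M]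
  {f : M ≃ₘ^1⟮𝓡 d, 𝓡 d⟯ M}
  {K : Set M} {V : (x : M) → Submodule ℝ (TangentSpace (𝓡 d) x)}
  [RiemannianBundle (fun x : M => TangentSpace (𝓡 d) x)]

lemma restrictedNorm_nonneg (k : ℤ) (x : M) : 0 ≤ restrictedNorm f V k x := by
  unfold restrictedNorm
  exact norm_nonneg ((dIter f k x).comp (V x).subtypeL)

lemma norm_dIter_le_restrictedNorm (k : ℤ) {x : M} {v : TangentSpace (𝓡 d) x} (hv : v ∈ V x) :
    ‖dIter f k x v‖ ≤ restrictedNorm f V k x * ‖v‖ :=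
  ((dIter f k x).comp (V x).subtypeL).le_opNorm ⟨v, hv⟩

lemma restrictedNorm_le {k : ℤ} {x : M} {C : ℝ} (hC : 0 ≤ C)
    (h : ∀ v ∈ V x, ‖dIter f k x v‖ ≤ C * ‖v‖) : restrictedNorm f V k x ≤ C :=
  ContinuousLinearMap.opNorm_le_bound _ hC fun v => h v v.2

lemma exists_lt_norm_dIter {k : ℤ} {x : M} {C : ℝ} (hC : 0 ≤ C) (h : C < restrictedNorm f V k x) :
    ∃ v ∈ V x, C * ‖v‖ < ‖dIter f k x v‖ := by
  by_contra! hcon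
  exact h.not_ge (restrictedNorm_le hC hcon)

lemma restrictedNorm_add_le (hK : IsFInvariant f K)
    (hV : ∀ x ∈ K, (V x).map (mfderiv (𝓡 d) (𝓡 d) f x).toLinearMap = V (f x))
    (k l : ℤ) {x : M} (hx : x ∈ K) :
    restrictedNorm f V (k + l) x ≤ restrictedNorm f V k (zIter f l x) * restrictedNorm f V l x := by
  refine restrictedNorm_le
    (mul_nonneg (restrictedNorm_nonneg _ _) (restrictedNorm_nonneg _ _)) fun v hv => ?_
  rw [norm_dIter_add]
  refine (norm_dIter_le_restrictedNorm k (dIter_mem hK hV l hx hv)).trans ?_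
  rw [mul_assoc]
  exact mul_le_mul_of_nonneg_left (norm_dIter_le_restrictedNorm l hv)
    (restrictedNorm_nonneg _ _)

/-- `restrictedNorm f V (-n) (f^n x)` is the norm of the inverse of `df^n` on `V x`. -/
lemma norm_le_restrictedNorm_neg (hK : IsFInvariant f K)
    (hV : ∀ x ∈ K, (V x).map (mfderiv (𝓡 d) (𝓡 d) f x).toLinearMap = V (f x))
    (n : ℤ) {x : M} (hx : x ∈ K) {w : TangentSpace (𝓡 d) x} (hw : w ∈ V x) :
    ‖w‖ ≤ restrictedNorm f V (-n) (zIter f n x) * ‖dIter f n x w‖ := by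
  have := norm_dIter_le_restrictedNorm (f := f) (-n) (dIter_mem hK hV n hx hw)
  rwa [← norm_dIter_add, neg_add_cancel, norm_dIter_zero] at this

lemma restrictedNorm_neg_le (hK : IsFInvariant f K)
    (hV : ∀ x ∈ K, (V x).map (mfderiv (𝓡 d) (𝓡 d) f x).toLinearMap = V (f x))
    (n : ℤ) {x : M} (hx : x ∈ K) {C : ℝ} (hC : 0 ≤ C)
    (h : ∀ w ∈ V x, ‖w‖ ≤ C * ‖dIter f n x w‖) :
    restrictedNorm f V (-n) (zIter f n x) ≤ C := by
  refine restrictedNorm_le hC fun v hv => ?_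
  obtain ⟨w, hw, rfl⟩ := exists_dIter_eq hK hV n hx hv
  rw [← norm_dIter_add, neg_add_cancel, norm_dIter_zero]
  exact h w hw

variable {L : ℝ}

lemma exp_neg_le_restrictedNorm {n : ℕ} {x : M} (hV : V x ≠ ⊥)
    (hL : ∀ v : TangentSpace (𝓡 d) x, ‖v‖ ≤ Real.exp (L * n) * ‖dIter f n x v‖) :
    Real.exp (-(L * n)) ≤ restrictedNorm f V n x := by
  obtain ⟨v, hv, hv0⟩ := Submodule.exists_mem_ne_zero_of_ne_bot hV
  have h1 := (hL v).trans (mul_le_mul_of_nonneg_left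
    (norm_dIter_le_restrictedNorm (f := f) n hv) (Real.exp_pos _).le)
  have hv' : 0 < ‖v‖ := norm_pos_iff.2 hv0
  rw [Real.exp_neg, inv_le_iff_one_le_mul₀ (Real.exp_pos _)]
  refine le_of_mul_le_mul_right ?_ hv'
  calc 1 * ‖v‖ = ‖v‖ := one_mul _
    _ ≤ _ := h1
    _ = _ := by ring

lemma exp_neg_le_restrictedNorm_neg (hK : IsFInvariant f K)
    (hVf : ∀ x ∈ K, (V x).map (mfderiv (𝓡 d) (𝓡 d) f x).toLinearMap = V (f x))
    {n : ℕ} {x : M} (hx : x ∈ K) (hV : V x ≠ ⊥)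
    (hL : ∀ v : TangentSpace (𝓡 d) x, ‖dIter f n x v‖ ≤ Real.exp (L * n) * ‖v‖) :
    Real.exp (-(L * n)) ≤ restrictedNorm f V (-n) (zIter f n x) := by
  obtain ⟨v, hv, hv0⟩ := Submodule.exists_mem_ne_zero_of_ne_bot hV
  have h1 := (norm_le_restrictedNorm_neg hK hVf n hx hv).trans (mul_le_mul_of_nonneg_left
    (hL v) (restrictedNorm_nonneg _ _))
  have hv' : 0 < ‖v‖ := norm_pos_iff.2 hv0
  rw [Real.exp_neg, inv_le_iff_one_le_mul₀ (Real.exp_pos _)]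
  refine le_of_mul_le_mul_right ?_ hv'
  calc 1 * ‖v‖ = ‖v‖ := one_mul _
    _ ≤ _ := h1
    _ = _ := by ring

variable (f V) in
/-- `log ‖df^n_{/V}‖`. -/
def logNorm (n : ℕ) (x : M) : ℝ := Real.log (restrictedNorm f V n x)

variable (f V) in
/-- `log ‖(df^n_{/V})⁻¹‖`. -/
def logInvNorm (n : ℕ) (x : M) : ℝ := Real.log (restrictedNorm f V (-n) (zIter f n x))

variable [IsManifold (𝓡 d) ∞ M]

/-- The base points of the unit vectors of `V` in a closed set form a compact set. -/
lemma IsContinuousSubbundleOn.isCompact_setOf_exists_mem [T2Space M]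
    (h : IsContinuousSubbundleOn K V) {C : Set (TangentBundle (𝓡 d) M)} (hC : IsClosed C) :
    IsCompact {x | x ∈ K ∧ ∃ v ∈ V x, ‖v‖ = 1 ∧ (⟨x, v⟩ : TangentBundle (𝓡 d) M) ∈ C} := by
  have h1 := (h.isCompact_unit.inter_right hC).image (FiberBundle.continuous_proj
    (EuclideanSpace ℝ (Fin d)) (fun x : M => TangentSpace (𝓡 d) x))
  convert h1 using 1
  ext x
  constructor
  · rintro ⟨hx, v, hv, hv1, hvC⟩
    exact ⟨⟨x, v⟩, ⟨⟨hx, hv, hv1⟩, hvC⟩, rfl⟩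
  · rintro ⟨⟨y, v⟩, ⟨⟨hx, hv, hv1⟩, hvC⟩, rfl⟩
    exact ⟨hx, v, hv, hv1, hvC⟩

variable [IsContMDiffRiemannianBundle (𝓡 d) ∞ (EuclideanSpace ℝ (Fin d))
      (fun x : M => TangentSpace (𝓡 d) x)]

/-- The norm of `df^k` on a continuous bundle is continuous: lower semicontinuous since vectors of
`V` extend to nearby points, and upper semicontinuous by compactness of the unit vectors. -/
lemma IsContinuousSubbundleOn.continuousOn_restrictedNorm [T2Space M]
    (h : IsContinuousSubbundleOn K V) (k : ℤ) : ContinuousOn (restrictedNorm f V k) K := by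
  intro x₀ hx₀
  rw [ContinuousWithinAt, tendsto_order]
  have hq := continuous_norm_dIter f k
  have hn := continuous_norm_tangent (d := d) (M := M)
  constructor
  · intro a ha
    rcases lt_or_ge a 0 with ha0 | ha0
    · exact Eventually.of_forall fun x => ha0.trans_le (restrictedNorm_nonneg _ _)
    obtain ⟨v₀, hv₀, hlt⟩ := exists_lt_norm_dIter ha0 ha
    have hO : IsOpen {p : TangentBundle (𝓡 d) M | a * ‖p.2‖ < ‖dIter f k p.1 p.2‖} :=
      isOpen_lt (continuous_const.mul hn) hq
    filter_upwards [h.eventually_exists x₀ hx₀ v₀ hv₀ _ (hO.mem_nhds hlt)] with x ⟨v, hv, hvO⟩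
    have h1 : a * ‖v‖ < restrictedNorm f V k x * ‖v‖ :=
      lt_of_lt_of_le hvO (norm_dIter_le_restrictedNorm k hv)
    exact lt_of_mul_lt_mul_right h1 (norm_nonneg _)
  · intro a ha
    obtain ⟨a', h1, h2⟩ := exists_between ha
    have ha' : 0 ≤ a' := (restrictedNorm_nonneg _ _).trans h1.le
    have hC : IsClosed {p : TangentBundle (𝓡 d) M | a' ≤ ‖dIter f k p.1 p.2‖} :=
      isClosed_le continuous_const hq
    have hcl := (h.isCompact_setOf_exists_mem hC).isClosed
    have hx₀' : x₀ ∈ {x | x ∈ K ∧ ∃ v ∈ V x, ‖v‖ = 1 ∧ (⟨x, v⟩ : TangentBundle (𝓡 d) M) ∈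
        {p : TangentBundle (𝓡 d) M | a' ≤ ‖dIter f k p.1 p.2‖}}ᶜ := by
      rintro ⟨-, v, hv, hv1, hvC⟩
      have h3 := norm_dIter_le_restrictedNorm (f := f) k hv
      rw [hv1, mul_one] at h3
      exact (h1.trans_le (le_trans hvC h3)).false
    filter_upwards [mem_nhdsWithin_of_mem_nhds (hcl.isOpen_compl.mem_nhds hx₀'),
      self_mem_nhdsWithin] with x hx hxK
    by_contra hcon
    obtain ⟨v, hv, hlt⟩ := exists_lt_norm_dIter ha' (h2.trans_le (not_lt.1 hcon))
    have hv0 : v ≠ 0 := by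
      rintro rfl
      simp at hlt
    have hvp : 0 < ‖v‖ := norm_pos_iff.2 hv0
    refine hx ⟨hxK, ‖v‖⁻¹ • v, (V x).smul_mem _ hv, ?_, ?_⟩
    · rw [norm_smul, norm_inv, norm_norm, inv_mul_cancel₀ hvp.ne']
    · show a' ≤ ‖dIter f k x (‖v‖⁻¹ • v)‖
      rw [map_smul, norm_smul, norm_inv, norm_norm, le_inv_mul_iff₀ hvp, mul_comm]
      exact hlt.le

variable (f) in
/-- Over a compact invariant set, `df^n` distorts lengths at most exponentially. -/
lemma exists_growth_bound (hKc : IsCompact K) (hK : IsFInvariant f K) :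
    ∃ L : ℝ, 0 ≤ L ∧ ∀ n : ℕ, ∀ x ∈ K, ∀ v : TangentSpace (𝓡 d) x,
      ‖dIter f n x v‖ ≤ Real.exp (L * n) * ‖v‖ ∧ ‖v‖ ≤ Real.exp (L * n) * ‖dIter f n x v‖ := by
  obtain ⟨L, hL0, hL⟩ := exists_log_norm_bound f hKc 1
  refine ⟨L, hL0, fun n => ?_⟩
  induction n with
  | zero =>
    intro x hx v
    rw [Nat.cast_zero, norm_dIter_zero]
    simp
  | succ n ih =>
    intro x hx v
    have h1 := ih x hx v
    have h2 := hL _ (zIter_mem f hK n hx) (dIter f n x v)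
    rw [← norm_dIter_add] at h2
    have h3 : Real.exp (L * (n + 1 : ℕ)) = Real.exp L * Real.exp (L * n) := by
      rw [← Real.exp_add]; congr 1; push_cast; ring
    rw [Nat.cast_succ, add_comm (n : ℤ) 1, h3]
    constructor
    · refine h2.1.trans ?_
      rw [mul_assoc]
      exact mul_le_mul_of_nonneg_left h1.1 (Real.exp_pos _).le
    · refine h1.2.trans ?_
      rw [mul_comm (Real.exp L), mul_assoc]
      exact mul_le_mul_of_nonneg_left h2.2 (Real.exp_pos _).le

lemma IsContinuousSubbundleOn.isSubadditiveOn_logNorm [T2Space M]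
    (h : IsContinuousSubbundleOn K V) (hK : IsFInvariant f K)
    (hVf : ∀ x ∈ K, (V x).map (mfderiv (𝓡 d) (𝓡 d) f x).toLinearMap = V (f x))
    (hV : ∀ x ∈ K, V x ≠ ⊥)
    (hL : ∀ n : ℕ, ∀ x ∈ K, ∀ v : TangentSpace (𝓡 d) x,
      ‖dIter f n x v‖ ≤ Real.exp (L * n) * ‖v‖ ∧ ‖v‖ ≤ Real.exp (L * n) * ‖dIter f n x v‖) :
    IsSubadditiveOn f K (logNorm f V) L where
  add_le m n x hx := by
    have hpos := fun (n : ℕ) x hx => (Real.exp_pos _).trans_le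
      (exp_neg_le_restrictedNorm (f := f) (hV x hx) fun v => (hL n x hx v).2)
    have h1 := restrictedNorm_add_le hK hVf m n hx
    have h2 := hpos m _ (zIter_mem f hK n hx)
    simp only [logNorm]
    rw [← zIter_natCast, ← Real.log_mul h2.ne' (hpos n x hx).ne']
    refine Real.log_le_log (hpos (m + n) x hx) ?_
    rwa [Nat.cast_add]
  bound n x hx := by
    have h1 := exp_neg_le_restrictedNorm (f := f) (hV x hx) fun v => (hL n x hx v).2
    have h2 : restrictedNorm f V n x ≤ Real.exp (L * n) :=
      restrictedNorm_le (Real.exp_pos _).le fun v _ => (hL n x hx v).1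
    have h0 := (Real.exp_pos _).trans_le h1
    rw [logNorm, abs_le]
    exact ⟨(Real.le_log_iff_exp_le h0).2 h1, (Real.log_le_iff_le_exp h0).2 h2⟩
  continuousOn n := (h.continuousOn_restrictedNorm n).log fun x hx =>
    ((Real.exp_pos _).trans_le
      (exp_neg_le_restrictedNorm (f := f) (hV x hx) fun v => (hL n x hx v).2)).ne'

lemma IsContinuousSubbundleOn.isSubadditiveOn_logInvNorm [T2Space M]
    (h : IsContinuousSubbundleOn K V) (hK : IsFInvariant f K)
    (hVf : ∀ x ∈ K, (V x).map (mfderiv (𝓡 d) (𝓡 d) f x).toLinearMap = V (f x))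
    (hV : ∀ x ∈ K, V x ≠ ⊥)
    (hL : ∀ n : ℕ, ∀ x ∈ K, ∀ v : TangentSpace (𝓡 d) x,
      ‖dIter f n x v‖ ≤ Real.exp (L * n) * ‖v‖ ∧ ‖v‖ ≤ Real.exp (L * n) * ‖dIter f n x v‖) :
    IsSubadditiveOn f K (logInvNorm f V) L where
  add_le m n x hx := by
    have hpos := fun (n : ℕ) x hx => (Real.exp_pos _).trans_le
      (exp_neg_le_restrictedNorm_neg hK hVf hx (hV x hx) fun v => (hL n x hx v).1)
    have h1 := restrictedNorm_add_le hK hVf (-n) (-m) (zIter_mem f hK m (zIter_mem f hK n hx))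
    rw [zIter_neg_apply, ← Function.comp_apply (f := zIter f m), ← zIter_add, mul_comm] at h1
    have h2 := hpos m _ (zIter_mem f hK n hx)
    have h3 := hpos (m + n) x hx
    simp only [logInvNorm]
    rw [← zIter_natCast, ← Real.log_mul h2.ne' (hpos n x hx).ne']
    refine Real.log_le_log h3 ?_
    rw [← Function.comp_apply (f := zIter f m), ← zIter_add, Nat.cast_add, neg_add_rev]
    exact h1
  bound n x hx := by
    have h1 := exp_neg_le_restrictedNorm_neg hK hVf hx (hV x hx) fun v => (hL n x hx v).1
    have h2 : restrictedNorm f V (-n) (zIter f n x) ≤ Real.exp (L * n) :=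
      restrictedNorm_neg_le hK hVf n hx (Real.exp_pos _).le fun v _ => (hL n x hx v).2
    have h0 := (Real.exp_pos _).trans_le h1
    rw [logInvNorm, abs_le]
    exact ⟨(Real.le_log_iff_exp_le h0).2 h1, (Real.log_le_iff_le_exp h0).2 h2⟩
  continuousOn n := ((h.continuousOn_restrictedNorm (-n)).comp (continuous_zIter f n).continuousOn
      fun x hx => zIter_mem f hK n hx).log fun x hx =>
    ((Real.exp_pos _).trans_le
      (exp_neg_le_restrictedNorm_neg hK hVf hx (hV x hx) fun v => (hL n x hx v).1)).ne'

end RestrictedNorm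

/-! ### Lyapunov exponents and domination at a point -/

section Exponents

open Module

lemma eventually_const_mul_exp_le (C : ℝ) {a b : ℝ} (hab : a < b) :
    ∀ᶠ n : ℕ in atTop, C * Real.exp (a * n) ≤ Real.exp (b * n) := by
  have h1 : Tendsto (fun n : ℕ => Real.exp ((b - a) * n)) atTop atTop :=
    Real.tendsto_exp_atTop.comp
      (tendsto_natCast_atTop_atTop.const_mul_atTop (by linarith))
  filter_upwards [h1.eventually_ge_atTop C] with n hn
  calc C * Real.exp (a * n) ≤ Real.exp ((b - a) * n) * Real.exp (a * n) := by gcongr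
    _ = Real.exp (b * n) := by rw [← Real.exp_add]; congr 1; ring

variable {d : ℕ} {M : Type*} [TopologicalSpace M] [ChartedSpace (EuclideanSpace ℝ (Fin d)) M]
  (f : M ≃ₘ^1⟮𝓡 d, 𝓡 d⟯ M) [RiemannianBundle (fun x : M => TangentSpace (𝓡 d) x)]

/-- The vectors at `x` whose Lyapunov exponent is at most `c` (and `0`). -/
def slowSpace (x : M) (c : ℝ) : Submodule ℝ (TangentSpace (𝓡 d) x) where
  carrier := {v | ∀ c' > c, ∀ᶠ n : ℕ in atTop, ‖dIter f n x v‖ ≤ Real.exp (c' * n)}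
  zero_mem' := fun c' _ => Eventually.of_forall fun n => by
    rw [map_zero, norm_zero]; exact (Real.exp_pos _).le
  add_mem' := by
    intro v w hv hw c' hc'
    obtain ⟨c'', h1, h2⟩ := exists_between hc'
    filter_upwards [hv c'' h1, hw c'' h1, eventually_const_mul_exp_le 2 h2] with n hn1 hn2 hn3
    rw [map_add]
    refine (norm_add_le _ _).trans ?_
    linarith
  smul_mem' := by
    intro a v hv c' hc'
    obtain ⟨c'', h1, h2⟩ := exists_between hc'
    filter_upwards [hv c'' h1, eventually_const_mul_exp_le ‖a‖ h2] with n hn1 hn3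
    rw [map_smul, norm_smul]
    exact (mul_le_mul_of_nonneg_left hn1 (norm_nonneg _)).trans hn3

variable {f} {x : M}

lemma mem_slowSpace {c : ℝ} {v : TangentSpace (𝓡 d) x} : v ∈ slowSpace f x c ↔
    ∀ c' > c, ∀ᶠ n : ℕ in atTop, ‖dIter f n x v‖ ≤ Real.exp (c' * n) := Iff.rfl

lemma slowSpace_mono {c c' : ℝ} (h : c ≤ c') : slowSpace f x c ≤ slowSpace f x c' :=
  fun _ hv c'' hc'' => hv c'' (h.trans_lt hc'')

lemma mem_slowSpace_of_eventually_le {c : ℝ} {v w : TangentSpace (𝓡 d) x} (C : ℝ)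
    (hw : w ∈ slowSpace f x c)
    (h : ∀ᶠ n : ℕ in atTop, ‖dIter f n x v‖ ≤ C * ‖dIter f n x w‖) : v ∈ slowSpace f x c := by
  intro c' hc'
  obtain ⟨c'', h1, h2⟩ := exists_between hc'
  filter_upwards [h, hw c'' h1, eventually_const_mul_exp_le |C| h2] with n hn1 hn2 hn3
  refine hn1.trans (le_trans ?_ hn3)
  calc C * ‖dIter f n x w‖ ≤ |C| * ‖dIter f n x w‖ := by gcongr; exact le_abs_self C
    _ ≤ _ := by gcongr

lemma mem_slowSpace_of_exp {c : ℝ} {v : TangentSpace (𝓡 d) x} (C : ℝ)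
    (h : ∀ᶠ n : ℕ in atTop, ‖dIter f n x v‖ ≤ C * Real.exp (c * n)) : v ∈ slowSpace f x c := by
  intro c' hc'
  filter_upwards [h, eventually_const_mul_exp_le C hc'] with n hn1 hn2 using hn1.trans hn2

/-- A vector that `df^n` expands by `C⁻¹ e^{cn}` has exponent at least `c`. -/
lemma notMem_slowSpace_of_exp {c c' : ℝ} (hc : c' < c) {w : TangentSpace (𝓡 d) x} {C : ℝ}
    (hw : w ≠ 0)
    (h : ∀ᶠ n : ℕ in atTop, ‖w‖ ≤ C * Real.exp (-(c * n)) * ‖dIter f n x w‖) :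
    w ∉ slowSpace f x c' := by
  intro hmem
  obtain ⟨c'', h1, h2⟩ := exists_between hc
  have hw' : 0 < ‖w‖ := norm_pos_iff.2 hw
  obtain ⟨n, hn1, hn2, hn3⟩ := (h.and ((hmem c'' h1).and
    (eventually_const_mul_exp_le (2 * |C| / ‖w‖) h2))).exists
  have h3 : ‖w‖ ≤ |C| * Real.exp (-(c * n)) * Real.exp (c'' * n) := by
    refine hn1.trans ?_
    gcongr
    exact le_abs_self C
  rw [div_mul_eq_mul_div, div_le_iff₀ hw'] at hn3
  have h4 : |C| * Real.exp (c'' * n) ≤ Real.exp (c * n) * (‖w‖ / 2) := by linarith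
  have h5 : |C| * Real.exp (-(c * n)) * Real.exp (c'' * n) ≤ ‖w‖ / 2 := by
    calc _ = Real.exp (-(c * n)) * (|C| * Real.exp (c'' * n)) := by ring
      _ ≤ Real.exp (-(c * n)) * (Real.exp (c * n) * (‖w‖ / 2)) := by gcongr
      _ = ‖w‖ / 2 := by rw [← mul_assoc, ← Real.exp_add]; simp
  linarith

/-- The upper limit that defines the exponent, in terms of the growth of `‖df^n v‖`. It reduces all
statements on exponents to membership in the subspaces `slowSpace f x c`. -/
lemma lyapunovExponent_le_iff {v : TangentSpace (𝓡 d) x} (hv : v ≠ 0) (c : ℝ) :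
    lyapunovExponent f x v ≤ c ↔ v ∈ slowSpace f x c := by
  have hcmp : ∀ (n : ℕ), 1 ≤ n → ∀ b : ℝ,
      (1 / (n : ℝ) * Real.log ‖dIter f n x v‖ ≤ b ↔ ‖dIter f n x v‖ ≤ Real.exp (b * n)) := by
    intro n hn b
    have hn' : (0 : ℝ) < n := by exact_mod_cast hn
    rw [one_div, inv_mul_le_iff₀ hn', Real.log_le_iff_le_exp (norm_dIter_pos f n hv), mul_comm]
  rw [lyapunovExponent, limsup_le_iff, mem_slowSpace]
  constructor
  · intro h c' hc'
    filter_upwards [h c' (EReal.coe_lt_coe_iff.2 hc'), eventually_ge_atTop 1] with n hn hn1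
    exact (hcmp n hn1 c').1 (EReal.coe_lt_coe_iff.1 hn).le
  · intro h y hy
    obtain ⟨c', h1, h2⟩ := EReal.lt_iff_exists_real_btwn.1 hy
    filter_upwards [h c' (EReal.coe_lt_coe_iff.1 h1), eventually_ge_atTop 1] with n hn hn1
    exact (EReal.coe_le_coe_iff.2 ((hcmp n hn1 c').2 hn)).trans_lt h2

lemma lyapunovExponent_neg_iff {v : TangentSpace (𝓡 d) x} (hv : v ≠ 0) :
    lyapunovExponent f x v < 0 ↔ ∃ c < 0, v ∈ slowSpace f x c := by
  constructor
  · intro h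
    obtain ⟨c, h1, h2⟩ := EReal.lt_iff_exists_real_btwn.1 h
    exact ⟨c, EReal.coe_lt_coe_iff.1 h2, (lyapunovExponent_le_iff hv c).1 h1.le⟩
  · rintro ⟨c, hc, hm⟩
    exact ((lyapunovExponent_le_iff hv c).2 hm).trans_lt (EReal.coe_lt_coe_iff.2 hc)

lemma lyapunovExponent_pos_iff {v : TangentSpace (𝓡 d) x} (hv : v ≠ 0) :
    0 < lyapunovExponent f x v ↔ ∃ c > 0, v ∉ slowSpace f x c := by
  constructor
  · intro h
    obtain ⟨c, h1, h2⟩ := EReal.lt_iff_exists_real_btwn.1 h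
    exact ⟨c, EReal.coe_lt_coe_iff.1 h1, fun hm =>
      (((lyapunovExponent_le_iff hv c).2 hm).trans_lt h2).false⟩
  · rintro ⟨c, hc, hm⟩
    have : (c : EReal) < lyapunovExponent f x v :=
      not_le.1 fun h => hm ((lyapunovExponent_le_iff hv c).1 h)
    exact (EReal.coe_lt_coe_iff.2 hc).trans this

/-- The vectors of negative exponent, together with `0`, already form a subspace. -/
lemma mem_stableSpace_iff {v : TangentSpace (𝓡 d) x} :
    v ∈ stableSpace f x ↔ ∃ c < 0, v ∈ slowSpace f x c := by
  constructor
  · intro hv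
    induction hv using Submodule.span_induction with
    | mem v hv => exact (lyapunovExponent_neg_iff hv.1).1 hv.2
    | zero => exact ⟨-1, by norm_num, Submodule.zero_mem _⟩
    | add v w _ _ hv hw =>
      obtain ⟨a, ha, hav⟩ := hv
      obtain ⟨b, hb, hbw⟩ := hw
      exact ⟨max a b, max_lt ha hb, Submodule.add_mem _ (slowSpace_mono (le_max_left _ _) hav)
        (slowSpace_mono (le_max_right _ _) hbw)⟩
    | smul t v _ hv =>
      obtain ⟨a, ha, hav⟩ := hv
      exact ⟨a, ha, Submodule.smul_mem _ _ hav⟩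
  · rintro ⟨c, hc, hv⟩
    rcases eq_or_ne v 0 with rfl | hv0
    · exact Submodule.zero_mem _
    · exact Submodule.subset_span ⟨hv0, (lyapunovExponent_neg_iff hv0).2 ⟨c, hc, hv⟩⟩

variable {K : Set M} {m : ℕ} {E F : (x : M) → Submodule ℝ (TangentSpace (𝓡 d) x)} {L : ℝ}

/-- The vectors of `E` become negligible compared with those of `F`, along all times `n` and not
only the multiples of the domination time. -/
lemma IsDominatedSplitting.eventually_norm_le (hK : IsFInvariant f K)
    (h : IsDominatedSplitting f K m E F)
    (hL : ∀ n : ℕ, ∀ x ∈ K, ∀ v : TangentSpace (𝓡 d) x,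
      ‖dIter f n x v‖ ≤ Real.exp (L * n) * ‖v‖ ∧ ‖v‖ ≤ Real.exp (L * n) * ‖dIter f n x v‖)
    (hL0 : 0 ≤ L) (hx : x ∈ K) {v w : TangentSpace (𝓡 d) x} (hv : v ∈ E x) (hw : w ∈ F x)
    (hw0 : w ≠ 0) {ε : ℝ} (hε : 0 < ε) :
    ∀ᶠ n : ℕ in atTop, ‖dIter f n x v‖ ≤ ε * ‖dIter f n x w‖ := by
  obtain ⟨N, hN, hdom⟩ := h.exists_forall_iterate hK
  have hw' : 0 < ‖w‖ := norm_pos_iff.2 hw0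
  set C := Real.exp (L * N) * Real.exp (L * N) * ‖v‖ / ‖w‖
  have hmain : ∀ n : ℕ, ‖dIter f n x v‖ ≤ C * (1 / 2) ^ (n / N) * ‖dIter f n x w‖ := by
    intro n
    set q := n / N
    set r := n % N
    have hn : (n : ℤ) = r + q * N := by
      have := Nat.mod_add_div n N
      rw [mul_comm] at this
      exact_mod_cast this.symm
    have hr : Real.exp (L * r) ≤ Real.exp (L * N) := by
      apply Real.exp_le_exp.2
      have : (r : ℝ) ≤ N := by exact_mod_cast (Nat.mod_lt n hN).le
      gcongr
    have h1 := (hL r _ (zIter_mem f hK (q * N) hx) (dIter f (q * N) x v)).1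
    have h2 := (hL r _ (zIter_mem f hK (q * N) hx) (dIter f (q * N) x w)).2
    rw [← norm_dIter_add, ← hn] at h1 h2
    have h3 := hdom q x hx v hv w hw
    rw [show C * (1 / 2) ^ q * ‖dIter f n x w‖ = Real.exp (L * N) * Real.exp (L * N) * ‖v‖ *
      (1 / 2) ^ q * ‖dIter f n x w‖ / ‖w‖ by simp only [C]; ring, le_div_iff₀ hw']
    calc ‖dIter f n x v‖ * ‖w‖ ≤ (Real.exp (L * N) * ‖dIter f (q * N) x v‖) * ‖w‖ := by
          gcongr
          exact h1.trans (by gcongr)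
      _ = Real.exp (L * N) * (‖dIter f (q * N) x v‖ * ‖w‖) := by ring
      _ ≤ Real.exp (L * N) * ((1 / 2) ^ q * (‖dIter f (q * N) x w‖ * ‖v‖)) := by gcongr
      _ ≤ Real.exp (L * N) * ((1 / 2) ^ q * ((Real.exp (L * N) * ‖dIter f n x w‖) * ‖v‖)) := by
          gcongr
          exact h2.trans (by gcongr)
      _ = _ := by ring
  have hlim : Tendsto (fun n : ℕ => C * (1 / 2) ^ (n / N)) atTop (𝓝 0) := by
    have h1 := (tendsto_pow_atTop_nhds_zero_of_lt_one (r := (1 : ℝ) / 2)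
      (by norm_num) (by norm_num)).comp (Nat.tendsto_div_const_atTop (by omega : N ≠ 0))
    simpa using h1.const_mul C
  filter_upwards [hlim.eventually (gt_mem_nhds hε)] with n hn
  exact (hmain n).trans (by gcongr)

/-- The consequences of the domination at a point `x` that only involve the forward orbit. -/
structure IsDominatedAt (f : M ≃ₘ^1⟮𝓡 d, 𝓡 d⟯ M) (x : M)
    (V W : Submodule ℝ (TangentSpace (𝓡 d) x)) : Prop where
  isCompl : IsCompl V W
  eventually_le : ∀ v ∈ V, ∀ w ∈ W, w ≠ 0 → ∀ ε > 0,
    ∀ᶠ n : ℕ in atTop, ‖dIter f n x v‖ ≤ ε * ‖dIter f n x w‖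

namespace IsDominatedAt

variable {V W : Submodule ℝ (TangentSpace (𝓡 d) x)}

/-- A single slow vector in the dominating bundle `W` makes all of the dominated bundle `V` slow. -/
lemma le_slowSpace (h : IsDominatedAt f x V W) {c : ℝ} {w : TangentSpace (𝓡 d) x} (hw : w ∈ W)
    (hw0 : w ≠ 0) (hwc : w ∈ slowSpace f x c) : V ≤ slowSpace f x c := fun v hv =>
  mem_slowSpace_of_eventually_le 1 hwc (h.eventually_le v hv w hw hw0 1 one_pos)

/-- A vector grows like its component in the dominating bundle. -/
lemma mem_slowSpace_of_add (h : IsDominatedAt f x V W) {c : ℝ} {v w : TangentSpace (𝓡 d) x}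
    (hv : v ∈ V) (hw : w ∈ W) (hvw : v + w ∈ slowSpace f x c) : w ∈ slowSpace f x c := by
  rcases eq_or_ne w 0 with rfl | hw0
  · exact Submodule.zero_mem _
  refine mem_slowSpace_of_eventually_le 2 hvw ?_
  filter_upwards [h.eventually_le v hv w hw hw0 (1 / 2) (by norm_num)] with n hn
  have := norm_sub_le (dIter f n x (v + w)) (dIter f n x v)
  rw [map_add, add_sub_cancel_left] at this
  rw [map_add]
  linarith

/-- If the stable space has the dimension of the dominated bundle, the two coincide. -/
lemma stableSpace_eq (h : IsDominatedAt f x V W)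
    (hdim : finrank ℝ (stableSpace f x) = finrank ℝ V) : stableSpace f x = V := by
  refine Submodule.eq_of_le_of_finrank_eq ?_ hdim
  intro u hu
  obtain ⟨c, hc, huc⟩ := mem_stableSpace_iff.1 hu
  obtain ⟨e, he, g, hg, rfl⟩ := Submodule.mem_sup.1
    (h.isCompl.sup_eq_top ▸ Submodule.mem_top (x := u) : u ∈ V ⊔ W)
  rcases eq_or_ne g 0 with rfl | hg0
  · simpa using he
  exfalso
  have hgc := h.mem_slowSpace_of_add he hg huc
  have hVle : V ≤ stableSpace f x := fun v hv =>
    mem_stableSpace_iff.2 ⟨c, hc, h.le_slowSpace hg hg0 hgc hv⟩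
  have hVeq := Submodule.eq_of_le_of_finrank_eq hVle hdim.symm
  have hgV : g ∈ V := hVeq ▸ mem_stableSpace_iff.2 ⟨c, hc, hgc⟩
  exact hg0 ((Submodule.disjoint_def.1 h.isCompl.disjoint) g hgV hg)

/-- At a hyperbolic point whose stable space is `V`, the exponents in `W` are bounded away from
`0`, since the subspaces of vectors of exponent at most `1 / k` stabilize. -/
lemma exists_notMem_slowSpace (h : IsDominatedAt f x V W) (hx : IsHyperbolicPoint f x)
    (hst : stableSpace f x = V) : ∃ c > 0, ∀ w ∈ W, w ≠ 0 → w ∉ slowSpace f x c := by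
  obtain ⟨k, hk⟩ := monotone_stabilizes_iff_artinian.2 (inferInstance :
    IsArtinian ℝ (TangentSpace (𝓡 d) x)) ⟨fun k : ℕ => OrderDual.toDual
      (slowSpace f x (1 / ((k : ℝ) + 1))), fun i j hij => by
        apply slowSpace_mono
        apply one_div_le_one_div_of_le (by positivity)
        have : (i : ℝ) ≤ j := by exact_mod_cast hij
        linarith⟩
  refine ⟨1 / ((k : ℝ) + 1), by positivity, fun w hw hw0 hwk => ?_⟩
  have hneg : ¬ lyapunovExponent f x w < 0 := by
    intro hlt
    have hwV : w ∈ V := hst ▸ mem_stableSpace_iff.2 ((lyapunovExponent_neg_iff hw0).1 hlt)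
    exact hw0 ((Submodule.disjoint_def.1 h.isCompl.disjoint) w hwV hw)
  have hpos : 0 < lyapunovExponent f x w := lt_of_le_of_ne (not_lt.1 hneg) (hx.1 w hw0).symm
  obtain ⟨c, hc, hwc⟩ := (lyapunovExponent_pos_iff hw0).1 hpos
  obtain ⟨j, hj⟩ := exists_nat_one_div_lt hc
  apply hwc
  have hk' : slowSpace f x (1 / ((k : ℝ) + 1)) =
      slowSpace f x (1 / (((max j k : ℕ) : ℝ) + 1)) := hk (max j k) (le_max_right _ _)
  rw [hk'] at hwk
  refine slowSpace_mono (le_trans ?_ hj.le) hwk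
  apply one_div_le_one_div_of_le (by positivity)
  have : (j : ℝ) ≤ (max j k : ℕ) := by exact_mod_cast le_max_left j k
  linarith

/-- If `V` is contracted and `W` is expanded, `x` is hyperbolic with stable space `V`. -/
lemma isHyperbolicPoint (h : IsDominatedAt f x V W) (hV : V ≠ ⊥) (hW : W ≠ ⊥) {c c' : ℝ}
    (hc : c < 0) (hc' : 0 < c') (hVc : V ≤ slowSpace f x c)
    (hWc : ∀ w ∈ W, w ≠ 0 → w ∉ slowSpace f x c') :
    IsHyperbolicPoint f x ∧ stableSpace f x = V := by
  have hout : ∀ u ∉ V, u ∉ slowSpace f x c' := by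
    intro u hu huc
    obtain ⟨e, he, g, hg, rfl⟩ := Submodule.mem_sup.1
      (h.isCompl.sup_eq_top ▸ Submodule.mem_top (x := u) : u ∈ V ⊔ W)
    refine hWc g hg ?_ (h.mem_slowSpace_of_add he hg huc)
    rintro rfl
    exact hu (by simpa using he)
  have hneg : ∀ v ∈ V, v ≠ 0 → lyapunovExponent f x v < 0 := fun v hv hv0 =>
    (lyapunovExponent_neg_iff hv0).2 ⟨c, hc, hVc hv⟩
  have hpos : ∀ v ∉ V, v ≠ 0 → 0 < lyapunovExponent f x v := fun v hv hv0 =>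
    (lyapunovExponent_pos_iff hv0).2 ⟨c', hc', hout v hv⟩
  refine ⟨⟨fun v hv0 => ?_, ?_, ?_⟩, ?_⟩
  · by_cases hv : v ∈ V
    · exact (hneg v hv hv0).ne
    · exact (hpos v hv hv0).ne'
  · obtain ⟨v, hv, hv0⟩ := Submodule.exists_mem_ne_zero_of_ne_bot hV
    exact ⟨v, hv0, hneg v hv hv0⟩
  · obtain ⟨w, hw, hw0⟩ := Submodule.exists_mem_ne_zero_of_ne_bot hW
    exact ⟨w, hw0, hpos w (fun hwV =>
      hw0 ((Submodule.disjoint_def.1 h.isCompl.disjoint) w hwV hw)) hw0⟩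
  · ext u
    rw [mem_stableSpace_iff]
    constructor
    · rintro ⟨a, ha, hua⟩
      by_contra hu
      exact hout u hu (slowSpace_mono (ha.trans hc').le hua)
    · exact fun hu => ⟨c, hc, hVc hu⟩

end IsDominatedAt

lemma IsDominatedSplitting.isDominatedAt (hK : IsFInvariant f K)
    (h : IsDominatedSplitting f K m E F)
    (hL : ∀ n : ℕ, ∀ x ∈ K, ∀ v : TangentSpace (𝓡 d) x,
      ‖dIter f n x v‖ ≤ Real.exp (L * n) * ‖v‖ ∧ ‖v‖ ≤ Real.exp (L * n) * ‖dIter f n x v‖)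
    (hL0 : 0 ≤ L) (hx : x ∈ K) : IsDominatedAt f x (E x) (F x) :=
  ⟨(h.1 x hx).1, fun _ hv _ hw hw0 _ hε => h.eventually_norm_le hK hL hL0 hx hv hw hw0 hε⟩

/-- Over a hyperbolic set whose index is the dimension of the dominated bundle `E`, the stable
bundle is `E`, hence the vectors of `F` are not slow. -/
lemma hyperbolicSet_of_dominated {Γ : Set M} (hΓ : IsFInvariant f Γ) {Es Eu : (x : M) →
    Submodule ℝ (TangentSpace (𝓡 d) x)} (hinv : IsInvariantSplitting f Γ m Es Eu) {C l : ℝ}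
    (hl : 0 < l) (hhyp : ∀ x ∈ Γ, ∀ n : ℕ,
      (∀ v ∈ Es x, ‖dIter f n x v‖ ≤ C * Real.exp (-(n * l)) * ‖v‖) ∧
      (∀ w ∈ Eu x, ‖dIter f (-n) x w‖ ≤ C * Real.exp (-(n * l)) * ‖w‖))
    (hx : x ∈ Γ) (hdom : IsDominatedAt f x (E x) (F x)) (hdim : finrank ℝ (E x) = m) :
    Es x = E x ∧ ∀ w ∈ F x, w ≠ 0 → w ∉ slowSpace f x (l / 2) := by
  have hs : Es x ≤ slowSpace f x (-l) := by
    intro v hv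
    refine mem_slowSpace_of_exp (C * ‖v‖) (Eventually.of_forall fun n => ?_)
    refine ((hhyp x hx n).1 v hv).trans (le_of_eq ?_)
    rw [show -((n : ℝ) * l) = -l * n by ring]
    ring
  have hu : ∀ w ∈ Eu x, w ≠ 0 → w ∉ slowSpace f x (l / 2) := by
    intro w hw hw0
    refine notMem_slowSpace_of_exp (c := l) (C := C) (by linarith) hw0
      (Eventually.of_forall fun n => ?_)
    have hmem := dIter_mem hΓ (fun x hx => (hinv x hx).2.2.2) n hx hw
    have := (hhyp _ (zIter_mem f hΓ n hx) n).2 _ hmem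
    rwa [← norm_dIter_add, neg_add_cancel, norm_dIter_zero, mul_comm (n : ℝ) l] at this
  have hout : ∀ u ∉ Es x, u ∉ slowSpace f x (l / 2) := by
    intro u huE huc
    obtain ⟨e, he, g, hg, rfl⟩ := Submodule.mem_sup.1
      ((hinv x hx).1.sup_eq_top ▸ Submodule.mem_top (x := u) : u ∈ Es x ⊔ Eu x)
    have hg0 : g ≠ 0 := by
      rintro rfl
      exact huE (by simpa using he)
    refine hu g hg hg0 ?_
    have := Submodule.sub_mem _ huc (slowSpace_mono (by linarith : -l ≤ l / 2) (hs he))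
    rwa [add_sub_cancel_left] at this
  have hst : stableSpace f x = Es x := by
    ext u
    rw [mem_stableSpace_iff]
    constructor
    · rintro ⟨a, ha, hua⟩
      by_contra h
      exact hout u h (slowSpace_mono (by linarith) hua)
    · exact fun h => ⟨-l, by linarith, hs h⟩
  have hE : stableSpace f x = E x := hdom.stableSpace_eq (by rw [hst, hdim, (hinv x hx).2.1])
  refine ⟨hst.symm.trans hE, fun w hw hw0 => hout w fun hwE => ?_⟩
  rw [← hst, hE] at hwE
  exact hw0 ((Submodule.disjoint_def.1 hdom.isCompl.disjoint) w hwE hw)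

end Exponents

/-! ### Uniform expansion in mean -/

section Expansion

open Module

variable {d : ℕ} {M : Type*} [TopologicalSpace M] [ChartedSpace (EuclideanSpace ℝ (Fin d)) M]
  (f : M ≃ₘ^1⟮𝓡 d, 𝓡 d⟯ M) [RiemannianBundle (fun x : M => TangentSpace (𝓡 d) x)]
  (K : Set M) (V : (x : M) → Submodule ℝ (TangentSpace (𝓡 d) x))

/-- The points of `K` over which some unit vector of `V` is not expanded at rate `c` by any of
`df`, …, `df^N`. -/
def lateSet (c : ℝ) (N : ℕ) : Set M :=
  {x | x ∈ K ∧ ∃ v ∈ V x, ‖v‖ = 1 ∧ ∀ n : ℕ, 1 ≤ n → n ≤ N → ‖dIter f n x v‖ ≤ Real.exp (c * n)}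

lemma lateSet_antitone (c : ℝ) : Antitone (lateSet f K V c) := by
  rintro N N' hN x ⟨hx, v, hv, hv1, h⟩
  exact ⟨hx, v, hv, hv1, fun n h1 h2 => h n h1 (h2.trans hN)⟩

variable {f K V} {x : M} {c L : ℝ}

/-- If the unit vectors over `x` are not slow, `x` leaves the sets `lateSet` after some rank: by
compactness of the unit sphere the expansion times are bounded. -/
lemma exists_notMem_lateSet (h : ∀ v ∈ V x, v ≠ 0 → v ∉ slowSpace f x c) :
    ∃ N, x ∉ lateSet f K V c N := by
  by_contra! hcon
  have : ProperSpace (TangentSpace (𝓡 d) x) := FiniteDimensional.proper ℝ _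
  set S : ℕ → Set (TangentSpace (𝓡 d) x) := fun N =>
    (V x : Set _) ∩ Metric.sphere 0 1 ∩
      {v | ∀ n : ℕ, 1 ≤ n → n ≤ N → ‖dIter f n x v‖ ≤ Real.exp (c * n)}
  have hclosed : ∀ N, IsClosed (S N) := by
    intro N
    refine ((V x).closed_of_finiteDimensional.inter Metric.isClosed_sphere).inter ?_
    simp only [ofPred_forall]
    exact isClosed_iInter fun n => isClosed_iInter fun _ => isClosed_iInter fun _ =>
      isClosed_le (dIter f n x).continuous.norm continuous_const
  have hcomp : IsCompact (S 0) :=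
    (isCompact_sphere 0 1).of_isClosed_subset (hclosed 0) fun v hv => hv.1.2
  obtain ⟨v, hv⟩ := IsCompact.nonempty_iInter_of_sequence_nonempty_isCompact_isClosed S
    (fun N v hv => ⟨hv.1, fun n h1 h2 => hv.2 n h1 (h2.trans N.le_succ)⟩)
    (fun N => by
      obtain ⟨-, v, hv, hv1, h⟩ := hcon N
      exact ⟨v, ⟨hv, mem_sphere_zero_iff_norm.2 hv1⟩, h⟩) hcomp hclosed
  rw [mem_iInter] at hv
  have hv1 : ‖v‖ = 1 := mem_sphere_zero_iff_norm.1 (hv 0).1.2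
  have hv0 : v ≠ 0 := by
    rintro rfl
    simp at hv1
  refine h v (hv 0).1.1 hv0 (mem_slowSpace_of_exp 1 ?_)
  filter_upwards [eventually_ge_atTop 1] with n hn
  rw [one_mul]
  exact (hv n).2 n hn le_rfl

/-- The expansion along an orbit is controlled by the number of its visits to `lateSet`. -/
lemma logInvNorm_le (hK : IsFInvariant f K)
    (hVf : ∀ x ∈ K, (V x).map (mfderiv (𝓡 d) (𝓡 d) f x).toLinearMap = V (f x))
    (hV : ∀ x ∈ K, V x ≠ ⊥)
    (hL : ∀ n : ℕ, ∀ x ∈ K, ∀ v : TangentSpace (𝓡 d) x,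
      ‖dIter f n x v‖ ≤ Real.exp (L * n) * ‖v‖ ∧ ‖v‖ ≤ Real.exp (L * n) * ‖dIter f n x v‖)
    (hcL : 0 ≤ c + L) (N T : ℕ) (hx : x ∈ K) :
    logInvNorm f V T x ≤ -(c * T - (c + L) *
      (∑ t ∈ Finset.range T, (lateSet f K V c N).indicator 1 (f^[t] x) + N)) := by
  have hpos := (Real.exp_pos _).trans_le
    (exp_neg_le_restrictedNorm_neg hK hVf hx (hV x hx) fun v => (hL T x hx v).1)
  rw [logInvNorm, Real.log_le_iff_le_exp hpos]
  refine restrictedNorm_neg_le hK hVf T hx (Real.exp_pos _).le fun w hw => ?_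
  rcases eq_or_ne w 0 with rfl | hw0
  · simp
  have ha : ∀ t : ℕ, 0 < ‖dIter f t x w‖ := fun t => norm_dIter_pos f t hw0
  have key := stopping_time_bound (a := fun t => Real.log ‖dIter f t x w‖)
    (b := fun t => (lateSet f K V c N).indicator 1 (f^[t] x)) (N := N) (T := T) hcL
    (fun t => indicator_nonneg (fun _ _ => zero_le_one) _)
    (fun t _ => by
      have h1 := (hL 1 _ (zIter_mem f hK t hx) (dIter f t x w)).2
      rw [← norm_dIter_add, Nat.cast_one, Nat.cast_one, mul_one] at h1
      have h2 := Real.log_le_log (ha t) h1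
      have h3 : (1 : ℤ) + t = ((t + 1 : ℕ) : ℤ) := by push_cast; ring
      rw [h3, Real.log_mul (Real.exp_pos _).ne' (ha (t + 1)).ne', Real.log_exp] at h2
      linarith)
    (fun t _ => by
      by_cases ht : f^[t] x ∈ lateSet f K V c N
      · left; simp [ht]
      right
      rw [← zIter_natCast] at ht
      have hmem := dIter_mem hK hVf t hx hw
      have hu := ha t
      have hnot : ¬∀ n : ℕ, 1 ≤ n → n ≤ N →
          ‖dIter f n (zIter f t x) (‖dIter f t x w‖⁻¹ • dIter f t x w)‖ ≤ Real.exp (c * n) :=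
        fun hall => ht ⟨zIter_mem f hK t hx, _, (V _).smul_mem _ hmem,
          by rw [norm_smul, norm_inv, norm_norm, inv_mul_cancel₀ hu.ne'], hall⟩
      push Not at hnot
      obtain ⟨n, h1, h2, h3⟩ := hnot
      refine ⟨n, h1, h2, fun _ => ?_⟩
      rw [map_smul, norm_smul, norm_inv, norm_norm, ← norm_dIter_add, lt_inv_mul_iff₀ hu] at h3
      have h4 := Real.log_le_log (mul_pos hu (Real.exp_pos _)) h3.le
      have h5 : (n : ℤ) + t = ((t + n : ℕ) : ℤ) := by push_cast; ring
      rwa [Real.log_mul hu.ne' (Real.exp_pos _).ne', Real.log_exp, h5] at h4)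
  have hzero : Real.log ‖dIter f ((0 : ℕ) : ℤ) x w‖ = Real.log ‖w‖ := by
    rw [Nat.cast_zero, norm_dIter_zero]
  have hw' : 0 < ‖w‖ := norm_pos_iff.2 hw0
  rw [← Real.log_le_log_iff hw' (mul_pos (Real.exp_pos _) (ha T)),
    Real.log_mul (Real.exp_pos _).ne' (ha T).ne', Real.log_exp]
  linarith

variable [IsManifold (𝓡 d) ∞ M]
  [IsContMDiffRiemannianBundle (𝓡 d) ∞ (EuclideanSpace ℝ (Fin d))
      (fun x : M => TangentSpace (𝓡 d) x)]

lemma IsContinuousSubbundleOn.isCompact_lateSet [T2Space M] (h : IsContinuousSubbundleOn K V)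
    (c : ℝ) (N : ℕ) : IsCompact (lateSet f K V c N) := by
  have hC : IsClosed {p : TangentBundle (𝓡 d) M | ∀ n : ℕ, 1 ≤ n → n ≤ N →
      ‖dIter f n p.1 p.2‖ ≤ Real.exp (c * n)} := by
    simp only [ofPred_forall]
    exact isClosed_iInter fun n => isClosed_iInter fun _ => isClosed_iInter fun _ =>
      isClosed_le (continuous_norm_dIter f n) continuous_const
  exact h.isCompact_setOf_exists_mem hC

/-- On a compact set without slow vectors in `V`, the expansion of `V` is uniform. -/
lemma IsContinuousSubbundleOn.exists_logInvNorm_le [T2Space M] (h : IsContinuousSubbundleOn K V)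
    (hK : IsFInvariant f K)
    (hVf : ∀ x ∈ K, (V x).map (mfderiv (𝓡 d) (𝓡 d) f x).toLinearMap = V (f x))
    (hV : ∀ x ∈ K, V x ≠ ⊥)
    (hL : ∀ n : ℕ, ∀ x ∈ K, ∀ v : TangentSpace (𝓡 d) x,
      ‖dIter f n x v‖ ≤ Real.exp (L * n) * ‖v‖ ∧ ‖v‖ ≤ Real.exp (L * n) * ‖dIter f n x v‖)
    (hcL : 0 ≤ c + L) {Γ : Set M} (hΓK : Γ ⊆ K) (hΓc : IsCompact Γ) (hΓ : IsFInvariant f Γ)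
    (hslow : ∀ x ∈ Γ, ∀ v ∈ V x, v ≠ 0 → v ∉ slowSpace f x c) :
    ∃ C : ℝ, ∀ x ∈ Γ, ∀ n : ℕ, logInvNorm f V n x ≤ C - c * n := by
  obtain ⟨N, hN⟩ : ∃ N, Γ ∩ lateSet f K V c N = ∅ := by
    by_contra! hcon
    have hcomp : ∀ N, IsCompact (Γ ∩ lateSet f K V c N) := fun N =>
      hΓc.inter (h.isCompact_lateSet c N)
    obtain ⟨x, hx⟩ := IsCompact.nonempty_iInter_of_sequence_nonempty_isCompact_isClosed
      (fun N => Γ ∩ lateSet f K V c N)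
      (fun N => inter_subset_inter_right _ (lateSet_antitone f K V c N.le_succ))
      (fun N => hcon N) (hcomp 0) (fun N => (hcomp N).isClosed)
    rw [mem_iInter] at hx
    obtain ⟨N, hN⟩ := exists_notMem_lateSet (K := K) (hslow x (hx 0).1)
    exact hN (hx N).2
  refine ⟨(c + L) * N, fun x hx n => ?_⟩
  have h1 := logInvNorm_le hK hVf hV hL hcL N n (hΓK hx)
  have h2 : ∑ t ∈ Finset.range n, (lateSet f K V c N).indicator (1 : M → ℝ) (f^[t] x) = 0 := by
    refine Finset.sum_eq_zero fun t _ => indicator_of_notMem (fun ht => ?_) _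
    have : f^[t] x ∈ Γ ∩ lateSet f K V c N := ⟨iterate_mem f hΓ t hx, ht⟩
    rw [hN] at this
    exact this
  rw [h2] at h1
  linarith

variable [MeasurableSpace M] [BorelSpace M]

/-- If almost no point of an ergodic measure has slow vectors in `V`, then `V` is uniformly
expanded in mean. -/
lemma IsContinuousSubbundleOn.eventually_integral_logInvNorm_le [T2Space M]
    (h : IsContinuousSubbundleOn K V) (hKc : IsCompact K) (hK : IsFInvariant f K)
    (hVf : ∀ x ∈ K, (V x).map (mfderiv (𝓡 d) (𝓡 d) f x).toLinearMap = V (f x))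
    (hV : ∀ x ∈ K, V x ≠ ⊥)
    (hL : ∀ n : ℕ, ∀ x ∈ K, ∀ v : TangentSpace (𝓡 d) x,
      ‖dIter f n x v‖ ≤ Real.exp (L * n) * ‖v‖ ∧ ‖v‖ ≤ Real.exp (L * n) * ‖dIter f n x v‖)
    (hL0 : 0 ≤ L) {μ : Measure M} (hμ : μ ∈ invMeasures f K) (hμe : Ergodic f μ)
    (hslow : ∀ᵐ x ∂μ, ∃ c > 0, ∀ v ∈ V x, v ≠ 0 → v ∉ slowSpace f x c) :
    ∃ c > 0, ∀ᶠ n : ℕ in atTop, ∫ x, logInvNorm f V n x ∂μ ≤ -c * n := by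
  obtain ⟨hμp, hμinv, hμK⟩ := hμ
  have hKae : ∀ᵐ x ∂μ, x ∈ K := by rwa [ae_iff]
  have hmeas : ∀ c N, MeasurableSet (lateSet f K V c N) := fun c N =>
    (h.isCompact_lateSet c N).measurableSet
  set H : ℕ → Set M := fun k => (⋂ N, lateSet f K V (1 / ((k : ℝ) + 1)) N)ᶜ
  have hH : ∀ k, MeasurableSet (H k) := fun k => (MeasurableSet.iInter fun N => hmeas _ N).compl
  -- Absence of slow vectors, with a uniform rate, propagates along the orbit.
  have hex : ∀ᵐ x ∂μ, ∃ k, ∀ j, f^[j] x ∈ H k := by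
    filter_upwards [hslow, hKae] with x ⟨c, hc, hx⟩ hxK
    obtain ⟨k, hk⟩ := exists_nat_one_div_lt hc
    refine ⟨k, fun j => ?_⟩
    rw [← zIter_natCast]
    simp only [H, mem_compl_iff, mem_iInter, not_forall]
    apply exists_notMem_lateSet
    intro w hw hw0 hwslow
    obtain ⟨u, hu, rfl⟩ := exists_dIter_eq hK hVf j hxK hw
    have hu0 : u ≠ 0 := by
      rintro rfl
      exact hw0 (map_zero _)
    refine hx u hu hu0 ?_
    intro c' hc'
    have h1 := hwslow c' (hk.trans hc')
    obtain ⟨n₀, hn₀⟩ := eventually_atTop.1 h1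
    filter_upwards [eventually_ge_atTop (n₀ + j)] with n hn
    obtain ⟨p, rfl⟩ := Nat.exists_eq_add_of_le' (le_of_add_le_right hn)
    have h2 := hn₀ p (by omega)
    rw [← norm_dIter_add] at h2
    rw [Nat.cast_add]
    refine h2.trans (Real.exp_le_exp.2 ?_)
    have : (0 : ℝ) ≤ j := j.cast_nonneg
    push_cast
    nlinarith
  obtain ⟨k, hk⟩ : ∃ k, ∀ᵐ x ∂μ, ∀ j, f^[j] x ∈ H k := by
    by_contra hcon
    rw [not_exists] at hcon
    have hall : ∀ k, ∀ᵐ x ∂μ, ∃ j, f^[j] x ∉ H k := fun k =>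
      (hμe.ae_forall_iterate_mem_or (hH k)).resolve_left (hcon k)
    obtain ⟨x, ⟨k, hx1⟩, hx2⟩ := (hex.and (ae_all_iff.2 hall)).exists
    obtain ⟨j, hj⟩ := hx2 k
    exact hj (hx1 j)
  set c : ℝ := 1 / ((k : ℝ) + 1)
  have hc : 0 < c := by positivity
  have hB0 : Tendsto (fun N => μ (lateSet f K V c N)) atTop (𝓝 0) := by
    apply tendsto_measure_antitone_zero (hmeas c) (lateSet_antitone f K V c)
    filter_upwards [hk] with x hx
    have h0 := hx 0
    simp only [H, mem_compl_iff, mem_iInter, not_forall] at h0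
    exact h0
  have hsub := h.isSubadditiveOn_logInvNorm hK hVf hV hL
  have := eventually_le_integral_of_stopping hμinv (hmeas c) hB0
    (Y := fun T x => -logInvNorm f V T x) (fun T => (hsub.integrable hKc hμK T).neg)
    (L := L) (half_lt_self hc) (fun N T => by
      filter_upwards [hKae] with x hx
      have := logInvNorm_le hK hVf hV hL (by linarith : 0 ≤ c + L) N T hx
      linarith)
  refine ⟨c / 2, by positivity, ?_⟩
  filter_upwards [this] with n hn
  rw [integral_neg] at hn
  linarith

end Expansion

/-! ### From norms to exponents -/

section Gap

open Module

variable {d : ℕ} {M : Type*} [TopologicalSpace M] [ChartedSpace (EuclideanSpace ℝ (Fin d)) M]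
  {f : M ≃ₘ^1⟮𝓡 d, 𝓡 d⟯ M}
  {K : Set M} {V E F : (x : M) → Submodule ℝ (TangentSpace (𝓡 d) x)} {m : ℕ} {x : M}

lemma eq_bot_or_ne_bot {n : ℕ} (h : ∀ x ∈ K, finrank ℝ (V x) = n) :
    (∀ x ∈ K, V x = ⊥) ∨ (∀ x ∈ K, V x ≠ ⊥) := by
  rcases Nat.eq_zero_or_pos n with rfl | hn
  · exact Or.inl fun x hx => Submodule.finrank_eq_zero.1 (h x hx)
  · refine Or.inr fun x hx hbot => ?_
    have := h x hx
    rw [hbot, finrank_bot] at this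
    omega

lemma IsInvariantSplitting.finrank_right (h : IsInvariantSplitting f K m E F) (hx : x ∈ K) :
    finrank ℝ (F x) = d - m := by
  have := Submodule.finrank_add_eq_of_isCompl (h x hx).1
  rw [finrank_tangentSpace, (h x hx).2.1] at this
  omega

variable [RiemannianBundle (fun x : M => TangentSpace (𝓡 d) x)]

/-- If all vectors of `V x` have negative exponents, so does the norm of `df^n` on `V x`. -/
lemma exists_logNorm_le (hV : V x ≠ ⊥) (h : ∀ v ∈ V x, ∃ c < 0, v ∈ slowSpace f x c) :
    ∃ c > 0, ∀ᶠ n : ℕ in atTop, logNorm f V n x ≤ -c * n := by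
  set b := Module.finBasis ℝ (V x)
  have hall : ∀ᶠ c in 𝓝[<] (0 : ℝ), ∀ i, (b i : TangentSpace (𝓡 d) x) ∈ slowSpace f x c := by
    rw [eventually_all]
    intro i
    obtain ⟨c, hc, hmem⟩ := h _ (b i).2
    filter_upwards [Ioo_mem_nhdsLT hc] with c' hc'
    exact slowSpace_mono hc'.1.le hmem
  obtain ⟨c, hc, hc0⟩ := (hall.and self_mem_nhdsWithin).exists
  replace hc0 : c < 0 := hc0
  set B : Fin (finrank ℝ (V x)) → (V x) →L[ℝ] ℝ := fun i =>
    LinearMap.toContinuousLinearMap (b.coord i)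
  have hev : ∀ᶠ n : ℕ in atTop, ∀ i,
      ‖dIter f n x (b i : TangentSpace (𝓡 d) x)‖ ≤ Real.exp (c / 2 * n) :=
    eventually_all.2 fun i => hc i _ (by linarith)
  refine ⟨-c / 4, by linarith, ?_⟩
  filter_upwards [hev, eventually_const_mul_exp_le (∑ i, ‖B i‖) (show c / 2 < c / 4 by linarith)]
    with n hn1 hn2
  have hbound : restrictedNorm f V n x ≤ Real.exp (c / 4 * n) := by
    refine restrictedNorm_le (Real.exp_pos _).le fun v hv => ?_
    have hsum : v = ∑ i, B i ⟨v, hv⟩ • (b i : TangentSpace (𝓡 d) x) := by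
      have := congrArg (Submodule.subtype (V x)) (b.sum_repr ⟨v, hv⟩)
      rw [map_sum] at this
      exact this.symm
    calc ‖dIter f n x v‖ = ‖∑ i, B i ⟨v, hv⟩ • dIter f n x (b i : TangentSpace (𝓡 d) x)‖ := by
          conv_lhs => rw [hsum]
          rw [map_sum]
          simp only [map_smul]
      _ ≤ ∑ i, ‖B i‖ * ‖v‖ * Real.exp (c / 2 * n) := by
          refine norm_sum_le_of_le _ fun i _ => ?_
          rw [norm_smul]
          exact mul_le_mul ((B i).le_opNorm ⟨v, hv⟩) (hn1 i) (norm_nonneg _) (by positivity)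
      _ = (∑ i, ‖B i‖) * Real.exp (c / 2 * n) * ‖v‖ := by
          rw [Finset.sum_mul, Finset.sum_mul]
          exact Finset.sum_congr rfl fun i _ => by ring
      _ ≤ _ := by gcongr
  have hpos : 0 < restrictedNorm f V n x := by
    obtain ⟨v, hv, hv0⟩ := Submodule.exists_mem_ne_zero_of_ne_bot hV
    have h1 := (norm_dIter_pos f n hv0).trans_le (norm_dIter_le_restrictedNorm n hv)
    exact pos_of_mul_pos_left h1 (norm_nonneg _)
  rw [logNorm, show -(-c / 4) * (n : ℝ) = c / 4 * n by ring, Real.log_le_iff_le_exp hpos]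
  exact hbound

/-- If the norm of `df^n` on `V x` decays exponentially, all vectors of `V x` have negative
exponents. -/
lemma le_slowSpace_of_logNorm {c : ℝ} (h : ∀ᶠ n : ℕ in atTop, logNorm f V n x ≤ -c * n) :
    V x ≤ slowSpace f x (-c) := fun v hv => by
  refine mem_slowSpace_of_exp ‖v‖ ?_
  filter_upwards [h] with n hn
  refine (norm_dIter_le_restrictedNorm n hv).trans ?_
  rw [mul_comm]
  gcongr
  exact (Real.le_exp_log _).trans (Real.exp_le_exp.2 hn)

/-- If the norm of `(df^n)⁻¹` on `V` decays exponentially, the nonzero vectors of `V x` have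
exponents bounded away from `0`. -/
lemma notMem_slowSpace_of_logInvNorm (hK : IsFInvariant f K)
    (hVf : ∀ x ∈ K, (V x).map (mfderiv (𝓡 d) (𝓡 d) f x).toLinearMap = V (f x))
    (hx : x ∈ K) {c : ℝ} (hc : 0 < c)
    (h : ∀ᶠ n : ℕ in atTop, logInvNorm f V n x ≤ -c * n) (w : TangentSpace (𝓡 d) x) (hw : w ∈ V x)
    (hw0 : w ≠ 0) : w ∉ slowSpace f x (c / 2) := by
  refine notMem_slowSpace_of_exp (c := c) (C := 1) (by linarith) hw0 ?_
  filter_upwards [h] with n hn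
  refine (norm_le_restrictedNorm_neg hK hVf n hx hw).trans ?_
  gcongr
  rw [one_mul, ← neg_mul]
  exact (Real.le_exp_log _).trans (Real.exp_le_exp.2 hn)

variable [MeasurableSpace M] {ν : Measure M}

/-- The maximal exponent exists and is below `-l`; it is `-∞` for the zero bundle. -/
lemma exists_isMaxExponent_lt (hν : ν Kᶜ = 0) {l : ℝ}
    (h : (∀ x ∈ K, V x = ⊥) ∨ (∀ x ∈ K, V x ≠ ⊥) ∧ (∀ n, Integrable (logNorm f V n) ν) ∧
      ∃ a : ℝ, Tendsto (fun n : ℕ => 1 / (n : ℝ) * ∫ x, logNorm f V n x ∂ν) atTop (𝓝 a) ∧ a < -l) :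
    ∃ a, IsMaxExponent f V ν a ∧ a < ((-l : ℝ) : EReal) := by
  have hae : ∀ᵐ x ∂ν, x ∈ K := by rwa [ae_iff]
  rcases h with h | ⟨h, hi, a, ha, hal⟩
  · exact ⟨⊥, Or.inl ⟨hae.mono h, rfl⟩, EReal.bot_lt_coe _⟩
  · exact ⟨a, Or.inr ⟨hae.mono h, hi, (continuous_coe_real_ereal.tendsto a).comp ha⟩,
      EReal.coe_lt_coe_iff.2 hal⟩

/-- The minimal exponent exists and is above `l`; it is the opposite of the limit of the means of
`log ‖(df^n_{/V})⁻¹‖`, and it is `+∞` for the zero bundle. -/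
lemma exists_lt_isMinExponent (hν : ν Kᶜ = 0) {l : ℝ}
    (h : (∀ x ∈ K, V x = ⊥) ∨ (∀ x ∈ K, V x ≠ ⊥) ∧ (∀ n, Integrable (logInvNorm f V n) ν) ∧
      ∃ a : ℝ, Tendsto (fun n : ℕ => 1 / (n : ℝ) * ∫ x, logInvNorm f V n x ∂ν) atTop (𝓝 a) ∧
        a < -l) :
    ∃ b, IsMinExponent f V ν b ∧ (l : EReal) < b := by
  have hae : ∀ᵐ x ∂ν, x ∈ K := by rwa [ae_iff]
  have hinv : ∀ (n : ℕ) (x : M), Real.log (restrictedNorm f V (-n) (zIter f n x))⁻¹ =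
      -logInvNorm f V n x := fun n x => Real.log_inv _
  rcases h with h | ⟨h, hi, a, ha, hal⟩
  · exact ⟨⊤, Or.inl ⟨hae.mono h, rfl⟩, EReal.coe_lt_top _⟩
  · refine ⟨(-a : ℝ), Or.inr ⟨hae.mono h, fun n => ?_, ?_⟩, EReal.coe_lt_coe_iff.2 (by linarith)⟩
    · simp only [hinv]
      exact (hi n).neg
    · refine (continuous_coe_real_ereal.tendsto (-a)).comp (ha.neg.congr fun n => ?_)
      simp only [hinv]
      rw [integral_neg]
      ring

end Gap

/-! ### Integrals over neighborhoods and simplices of measures -/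

section Robustness

variable {X : Type*} [TopologicalSpace X] [T2Space X] [MeasurableSpace X] [BorelSpace X]
  {K : Set X}

/-- An upper bound for the integral of a continuous function over a set of measures persists, up to
an arbitrarily small loss, in a uniform neighborhood of that set. -/
lemma exists_weakStarDist_integral_lt (hK : IsCompact K) {φ : ℕ → C(K, ℝ)} (hφ : DenseRange φ)
    {h : X → ℝ} (hh : ContinuousOn h K) {S : Set (Measure X)}
    (hS : ∀ η ∈ S, IsProbabilityMeasure η ∧ η Kᶜ = 0) {a b : ℝ} (hab : a < b)
    (ha : ∀ η ∈ S, ∫ x, h x ∂η ≤ a) :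
    ∃ κ > 0, ∀ ν : Measure X, IsProbabilityMeasure ν → ν Kᶜ = 0 →
      (∃ η ∈ S, weakStarDist φ ν η < κ) → ∫ x, h x ∂ν < b := by
  obtain ⟨κ, hκ, hκ'⟩ := exists_weakStarDist_lt_integral hK hφ hh (sub_pos.2 hab)
  refine ⟨κ, hκ, fun ν hν hνK ⟨η, hη, hdist⟩ => ?_⟩
  have h1 := (abs_lt.1 (hκ' ν η hν (hS η hη).1 hνK (hS η hη).2 hdist)).2
  have h2 := ha η hη
  linarith

end Robustness

section SimplexIntegral

variable {X : Type*} [MeasurableSpace X] {k : ℕ} {μ : Fin k → Measure X} {η : Measure X}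

lemma isProbabilityMeasure_of_mem_measureSimplex (h : η ∈ measureSimplex μ)
    (hμ : ∀ i, IsProbabilityMeasure (μ i)) : IsProbabilityMeasure η := by
  obtain ⟨s, hs, rfl⟩ := h
  constructor
  simp only [Measure.coe_finsetSum, Finset.sum_apply, Measure.smul_apply, measure_univ]
  simp only [ENNReal.smul_def, smul_eq_mul, mul_one]
  exact_mod_cast hs

lemma measure_eq_zero_of_mem_measureSimplex (h : η ∈ measureSimplex μ) {A : Set X}
    (hμ : ∀ i, μ i A = 0) : η A = 0 := by
  obtain ⟨s, hs, rfl⟩ := h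
  simp [hμ]

lemma integral_le_of_mem_measureSimplex (h : η ∈ measureSimplex μ) {ψ : X → ℝ} {a : ℝ}
    (hi : ∀ i, Integrable ψ (μ i)) (hμ : ∀ i, ∫ x, ψ x ∂(μ i) ≤ a) : ∫ x, ψ x ∂η ≤ a := by
  obtain ⟨s, hs, rfl⟩ := h
  have hs' : ∑ i, (s i : ℝ) = 1 := by exact_mod_cast hs
  rw [integral_finsetSum_measure fun i _ => (hi i).smul_measure_nnreal]
  simp only [integral_smul_nnreal_measure]
  calc ∑ i, s i • ∫ x, ψ x ∂(μ i) ≤ ∑ i, (s i : ℝ) * a :=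
        Finset.sum_le_sum fun i _ => mul_le_mul_of_nonneg_left (hμ i) (s i).2
    _ = a := by rw [← Finset.sum_mul, hs', one_mul]

end SimplexIntegral

/-! ### Exponent gaps near contracting and expanding measures -/

section Main

open Module

variable {d : ℕ} {M : Type*} [TopologicalSpace M] [T2Space M]
  [ChartedSpace (EuclideanSpace ℝ (Fin d)) M] [IsManifold (𝓡 d) ∞ M]
  [RiemannianBundle (fun x : M => TangentSpace (𝓡 d) x)]
  [IsContMDiffRiemannianBundle (𝓡 d) ∞ (EuclideanSpace ℝ (Fin d))
      (fun x : M => TangentSpace (𝓡 d) x)]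
  {f : M ≃ₘ^1⟮𝓡 d, 𝓡 d⟯ M} {K : Set M} {m : ℕ}
  {E F : (x : M) → Submodule ℝ (TangentSpace (𝓡 d) x)}

/-- Over a hyperbolic set of index `dim E`, the bundle `E` is uniformly contracted and `F` is
uniformly expanded. -/
lemma IsDominatedSplitting.exists_uniform_of_hyperbolicSet (h : IsDominatedSplitting f K m E F)
    (hKc : IsCompact K) (hK : IsFInvariant f K) {Γ : Set M} (hΓK : Γ ⊆ K) (hΓc : IsCompact Γ)
    (hΓ : IsFInvariant f Γ) (hhyp : IsHyperbolicSet f Γ m) :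
    ∃ c > 0, ∃ n₀ : ℕ, n₀ ≠ 0 ∧
      ((∀ x ∈ K, E x ≠ ⊥) → ∀ x ∈ Γ, logNorm f E n₀ x ≤ -c * n₀) ∧
      ((∀ x ∈ K, F x ≠ ⊥) → ∀ x ∈ Γ, logInvNorm f F n₀ x ≤ -c * n₀) := by
  obtain ⟨L, hL0, hL⟩ := exists_growth_bound f hKc hK
  obtain ⟨hEc, hFc⟩ := h.isContinuousSubbundleOn hKc hK
  have hFf := fun x hx => (h.1 x hx).2.2.2
  obtain ⟨Es, Eu, hinv, C, hC, l, hl, hexp⟩ := hhyp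
  have hpt : ∀ x ∈ Γ, Es x = E x ∧ ∀ w ∈ F x, w ≠ 0 → w ∉ slowSpace f x (l / 2) := fun x hx =>
    hyperbolicSet_of_dominated hΓ hinv hl hexp hx (h.isDominatedAt hK hL hL0 (hΓK hx))
      (h.1 x (hΓK hx)).2.1
  have hlin : ∀ A : ℝ, ∀ᶠ n : ℕ in atTop, A - l / 2 * n ≤ -(l / 4) * n := by
    intro A
    have : Tendsto (fun n : ℕ => l / 4 * (n : ℝ)) atTop atTop :=
      tendsto_natCast_atTop_atTop.const_mul_atTop (by linarith)
    filter_upwards [this.eventually_ge_atTop A] with n hn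
    linarith
  have hEn : ∀ᶠ n : ℕ in atTop, (∀ x ∈ K, E x ≠ ⊥) →
      ∀ x ∈ Γ, logNorm f E n x ≤ -(l / 4) * n := by
    filter_upwards [hlin (Real.log C)] with n hn hEb x hx
    have hpos := (Real.exp_pos _).trans_le
      (exp_neg_le_restrictedNorm (f := f) (hEb x (hΓK hx)) fun v => (hL n x (hΓK hx) v).2)
    have h1 : restrictedNorm f E n x ≤ C * Real.exp (-(n * l)) :=
      restrictedNorm_le (by positivity) fun v hv => (hexp x hx n).1 v ((hpt x hx).1 ▸ hv)
    have h2 := Real.log_le_log hpos h1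
    rw [Real.log_mul hC.ne' (Real.exp_pos _).ne', Real.log_exp] at h2
    have : 0 ≤ l * n := by positivity
    rw [logNorm]
    linarith
  have hFn : ∀ᶠ n : ℕ in atTop, (∀ x ∈ K, F x ≠ ⊥) →
      ∀ x ∈ Γ, logInvNorm f F n x ≤ -(l / 4) * n := by
    by_cases hFb : ∀ x ∈ K, F x ≠ ⊥
    · obtain ⟨A, hA⟩ := hFc.exists_logInvNorm_le hK hFf hFb hL (by linarith : 0 ≤ l / 2 + L) hΓK hΓc
        hΓ fun x hx => (hpt x hx).2
      filter_upwards [hlin A] with n hn _ x hx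
      exact (hA x hx n).trans hn
    · exact Eventually.of_forall fun n h => absurd h hFb
  obtain ⟨n₀, h1, h2, h3⟩ := (hEn.and (hFn.and (eventually_ge_atTop 1))).exists
  exact ⟨l / 4, by positivity, n₀, by omega, h1, h2⟩

variable [MeasurableSpace M] [BorelSpace M]

/-- If, at some time `n₀`, the mean contraction of `E` and the mean expansion of `F` are bounded
over a set `S` of measures, then the invariant measures close to `S` have an exponent gap. -/
lemma IsDominatedSplitting.exists_exponentGap (h : IsDominatedSplitting f K m E F)
    (hKc : IsCompact K) (hK : IsFInvariant f K) {φ : ℕ → C(K, ℝ)} (hφ : DenseRange φ)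
    {S : Set (Measure M)} (hS : ∀ η ∈ S, IsProbabilityMeasure η ∧ η Kᶜ = 0) {c : ℝ} (hc : 0 < c)
    {n₀ : ℕ} (hn₀ : n₀ ≠ 0)
    (hE : (∀ x ∈ K, E x ≠ ⊥) → ∀ η ∈ S, ∫ x, logNorm f E n₀ x ∂η ≤ -c * n₀)
    (hF : (∀ x ∈ K, F x ≠ ⊥) → ∀ η ∈ S, ∫ x, logInvNorm f F n₀ x ∂η ≤ -c * n₀) :
    ∃ κ > 0, ∃ l > 0, ∀ ν ∈ invMeasures f K, (∃ η ∈ S, weakStarDist φ ν η < κ) →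
      ExponentGap f E F ν l ∧ ((∀ x ∈ K, E x ≠ ⊥) → ∫ x, logNorm f E n₀ x ∂ν < 0) ∧
      ((∀ x ∈ K, F x ≠ ⊥) → ∫ x, logInvNorm f F n₀ x ∂ν < 0) := by
  obtain ⟨L, -, hL⟩ := exists_growth_bound f hKc hK
  obtain ⟨hEc, hFc⟩ := h.isContinuousSubbundleOn hKc hK
  have hn₀' : (0 : ℝ) < n₀ := by exact_mod_cast Nat.pos_of_ne_zero hn₀
  have hlt : -c * n₀ < -(c / 2) * n₀ := by nlinarith
  have hneg : -(c / 2) * n₀ < 0 := by nlinarith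
  have hEf := fun x hx => (h.1 x hx).2.2.1
  have hFf := fun x hx => (h.1 x hx).2.2.2
  -- The conclusion for one bundle, either trivial or with a negative mean at time `n₀`.
  have hone : ∀ (V : (x : M) → Submodule ℝ (TangentSpace (𝓡 d) x)) (ψ : ℕ → M → ℝ),
      ((∀ x ∈ K, V x = ⊥) ∨ (∀ x ∈ K, V x ≠ ⊥)) →
      ((∀ x ∈ K, V x ≠ ⊥) → IsSubadditiveOn f K ψ L) →
      ((∀ x ∈ K, V x ≠ ⊥) → ∀ η ∈ S, ∫ x, ψ n₀ x ∂η ≤ -c * n₀) →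
      ∃ κ > 0, ∀ ν ∈ invMeasures f K, (∃ η ∈ S, weakStarDist φ ν η < κ) →
        ((∀ x ∈ K, V x = ⊥) ∨ (∀ x ∈ K, V x ≠ ⊥) ∧ (∀ n, Integrable (ψ n) ν) ∧
          ∃ a : ℝ, Tendsto (fun n : ℕ => 1 / (n : ℝ) * ∫ x, ψ n x ∂ν) atTop (𝓝 a) ∧
            a < -(c / 2)) ∧
        ((∀ x ∈ K, V x ≠ ⊥) → ∫ x, ψ n₀ x ∂ν < 0) := by
    intro V ψ hdich hsub hint
    by_cases hV : ∀ x ∈ K, V x ≠ ⊥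
    · obtain ⟨κ, hκ, hκ'⟩ := exists_weakStarDist_integral_lt hKc hφ ((hsub hV).continuousOn n₀) hS
        hlt (hint hV)
      refine ⟨κ, hκ, fun ν ⟨hνp, hνi, hνK⟩ hd => ?_⟩
      have h1 := hκ' ν hνp hνK hd
      obtain ⟨a, ha, hle⟩ := (hsub hV).exists_tendsto hKc hνK hνi
      refine ⟨Or.inr ⟨hV, (hsub hV).integrable hKc hνK, a, ha, ?_⟩, fun _ => h1.trans hneg⟩
      refine (hle n₀ hn₀).trans_lt ?_
      rwa [div_lt_iff₀ hn₀']
    · exact ⟨1, one_pos, fun ν _ _ => ⟨Or.inl (hdich.resolve_right hV), fun h => absurd h hV⟩⟩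
  obtain ⟨κ₁, hκ₁, h₁⟩ := hone E (logNorm f E) (eq_bot_or_ne_bot fun x hx => (h.1 x hx).2.1)
    (fun hV => hEc.isSubadditiveOn_logNorm hK hEf hV hL) hE
  obtain ⟨κ₂, hκ₂, h₂⟩ := hone F (logInvNorm f F)
    (eq_bot_or_ne_bot fun x hx => h.1.finrank_right hx)
    (fun hV => hFc.isSubadditiveOn_logInvNorm hK hFf hV hL) hF
  refine ⟨min κ₁ κ₂, lt_min hκ₁ hκ₂, c / 2, by positivity, fun ν hν ⟨η, hη, hd⟩ => ?_⟩
  obtain ⟨a₁, b₁⟩ := h₁ ν hν ⟨η, hη, hd.trans_le (min_le_left _ _)⟩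
  obtain ⟨a₂, b₂⟩ := h₂ ν hν ⟨η, hη, hd.trans_le (min_le_right _ _)⟩
  obtain ⟨a, ha, hal⟩ := exists_isMaxExponent_lt hν.2.2 a₁
  obtain ⟨b, hb, hbl⟩ := exists_lt_isMinExponent hν.2.2 a₂
  exact ⟨⟨a, b, ha, hb, hal, hbl⟩, b₁, b₂⟩

/-- An ergodic measure with negative mean at some time of `log ‖df^n_{/E}‖` and
`log ‖(df^n_{/F})⁻¹‖` is hyperbolic. -/
lemma IsDominatedSplitting.isHyperbolicMeasure (h : IsDominatedSplitting f K m E F)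
    (hKc : IsCompact K) (hK : IsFInvariant f K) (hEb : ∀ x ∈ K, E x ≠ ⊥) (hFb : ∀ x ∈ K, F x ≠ ⊥)
    {ν : Measure M} (hν : ν ∈ invMeasures f K) (hνe : Ergodic f ν) {n₀ : ℕ} (hn₀ : n₀ ≠ 0)
    (hE : ∫ x, logNorm f E n₀ x ∂ν < 0) (hF : ∫ x, logInvNorm f F n₀ x ∂ν < 0) :
    IsHyperbolicMeasure f ν m := by
  obtain ⟨hνp, -, hνK⟩ := hν
  obtain ⟨L, hL0, hL⟩ := exists_growth_bound f hKc hK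
  obtain ⟨hEc, hFc⟩ := h.isContinuousSubbundleOn hKc hK
  have hEf := fun x hx => (h.1 x hx).2.2.1
  have hFf := fun x hx => (h.1 x hx).2.2.2
  have hit := fun n x hx => iterate_mem f hK n (x := x) hx
  have h1 := (hEc.isSubadditiveOn_logNorm hK hEf hEb hL).ae_eventually_le hKc hνK hit hνe hn₀ hE
  have h2 := (hFc.isSubadditiveOn_logInvNorm hK hFf hFb hL).ae_eventually_le hKc hνK hit hνe hn₀ hF
  filter_upwards [h1, h2, show ∀ᵐ x ∂ν, x ∈ K by rwa [ae_iff]] with x ⟨c, hc, hx1⟩ ⟨c', hc', hx2⟩ hx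
  obtain ⟨hhyp, hst⟩ := (h.isDominatedAt hK hL hL0 hx).isHyperbolicPoint (hEb x hx) (hFb x hx)
    (c := -c) (c' := c' / 2) (by linarith) (by linarith) (le_slowSpace_of_logNorm hx1)
    (notMem_slowSpace_of_logInvNorm hK hFf hx hc' hx2)
  exact ⟨hhyp, by rw [hst, (h.1 x hx).2.1]⟩

/-- For an ergodic hyperbolic measure of index `dim E`, the bundle `E` is contracted in mean and
`F` is expanded in mean. -/
lemma IsDominatedSplitting.eventually_integral_le (h : IsDominatedSplitting f K m E F)
    (hKc : IsCompact K) (hK : IsFInvariant f K) {μ : Measure M} (hμ : μ ∈ invMeasures f K)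
    (hμe : Ergodic f μ) (hμh : IsHyperbolicMeasure f μ m) :
    (∀ x ∈ K, E x ≠ ⊥) ∧ (∀ x ∈ K, F x ≠ ⊥) ∧
    ∃ c > 0, ∀ᶠ n : ℕ in atTop, ∫ x, logNorm f E n x ∂μ ≤ -c * n ∧
      ∫ x, logInvNorm f F n x ∂μ ≤ -c * n := by
  have hμ' := hμ
  obtain ⟨hμp, -, hμK⟩ := hμ'
  obtain ⟨L, hL0, hL⟩ := exists_growth_bound f hKc hK
  obtain ⟨hEc, hFc⟩ := h.isContinuousSubbundleOn hKc hK
  have hEf := fun x hx => (h.1 x hx).2.2.1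
  have hFf := fun x hx => (h.1 x hx).2.2.2
  have hgood : ∀ᵐ x ∂μ, x ∈ K ∧ IsHyperbolicPoint f x ∧ stableSpace f x = E x := by
    filter_upwards [hμh, show ∀ᵐ x ∂μ, x ∈ K by rwa [ae_iff]] with x ⟨h1, h2⟩ hx
    exact ⟨hx, h1, (h.isDominatedAt hK hL hL0 hx).stableSpace_eq (by rw [h2, (h.1 x hx).2.1])⟩
  obtain ⟨x, hx, hhyp, hst⟩ := hgood.exists
  have hEb : ∀ x ∈ K, E x ≠ ⊥ := by
    refine (eq_bot_or_ne_bot fun x hx => (h.1 x hx).2.1).resolve_left fun hbot => ?_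
    obtain ⟨v, hv0, hv⟩ := hhyp.2.1
    have : v ∈ E x := hst ▸ mem_stableSpace_iff.2 ((lyapunovExponent_neg_iff hv0).1 hv)
    rw [hbot x hx] at this
    exact hv0 this
  have hFb : ∀ x ∈ K, F x ≠ ⊥ := by
    refine (eq_bot_or_ne_bot fun x hx => h.1.finrank_right hx).resolve_left fun hbot => ?_
    obtain ⟨v, hv0, hv⟩ := hhyp.2.2
    have htop := (h.1 x hx).1.sup_eq_top
    rw [hbot x hx, sup_bot_eq] at htop
    have : v ∈ stableSpace f x := by rw [hst, htop]; exact Submodule.mem_top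
    exact (hv.trans ((lyapunovExponent_neg_iff hv0).2 (mem_stableSpace_iff.1 this))).false
  refine ⟨hEb, hFb, ?_⟩
  obtain ⟨c, hc, hcE⟩ := (hEc.isSubadditiveOn_logNorm hK hEf hEb hL).eventually_integral_le hKc hμK
    (by
      filter_upwards [hgood] with x ⟨hx, _, hst⟩
      refine exists_logNorm_le (hEb x hx) fun v hv => ?_
      rw [← hst] at hv
      exact mem_stableSpace_iff.1 hv)
  obtain ⟨c', hc', hcF⟩ := hFc.eventually_integral_logInvNorm_le hKc hK hFf hFb hL hL0 hμ hμe
    (by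
      filter_upwards [hgood] with x ⟨hx, hhyp, hst⟩
      exact (h.isDominatedAt hK hL hL0 hx).exists_notMem_slowSpace hhyp hst)
  refine ⟨min c c', lt_min hc hc', ?_⟩
  filter_upwards [hcE, hcF] with n h1 h2
  have h3 : min c c' * n ≤ c * n := by gcongr; exact min_le_left _ _
  have h4 : min c c' * n ≤ c' * n := by gcongr; exact min_le_right _ _
  constructor <;> linarith

end Main

end

theorem mainTheorem5 {d : ℕ} {M : Type*} [TopologicalSpace M] [T2Space M]
    [SecondCountableTopology M] [ChartedSpace (EuclideanSpace ℝ (Fin d)) M]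
    [IsManifold (𝓡 d) ∞ M] [RiemannianBundle (fun x : M => TangentSpace (𝓡 d) x)]
    [IsContMDiffRiemannianBundle (𝓡 d) ∞ (EuclideanSpace ℝ (Fin d))
      (fun x : M => TangentSpace (𝓡 d) x)]
    [MeasurableSpace M] [BorelSpace M]
    (f : M ≃ₘ^1⟮𝓡 d, 𝓡 d⟯ M)
    (Λ : Set M) (hΛ : IsCompact Λ) (hΛf : IsFInvariant f Λ)
    (m : ℕ) (E F : (x : M) → Submodule ℝ (TangentSpace (𝓡 d) x))
    (hEF : IsDominatedSplitting f Λ m E F)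
    -- a dominated extension: the splitting `E'`, `F'` over the (compact) maximal invariant set
    -- of a neighborhood `U` of `Λ` extends `E`, `F`
    (U : Set M) (hU : U ∈ 𝓝ˢ Λ) (hUc : IsCompact (maxInvariant f U))
    (E' F' : (x : M) → Submodule ℝ (TangentSpace (𝓡 d) x))
    (hEF' : IsDominatedSplitting f (maxInvariant f U) m E' F')
    (hext : ∀ x ∈ Λ, E' x = E x ∧ F' x = F x)
    -- the sequence of functions that defines the distance on the space of measures
    (φ : ℕ → C(maxInvariant f U, ℝ)) (hφ : DenseRange φ) :
    (∀ (k : ℕ) (μ : Fin k → Measure M),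
      (∀ i, μ i ∈ invMeasures f Λ ∧ Ergodic f (μ i) ∧ IsHyperbolicMeasure f (μ i) m) →
      ∃ κ > (0 : ℝ), ∃ l > (0 : ℝ), ∀ ν ∈ invMeasures f (maxInvariant f U),
        (∃ η ∈ measureSimplex μ, weakStarDist φ ν η < κ) →
        (Ergodic f ν → IsHyperbolicMeasure f ν m) ∧ ExponentGap f E' F' ν l) ∧
    (∀ Γ : Set M, Γ ⊆ Λ → IsCompact Γ → IsFInvariant f Γ → IsHyperbolicSet f Γ m →
      ∃ κ > (0 : ℝ), ∃ l > (0 : ℝ), ∀ ν ∈ invMeasures f (maxInvariant f U),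
        (∃ η ∈ invMeasures f Γ, weakStarDist φ ν η < κ) →
        ExponentGap f E' F' ν l) := by
  have hK := isFInvariant_maxInvariant f U
  have hΛK : Λ ⊆ maxInvariant f U := subset_maxInvariant f hΛf (subset_of_mem_nhdsSet hU)
  obtain ⟨L, -, hL⟩ := exists_growth_bound f hUc hK
  obtain ⟨hEc, hFc⟩ := hEF'.isContinuousSubbundleOn hUc hK
  have hEf := fun x hx => (hEF'.1 x hx).2.2.1
  have hFf := fun x hx => (hEF'.1 x hx).2.2.2
  have hmono : ∀ {A : Set M}, A ⊆ Λ → invMeasures f A ⊆ invMeasures f (maxInvariant f U) :=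
    fun hA ν hν => ⟨hν.1, hν.2.1,
      measure_mono_null (compl_subset_compl.2 (hA.trans hΛK)) hν.2.2⟩
  constructor
  · intro k μ hμ
    -- For `k = 0` the simplex is empty.
    rcases Nat.eq_zero_or_pos k with rfl | hk
    · refine ⟨1, one_pos, 1, one_pos, fun ν _ ⟨η, ⟨s, hs, _⟩, _⟩ => ?_⟩
      simp at hs
    have hmeas := fun i => hmono le_rfl (hμ i).1
    have hint := fun i => hEF'.eventually_integral_le hUc hK (hmeas i) (hμ i).2.1 (hμ i).2.2
    obtain ⟨hEb, hFb, -⟩ := hint ⟨0, hk⟩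
    have hall : ∀ᶠ c in 𝓝[>] (0 : ℝ), ∀ i, ∀ᶠ n : ℕ in atTop,
        ∫ x, logNorm f E' n x ∂(μ i) ≤ -c * n ∧ ∫ x, logInvNorm f F' n x ∂(μ i) ≤ -c * n := by
      rw [eventually_all]
      intro i
      obtain ⟨-, -, c, hc, hev⟩ := hint i
      filter_upwards [Ioo_mem_nhdsGT hc] with c' hc'
      filter_upwards [hev] with n hn
      have : c' * n ≤ c * n := by gcongr; exact hc'.2.le
      constructor <;> linarith [hn.1, hn.2]
    -- A rate `c` and a time `n₀` that suit all the measures `μ i`.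
    obtain ⟨c, hcall, hc⟩ := (hall.and self_mem_nhdsWithin).exists
    replace hc : 0 < c := hc
    obtain ⟨n₀, hn₀, hn₀'⟩ := ((eventually_all.2 hcall).and (eventually_ge_atTop 1)).exists
    have hn₀0 : n₀ ≠ 0 := by omega
    have hp := fun i => (hmeas i).1
    have hEs := hEc.isSubadditiveOn_logNorm hK hEf hEb hL
    have hFs := hFc.isSubadditiveOn_logInvNorm hK hFf hFb hL
    obtain ⟨κ, hκ, l, hl, hgap⟩ := hEF'.exists_exponentGap hUc hK hφ (S := measureSimplex μ)
      (fun η hη => ⟨isProbabilityMeasure_of_mem_measureSimplex hη hp,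
        measure_eq_zero_of_mem_measureSimplex hη fun i => (hmeas i).2.2⟩) hc hn₀0
      (fun _ η hη => integral_le_of_mem_measureSimplex hη
        (fun i => hEs.integrable hUc (hmeas i).2.2 n₀) fun i => (hn₀ i).1)
      (fun _ η hη => integral_le_of_mem_measureSimplex hη
        (fun i => hFs.integrable hUc (hmeas i).2.2 n₀) fun i => (hn₀ i).2)
    refine ⟨κ, hκ, l, hl, fun ν hν hd => ?_⟩
    obtain ⟨h1, h2, h3⟩ := hgap ν hν hd
    exact ⟨fun hνe => hEF'.isHyperbolicMeasure hUc hK hEb hFb hν hνe hn₀0 (h2 hEb) (h3 hFb), h1⟩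
  · intro Γ hΓΛ hΓc hΓ hhyp
    obtain ⟨c, hc, n₀, hn₀, hE, hF⟩ := hEF'.exists_uniform_of_hyperbolicSet hUc hK
      (hΓΛ.trans hΛK) hΓc hΓ hhyp
    have hbound : ∀ η ∈ invMeasures f Γ, ∀ ψ : M → ℝ, Integrable ψ η →
        (∀ x ∈ Γ, ψ x ≤ -c * n₀) → ∫ x, ψ x ∂η ≤ -c * n₀ := by
      intro η ⟨hηp, _, hηΓ⟩ ψ hψ hle
      have := integral_mono_ae hψ (integrable_const (-c * n₀)) (by
        filter_upwards [show ∀ᵐ x ∂η, x ∈ Γ by rwa [ae_iff]] with x hx using hle x hx)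
      simpa using this
    obtain ⟨κ, hκ, l, hl, hgap⟩ := hEF'.exists_exponentGap hUc hK hφ (S := invMeasures f Γ)
      (fun η hη => ⟨hη.1, (hmono hΓΛ hη).2.2⟩) hc hn₀
      (fun hEb η hη => by
        have := hη.1
        exact hbound η hη _ ((hEc.isSubadditiveOn_logNorm hK hEf hEb hL).integrable hUc
          (hmono hΓΛ hη).2.2 n₀) (hE hEb))
      (fun hFb η hη => by
        have := hη.1
        exact hbound η hη _ ((hFc.isSubadditiveOn_logInvNorm hK hFf hFb hL).integrable hUc
          (hmono hΓΛ hη).2.2 n₀) (hF hFb))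
    exact ⟨κ, hκ, l, hl, fun ν hν hd => (hgap ν hν hd).1⟩
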